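/- Fix a prime $p$; all groups, categories and partial groups below are finite. Conventions. Let $\mathcal F$ be a fusion system over a $p$-group $S$ and $\Delta$ a nonempty set of subgroups of $S$, closed under $\mathcal F$-conjugacy and passing to overgroups. $\mathcal T_\Delta(S)$ is the category with object set $\Delta$, morphisms $N_S(P,Q)=\{g\in S: gPg^{-1}\le Q\}$ and composition given by multiplication. A *transporter system* associated with $\mathcal F$ (in the sense of Oliver and Ventura) is a category $\mathcal T$ with object set $\Delta$ and functors $\mathcal T_\Delta(S)\xrightarrow{\delta}\mathcal T\xrightarrow{\pi}\mathcal F$, the identity and the inclusion on objects, such that, with $E(P)=\ker(\mathrm{Aut}_{\mathcal T}(P)\to \mathrm{Aut}_{\mathcal F}(P))$ and $\delta_P=\delta_{P,P}$: (A2) $E(P)$ acts freely on $\mathrm{Mor}_{\mathcal T}(P,Q)$ by right composition with orbit map $\pi_{P,Q}$ onto $\mathrm{Hom}_{\mathcal F}(P,Q)$, and $E(Q)$ acts freely by left composition; (B) each $\delta_{P,Q}$ is injective and $\pi(\delta_{P,Q}(g))=c_g$; (C) $\varphi\circ\delta_P(g)=\delta_Q(\pi(\varphi)(g))\circ\varphi$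 for $\varphi\in\mathrm{Mor}_{\mathcal T}(P,Q)$, $g\in P$; (I) $\delta_S(S)$ is a Sylow $p$-subgroup of $\mathrm{Aut}_{\mathcal T}(S)$; (II) if $\varphi\in\mathrm{Iso}_{\mathcal T}(P,Q)$, $P\trianglelefteq\bar P\le S$, $Q\trianglelefteq\bar Q\le S$ and $\varphi\,\delta_P(\bar P)\,\varphi^{-1}\le\delta_Q(\bar Q)$, then there is $\bar\varphi\in\mathrm{Mor}_{\mathcal T}(\bar P,\bar Q)$ with $\bar\varphi\circ\delta_{P,\bar P}(1)=\delta_{Q,\bar Q}(1)\circ\varphi$. An *isomorphism* $\alpha\colon\mathcal T\to\mathcal T'$ of transporter systems is an equivalence of categories with $\alpha(\delta_P(P))=\delta'_{\alpha(P)}(\alpha(P))$ for all $P\in\Delta$ and $\alpha(\delta_{P,Q}(1))=\delta'_{\alpha(P),\alpha(Q)}(1)$ for all $P\le Q$ in $\Delta$; it is *rigid* if $S=S'$ and $\alpha_S\circ\delta_S=\delta'_S$. A *locality* is a triple $(\mathcal L,\Delta,S)$, where $\mathcal L$ is a partial group (in the sense of Chermak) with domain $\mathbf D$, $S$ is a $p$-subgroup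 of $\mathcal L$, given as a $p$-group with an embedding into $\mathcal L$, and $\Delta$ is a set of subgroups of $S$, such that: $(f_n,\dots,f_1)\in\mathbf D$ if and only if there are $X_0,\dots,X_n\in\Delta$ with ${}^{f_{i+1}}X_i=X_{i+1}$ for all $0\le i<n$; if $P\in\Delta$, $f\in\mathcal L$ and ${}^fP\le Q\le S$, then $Q\in\Delta$; and $S$ is maximal among the $p$-subgroups of $\mathcal L$. An *isomorphism* $\mathcal L\to\mathcal L'$ of localities is an isomorphism of partial groups that sends $\Delta$ to $\Delta'$; it is *rigid* if $S=S'$ and it is the identity on $S$. For a transporter system $\mathcal T$, let $\equiv$ be the equivalence relation on the set $\mathrm{Iso}(\mathcal T)$ of isomorphisms of the category $\mathcal T$ that is generated by the pairs $(\varphi_0,\varphi)$, $\varphi_0\colon P_0\to Q_0$, $\varphi\colon P\to Q$, with $P_0\le P$, $Q_0\le Q$ and $\varphi\circ\delta_{P_0,P}(1)=\delta_{Q_0,Q}(1)\circ\varphi_0$. Let $\mathcal L_\Delta(\mathcal T)=\mathrm{Iso}(\mathcal T)/{\equiv}$; a word of classes $(f_n,\dots,f_1)$ is in the domain if there are $P_0,\dots,P_n\in\Delta$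 and isomorphisms $\varphi_i\colon P_{i-1}\to P_i$ with $\varphi_i\in f_i$, and then its product is $[\varphi_n\circ\cdots\circ\varphi_1]$; $S$ is embedded by $s\mapsto[\delta_S(s)]$. Let $\mathsf T$ and $\mathsf L$ be the categories of transporter systems (associated with arbitrary fusion systems over $p$-groups) and of localities, with isomorphisms as morphisms, and $\mathsf T_0$ and $\mathsf L_0$ the subcategories with the same objects and the rigid isomorphisms. Theorem. Every morphism of $\mathsf T$ and of $\mathsf L$ is invertible. Each $(\mathcal L_\Delta(\mathcal T),\Delta,S)$ is a locality, and there is a functor $\Lambda\colon\mathsf T\to\mathsf L$ with $\mathcal T\mapsto(\mathcal L_\Delta(\mathcal T),\Delta,S)$ and $\Lambda(\alpha)([\varphi])=[\alpha(\varphi)]$ that is an equivalence of categories and restricts to an equivalence $\mathsf T_0\to\mathsf L_0$. Both equivalences restrict further to equivalences between the full subcategories on the transporter systems associated with a saturated fusion system and on the localities $(\mathcal L,\Delta,S)$ for which there is a saturated fusion system $\mathcal F$ over $S$ with $\mathrm{Hom}_{\mathcal F}(P,Q)=\{c_f\colon P\to Q : f\in\mathcal L,\ {}^fP\le Q\}$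 for all $P\in\Delta$ and $Q\le S$. Moreover, for each transporter system $\mathcal T$, the map $\Phi\colon\mathrm{Aut}(\mathcal T)\to\mathrm{Aut}(\mathcal L_\Delta(\mathcal T))$, $\Phi(\alpha)([\varphi])=[\alpha(\varphi)]$, is an isomorphism of groups, and it maps the set of rigid automorphisms of $\mathcal T$ onto the set of rigid automorphisms of $\mathcal L_\Delta(\mathcal T)$. -/

import Mathlib

open CategoryTheory

universe u

/-! ### Finite `p`-groups as bundled objects -/

/-- A finite `p`-group. -/
structure FinPGroup (p : ℕ) where
  carrier : Type u
  [group : Group carrier]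
  [finite : Finite carrier]
  isPGroup : IsPGroup p carrier

namespace FinPGroup

variable {p : ℕ}

instance : CoeSort (FinPGroup.{u} p) (Type u) := ⟨carrier⟩

instance (S : FinPGroup.{u} p) : Group S := S.group

instance (S : FinPGroup.{u} p) : Finite S := S.finite

/-- The identity map `S → S'` when `S = S'`. -/
def eqEquiv {S S' : FinPGroup.{u} p} (h : S = S') : S ≃* S' := h ▸ MulEquiv.refl S

end FinPGroup

/-! ### Fusion systems -/

section Fusion

variable {S : Type u} [Group S]

/-- The set `N_S(P, Q)` of all `g` with `g P g⁻¹ ≤ Q`. -/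
def transporter (P Q : Subgroup S) : Set S := {g | ∀ x ∈ P, g * x * g⁻¹ ∈ Q}

theorem one_mem_transporter {P Q : Subgroup S} (h : P ≤ Q) : (1 : S) ∈ transporter P Q :=
  fun x hx => by simpa using h hx

theorem mul_mem_transporter {P Q R : Subgroup S} {g h : S} (hg : g ∈ transporter P Q)
    (hh : h ∈ transporter Q R) : h * g ∈ transporter P R :=
  fun x hx => by simpa [mul_assoc] using hh _ (hg x hx)

theorem mem_transporter_self {P : Subgroup S} {g : S} (hg : g ∈ P) : g ∈ transporter P P :=
  fun _ hx => P.mul_mem (P.mul_mem hg hx) (P.inv_mem hg)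

theorem mem_transporter_top {P : Subgroup S} (hP : P = ⊤) (g : S) : g ∈ transporter P P :=
  fun _ _ => by rw [hP]; exact Subgroup.mem_top _

theorem mem_transporter_of_normal {P Q : Subgroup S} (hQ : Q ≤ Subgroup.normalizer (P : Set S))
    {g : S} (hg : g ∈ Q) : g ∈ transporter P P :=
  fun x hx => (Subgroup.mem_normalizer_iff.1 (hQ hg) x).1 hx

/-- The conjugation homomorphism `c_g : P → Q`, `x ↦ g x g⁻¹`, for `g ∈ N_S(P, Q)`. -/
def conjHom {P Q : Subgroup S} (g : S) (hg : g ∈ transporter P Q) : P →* Q where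
  toFun x := ⟨g * x * g⁻¹, hg x x.2⟩
  map_one' := by ext; simp
  map_mul' x y := by ext; simp [mul_assoc]

variable (S) in
/-- A fusion system over `S`: a category whose objects are the subgroups of `S`, whose morphisms
are injective homomorphisms, which contains all the conjugation homomorphisms induced by elements
of `S`, and in which each morphism is an isomorphism followed by an inclusion. (Identities are
conjugations by `1`.) -/
structure FusionSystem where
  Hom (P Q : Subgroup S) : Set (P →* Q)
  injective {P Q : Subgroup S} (φ : P →* Q) : φ ∈ Hom P Q → Function.Injective φ
  conj_mem {P Q : Subgroup S} (g : S) (hg : g ∈ transporter P Q) : conjHom g hg ∈ Hom P Q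
  comp_mem {P Q R : Subgroup S} (φ : P →* Q) (ψ : Q →* R) :
    φ ∈ Hom P Q → ψ ∈ Hom Q R → ψ.comp φ ∈ Hom P R
  factor {P Q : Subgroup S} (φ : P →* Q) : φ ∈ Hom P Q →
    ∃ (R : Subgroup S) (hR : R ≤ Q) (e : P ≃* R), e.toMonoidHom ∈ Hom P R ∧
      e.symm.toMonoidHom ∈ Hom R P ∧ φ = (Subgroup.inclusion hR).comp e.toMonoidHom

namespace FusionSystem

variable (F : FusionSystem S)

/-- The isomorphisms of the category `F`. -/
def Iso (P Q : Subgroup S) : Set (P ≃* Q) :=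
  {e | e.toMonoidHom ∈ F.Hom P Q ∧ e.symm.toMonoidHom ∈ F.Hom Q P}

/-- `P` and `Q` are `F`-conjugate. -/
def IsConj (P Q : Subgroup S) : Prop := (F.Iso P Q).Nonempty

/-- The group `Aut_F(P)`. -/
def aut (P : Subgroup S) : Subgroup (MulAut P) where
  carrier := F.Iso P P
  mul_mem' {a b} ha hb := ⟨F.comp_mem _ _ hb.1 ha.1, F.comp_mem _ _ ha.2 hb.2⟩
  one_mem' := by
    have h : (1 : MulAut P).toMonoidHom = conjHom 1 (one_mem_transporter le_rfl) := by
      ext x; simp [conjHom]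
    have h' : (MulEquiv.symm (1 : MulAut P)).toMonoidHom =
        conjHom 1 (one_mem_transporter le_rfl) := by
      ext x; simp [conjHom, MulAut.one_def]
    exact ⟨h ▸ F.conj_mem _ _, h' ▸ F.conj_mem _ _⟩
  inv_mem' {a} ha := ⟨ha.2, ha.1⟩

/-- `P` is fully automized: `Aut_S(P)` is a Sylow `p`-subgroup of `Aut_F(P)`. -/
def FullyAutomized (p : ℕ) (P : Subgroup S) : Prop :=
  ∃ A : Sylow p (F.aut P),
    (A : Subgroup (F.aut P)).map (F.aut P).subtype = P.normalizerMonoidHom.range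

/-- For an isomorphism `φ : Q → P`, the group `N_φ` of all `g ∈ N_S(Q)` such that
`φ c_g φ⁻¹ ∈ Aut_S(P)`. -/
def extender {Q P : Subgroup S} (φ : Q ≃* P) : Subgroup S :=
  (P.normalizerMonoidHom.range.comap
    ((MulAut.congr φ).toMonoidHom.comp Q.normalizerMonoidHom)).map
      (Subgroup.normalizer (Q : Set S)).subtype

/-- `P` is receptive: each `F`-isomorphism `φ : Q → P` extends to a morphism `N_φ → S` in `F`. -/
def Receptive (P : Subgroup S) : Prop :=
  ∀ (Q : Subgroup S) (φ : Q ≃* P), φ ∈ F.Iso Q P →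
    ∃ ψ ∈ F.Hom (extender φ) ⊤, ∀ (x : S) (hx : x ∈ Q) (hx' : x ∈ extender φ),
      (ψ ⟨x, hx'⟩ : S) = φ ⟨x, hx⟩

/-- `F` is saturated: each subgroup is `F`-conjugate to one that is fully automized and
receptive. -/
def Saturated (p : ℕ) : Prop :=
  ∀ P : Subgroup S, ∃ Q : Subgroup S, F.IsConj P Q ∧ F.FullyAutomized p Q ∧ F.Receptive Q

end FusionSystem

/-- The members of a collection `Δ` of subgroups, as the objects of a category. (A structure, so
that the order on subgroups does not put a category on it.) -/
@[ext]
structure Member (Δ : Set (Subgroup S)) where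
  sub : Subgroup S
  mem : sub ∈ Δ

end Fusion

/-! ### Transporter systems -/

/-- A (finite) transporter system on the `p`-group `S`: a fusion system `fusion` over `S`, a
category with object set `Δ`, and functors `δ`, `π` from the transporter category of `S` on `Δ`
and to `fusion`, which are the identity and the inclusion on objects and so are given by their
effect on morphisms. Composition is written in diagrammatic order. -/
structure TransporterSystem (p : ℕ) (S : Type u) [Group S] where
  fusion : FusionSystem S
  Δ : Set (Subgroup S)
  [cat : Category.{u} (Member Δ)]
  nonempty : Δ.Nonempty
  finite (P Q : Member Δ) : Finite (P ⟶ Q)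
  δ {P Q : Member Δ} (g : S) (hg : g ∈ transporter P.sub Q.sub) : P ⟶ Q
  δ_one (P : Member Δ) : δ 1 (one_mem_transporter le_rfl) = 𝟙 P
  δ_mul {P Q R : Member Δ} (g h : S) (hg : g ∈ transporter P.sub Q.sub)
    (hh : h ∈ transporter Q.sub R.sub) : δ (h * g) (mul_mem_transporter hg hh) = δ g hg ≫ δ h hh
  π {P Q : Member Δ} (φ : P ⟶ Q) : P.sub →* Q.sub
  π_mem {P Q : Member Δ} (φ : P ⟶ Q) : π φ ∈ fusion.Hom P.sub Q.sub
  π_id (P : Member Δ) : π (𝟙 P) = MonoidHom.id P.sub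
  π_comp {P Q R : Member Δ} (φ : P ⟶ Q) (ψ : Q ⟶ R) : π (φ ≫ ψ) = (π ψ).comp (π φ)
  conj_closed (P Q : Subgroup S) : P ∈ Δ → fusion.IsConj P Q → Q ∈ Δ
  over_closed (P Q : Subgroup S) : P ∈ Δ → P ≤ Q → Q ∈ Δ
  π_surjective {P Q : Member Δ} (f : P.sub →* Q.sub) :
    f ∈ fusion.Hom P.sub Q.sub → ∃ φ : P ⟶ Q, π φ = f
  π_orbit {P Q : Member Δ} (φ ψ : P ⟶ Q) :
    π φ = π ψ ↔ ∃ e : P ⟶ P, π e = MonoidHom.id P.sub ∧ ψ = e ≫ φ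
  free_right {P Q : Member Δ} (φ : P ⟶ Q) (e : P ⟶ P) :
    π e = MonoidHom.id P.sub → e ≫ φ = φ → e = 𝟙 P
  free_left {P Q : Member Δ} (φ : P ⟶ Q) (e : Q ⟶ Q) :
    π e = MonoidHom.id Q.sub → φ ≫ e = φ → e = 𝟙 Q
  δ_injective {P Q : Member Δ} (g h : S) (hg : g ∈ transporter P.sub Q.sub)
    (hh : h ∈ transporter P.sub Q.sub) : δ g hg = δ h hh → g = h
  π_δ {P Q : Member Δ} (g : S) (hg : g ∈ transporter P.sub Q.sub) : π (δ g hg) = conjHom g hg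
  comm {P Q : Member Δ} (φ : P ⟶ Q) (g : P.sub) :
    δ (g : S) (mem_transporter_self g.2) ≫ φ =
      φ ≫ δ (π φ g : S) (mem_transporter_self (π φ g).2)
  sylow (T : Member Δ) : T.sub = ⊤ → ∃ A : Sylow p (Aut T), ∀ a : Aut T,
    a ∈ A ↔ ∃ (g : S) (hg : g ∈ transporter T.sub T.sub), a.hom = δ g hg
  extend {P Q P' Q' : Member Δ} (φ : P ≅ Q) (hP : P.sub ≤ P'.sub) (hQ : Q.sub ≤ Q'.sub)
    (nP : P'.sub ≤ Subgroup.normalizer (P.sub : Set S))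
    (nQ : Q'.sub ≤ Subgroup.normalizer (Q.sub : Set S)) :
    (∀ (g : S) (hg : g ∈ P'.sub), ∃ (h : S) (hh : h ∈ Q'.sub),
      φ.inv ≫ δ g (mem_transporter_of_normal nP hg) ≫ φ.hom =
        δ h (mem_transporter_of_normal nQ hh)) →
    ∃ φ' : P' ⟶ Q', δ 1 (one_mem_transporter hP) ≫ φ' = φ.hom ≫ δ 1 (one_mem_transporter hQ)

namespace TransporterSystem

variable {p : ℕ}

section

variable {S : Type u} [Group S] (T : TransporterSystem p S)

/-- The objects of `T`. -/
abbrev Ob : Type u := Member T.Δ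

instance : Category.{u} T.Ob := T.cat

/-- The inclusion morphism `δ_{P,Q}(1)`. -/
def incl {P Q : T.Ob} (h : P.sub ≤ Q.sub) : P ⟶ Q := T.δ 1 (one_mem_transporter h)

/-- `S` as an object of `T`. -/
def top : T.Ob :=
  ⟨⊤, T.over_closed _ _ T.nonempty.choose_spec le_top⟩

theorem top_sub : T.top.sub = ⊤ := rfl

/-- The automorphism `δ_S(s)` of the object `S`, for `s ∈ S`. -/
def δIso (s : S) : T.top ≅ T.top where
  hom := T.δ s (mem_transporter_top T.top_sub s)
  inv := T.δ s⁻¹ (mem_transporter_top T.top_sub s⁻¹)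
  hom_inv_id := by
    rw [← T.δ_mul, ← T.δ_one]; simp
  inv_hom_id := by
    rw [← T.δ_mul, ← T.δ_one]; simp

/-- The set `δ_P(P)` of morphisms `P ⟶ P`. -/
def inner (P : T.Ob) : Set (P ⟶ P) :=
  {f | ∃ (g : S) (hg : g ∈ P.sub), f = T.δ g (mem_transporter_self hg)}

end

/-- An isomorphism of transporter systems: an equivalence of categories which is isotypical and
sends inclusions to inclusions. -/
@[ext]
structure Iso {S S' : Type u} [Group S] [Group S'] (T : TransporterSystem p S)
    (T' : TransporterSystem p S') where
  functor : T.Ob ⥤ T'.Ob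
  isEquivalence : functor.IsEquivalence
  isotypical (P : T.Ob) : (fun f : P ⟶ P => functor.map f) '' T.inner P = T'.inner (functor.obj P)
  inclusions (P Q : T.Ob) (h : P.sub ≤ Q.sub) :
    ∃ h' : (functor.obj P).sub ≤ (functor.obj Q).sub, functor.map (T.incl h) = T'.incl h'

namespace Iso

variable {S S' S'' : Type u} [Group S] [Group S'] [Group S''] {T : TransporterSystem p S}
  {T' : TransporterSystem p S'} {T'' : TransporterSystem p S''}

/-- The identity isomorphism. -/
def refl (T : TransporterSystem p S) : Iso T T where
  functor := 𝟭 _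
  isEquivalence := inferInstance
  isotypical P := by simp
  inclusions P Q h := ⟨h, rfl⟩

/-- Composition of isomorphisms. -/
def trans (α : Iso T T') (β : Iso T' T'') : Iso T T'' where
  functor := α.functor ⋙ β.functor
  isEquivalence :=
    have := α.isEquivalence
    have := β.isEquivalence
    inferInstance
  isotypical P := by
    have h := β.isotypical (α.functor.obj P)
    rw [← α.isotypical P, Set.image_image] at h
    exact h
  inclusions P Q h := by
    obtain ⟨h', e'⟩ := α.inclusions P Q h
    obtain ⟨h'', e''⟩ := β.inclusions _ _ h'
    exact ⟨h'', by rw [Functor.comp_map, e', e'']⟩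

/-- The isomorphism `α` sends the object `S` to `S'` and satisfies `α(δ_S(s)) = δ'_{S'}(e(s))` for
all `s ∈ S`. -/
def RestrictsTo (α : Iso T T') (e : S ≃* S') : Prop :=
  ∃ h : (α.functor.obj T.top).sub = ⊤, ∀ s : S,
    α.functor.map (T.δ s (mem_transporter_top T.top_sub s)) = T'.δ (e s) (mem_transporter_top h (e s))

theorem restrictsTo_refl (T : TransporterSystem p S) :
    (refl T).RestrictsTo (MulEquiv.refl S) := ⟨rfl, fun _ => rfl⟩

theorem RestrictsTo.trans {α : Iso T T'} {β : Iso T' T''} {e : S ≃* S'} {e' : S' ≃* S''}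
    (h : α.RestrictsTo e) (h' : β.RestrictsTo e') : (α.trans β).RestrictsTo (e.trans e') := by
  obtain ⟨h1, h2⟩ := h
  have key : ∀ X : T'.Ob, X = T'.top → ∀ hX : X.sub = ⊤,
      ∃ k : (β.functor.obj X).sub = ⊤, ∀ s : S',
        β.functor.map (T'.δ s (mem_transporter_top hX s)) =
          T''.δ (e' s) (mem_transporter_top k (e' s)) := by
    rintro X rfl _
    exact h'
  obtain ⟨k, hk⟩ := key _ (Member.ext h1) h1
  refine ⟨k, fun s => ?_⟩
  change β.functor.map (α.functor.map _) = _
  rw [h2]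
  exact hk _

end Iso

/-- The set `Iso(T)` of all isomorphisms of the category `T`. -/
structure IsoSet {S : Type u} [Group S] (T : TransporterSystem p S) where
  {source target : T.Ob}
  iso : source ≅ target

/-- `φ₀` is a restriction of `φ`, that is `φ₀ ↑ φ`. -/
def IsRestriction {S : Type u} [Group S] {T : TransporterSystem p S} (φ₀ φ : IsoSet T) : Prop :=
  ∃ (h : φ₀.source.sub ≤ φ.source.sub) (h' : φ₀.target.sub ≤ φ.target.sub),
    T.incl h ≫ φ.iso.hom = φ₀.iso.hom ≫ T.incl h'

/-- The equivalence relation on `Iso(T)` generated by `↑`. -/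
def IsoEquiv {S : Type u} [Group S] {T : TransporterSystem p S} : IsoSet T → IsoSet T → Prop :=
  Relation.EqvGen IsRestriction

/-- The effect of an isomorphism of transporter systems on `Iso(T)`. -/
def Iso.mapIso {S S' : Type u} [Group S] [Group S'] {T : TransporterSystem p S}
    {T' : TransporterSystem p S'} (α : Iso T T') (φ : IsoSet T) : IsoSet T' :=
  ⟨α.functor.mapIso φ.iso⟩

end TransporterSystem

/-- The objects of the category `𝖳` of transporter systems for the prime `p`. -/
structure TransporterCat (p : ℕ) where
  S : FinPGroup.{u} p
  sys : TransporterSystem p S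

namespace TransporterCat

variable {p : ℕ}

/-- The category `𝖳` of transporter systems and their isomorphisms. -/
instance : Category.{u} (TransporterCat.{u} p) where
  Hom X Y := TransporterSystem.Iso X.sys Y.sys
  id X := .refl X.sys
  comp α β := α.trans β

/-- A morphism of `𝖳` seen as an isomorphism of transporter systems. -/
def toIso {X Y : TransporterCat.{u} p} (α : X ⟶ Y) : TransporterSystem.Iso X.sys Y.sys := α

/-- Rigid isomorphisms: `S = S'` and `α_S ∘ δ_S = δ'_S`. -/
def rigid (p : ℕ) : MorphismProperty (TransporterCat.{u} p) :=
  fun X Y α => ∃ h : X.S = Y.S, (toIso α).RestrictsTo (FinPGroup.eqEquiv h)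

instance : (rigid.{u} p).IsMultiplicative where
  id_mem X := ⟨rfl, TransporterSystem.Iso.restrictsTo_refl X.sys⟩
  comp_mem {X Y Z} α β hα hβ := by
    obtain ⟨S, T⟩ := X
    obtain ⟨S', T'⟩ := Y
    obtain ⟨S'', T''⟩ := Z
    obtain ⟨h, hα⟩ := hα
    obtain ⟨h', hβ⟩ := hβ
    dsimp only at h h'
    subst h h'
    exact ⟨rfl, hα.trans hβ⟩

/-- The transporter systems associated with a saturated fusion system. -/
def saturated (p : ℕ) : ObjectProperty (TransporterCat.{u} p) :=
  fun X => X.sys.fusion.Saturated p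

end TransporterCat

/-! ### Partial groups and localities -/

/-- A partial group. A word `[f_n, …, f_1]` is in the domain if the product `f_n ⋯ f_1` is
defined. -/
class PartialGroup (L : Type u) where
  /-- The domain of the product. -/
  D : Set (List L)
  /-- The product. -/
  mprod (w : List L) : w ∈ D → L
  /-- The inversion. -/
  inv : L → L
  nil_mem : [] ∈ D
  single_mem (x : L) : [x] ∈ D
  left_mem (u v : List L) : u ++ v ∈ D → u ∈ D
  right_mem (u v : List L) : u ++ v ∈ D → v ∈ D
  prod_single (x : L) : mprod [x] (single_mem x) = x
  assoc_mem (u v w : List L) (h : u ++ v ++ w ∈ D) :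
    u ++ [mprod v (right_mem u v (left_mem _ w h))] ++ w ∈ D
  prod_assoc (u v w : List L) (h : u ++ v ++ w ∈ D) :
    mprod (u ++ v ++ w) h =
      mprod (u ++ [mprod v (right_mem u v (left_mem _ w h))] ++ w) (assoc_mem u v w h)
  inv_inv (x : L) : inv (inv x) = x
  inv_mem (w : List L) : w ∈ D → (w.map inv).reverse ++ w ∈ D
  prod_inv (w : List L) (h : w ∈ D) : mprod ((w.map inv).reverse ++ w) (inv_mem w h) = mprod [] nil_mem

namespace PartialGroup

variable {L : Type u} [PartialGroup L]

/-- The set `D(f)` of all `x` for which the conjugate of `x` by `f` is defined. -/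
def conjDom (f : L) : Set L := {x | [f, x, inv f] ∈ D}

/-- The conjugate of `x` by `f`. -/
def conj (f x : L) (hx : x ∈ conjDom f) : L := mprod [f, x, inv f] hx

/-- The set of conjugates by `f` of the elements of `X`. -/
def conjSet (f : L) (X : Set L) : Set L := {y | ∃ x ∈ X, ∃ hx : x ∈ conjDom f, conj f x hx = y}

/-- `H` is a subgroup of the partial group `L`. -/
structure IsSubgroup (H : Set L) : Prop where
  word_mem (w : List L) : (∀ x ∈ w, x ∈ H) → w ∈ D
  prod_mem (w : List L) (hw : ∀ x ∈ w, x ∈ H) : mprod w (word_mem w hw) ∈ H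
  inv_mem (x : L) : x ∈ H → inv x ∈ H

/-- `H` is a `p`-subgroup of the (finite) partial group `L`. -/
def IsPSubgroup (p : ℕ) (H : Set L) : Prop := IsSubgroup H ∧ ∃ n : ℕ, Nat.card H = p ^ n

end PartialGroup

open PartialGroup in
/-- The word `w = [f_n, …, f_1]` is in the domain via a sequence `X = X_0, …, X_n = Y` of members
of `Δ`: for each `i`, the conjugate of `X_i` by `f_{i+1}` is defined and equal to `X_{i+1}`. Here
subgroups of `S` are carried into `L` by `ι`. -/
inductive ConjChain {S L : Type u} [Group S] [PartialGroup L] (ι : S → L) (Δ : Set (Subgroup S)) :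
    List L → Subgroup S → Subgroup S → Prop
  | nil (X : Subgroup S) : X ∈ Δ → ConjChain ι Δ [] X X
  | cons (f : L) (w : List L) (X Y Z : Subgroup S) : ConjChain ι Δ w X Y → Z ∈ Δ →
      ι '' (Y : Set S) ⊆ conjDom f → conjSet f (ι '' (Y : Set S)) = ι '' (Z : Set S) →
      ConjChain ι Δ (f :: w) X Z

open PartialGroup in
/-- A locality `(L, Δ, S)`. The `p`-subgroup `S` of `L` is given as a `p`-group together with an
embedding `ι : S → L`, so that it makes sense to say that two localities have the same `S`. -/
structure Locality (p : ℕ) (S : Type u) [Group S] where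
  carrier : Type u
  [partialGroup : PartialGroup carrier]
  finite : Finite carrier
  ι : S → carrier
  ι_injective : Function.Injective ι
  ι_mem (w : List S) : w.map ι ∈ D
  ι_prod (w : List S) : mprod (w.map ι) (ι_mem w) = ι w.prod
  Δ : Set (Subgroup S)
  domain (w : List carrier) : w ∈ D ↔ ∃ X Y, ConjChain ι Δ w X Y
  closed (P Q : Subgroup S) (f : carrier) : P ∈ Δ → ι '' (P : Set S) ⊆ conjDom f →
    conjSet f (ι '' (P : Set S)) ⊆ ι '' (Q : Set S) → Q ∈ Δ
  maximal (H : Set carrier) : IsPSubgroup p H → Set.range ι ⊆ H → H = Set.range ι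

namespace Locality

open PartialGroup

variable {p : ℕ}

instance {S : Type u} [Group S] (L : Locality p S) : PartialGroup L.carrier := L.partialGroup

/-- An isomorphism of localities: an isomorphism of partial groups which carries `Δ` to `Δ'`. -/
@[ext]
structure Iso {S S' : Type u} [Group S] [Group S'] (L : Locality p S) (L' : Locality p S') where
  toEquiv : L.carrier ≃ L'.carrier
  mem_iff (w : List L.carrier) : w.map toEquiv ∈ D ↔ w ∈ D
  map_prod (w : List L.carrier) (h : w ∈ D) :
    toEquiv (mprod w h) = mprod (w.map toEquiv) ((mem_iff w).2 h)
  map_Δ : (fun P : Subgroup S => toEquiv '' (L.ι '' (P : Set S))) '' L.Δ =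
    (fun P : Subgroup S' => L'.ι '' (P : Set S')) '' L'.Δ

namespace Iso

variable {S S' S'' : Type u} [Group S] [Group S'] [Group S''] {L : Locality p S}
  {L' : Locality p S'} {L'' : Locality p S''}

/-- The identity isomorphism. -/
def refl (L : Locality p S) : Iso L L where
  toEquiv := Equiv.refl _
  mem_iff w := by simp
  map_prod w h := by simp
  map_Δ := by simp

/-- Composition of isomorphisms. -/
def trans (α : Iso L L') (β : Iso L' L'') : Iso L L'' where
  toEquiv := α.toEquiv.trans β.toEquiv
  mem_iff w := by
    rw [← α.mem_iff w, ← β.mem_iff, List.map_map]; rfl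
  map_prod w h := by
    simp only [Equiv.trans_apply, α.map_prod w h, β.map_prod, List.map_map]; rfl
  map_Δ := by
    have h := congrArg (fun A => (fun X : Set L'.carrier => β.toEquiv '' X) '' A) α.map_Δ
    simp only [Set.image_image] at h
    rw [← β.map_Δ]
    simpa [Set.image_image] using h

/-- The isomorphism `β` restricts to `e : S → S'`. -/
def RestrictsTo (β : Iso L L') (e : S ≃* S') : Prop := ∀ s : S, β.toEquiv (L.ι s) = L'.ι (e s)

end Iso

end Locality

/-- The objects of the category `𝖫` of localities for the prime `p`. -/
structure LocalityCat (p : ℕ) where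
  S : FinPGroup.{u} p
  loc : Locality p S

namespace LocalityCat

variable {p : ℕ}

/-- The category `𝖫` of localities and their isomorphisms. -/
instance : Category.{u} (LocalityCat.{u} p) where
  Hom X Y := Locality.Iso X.loc Y.loc
  id X := .refl X.loc
  comp α β := α.trans β

/-- A morphism of `𝖫` seen as an isomorphism of localities. -/
def toIso {X Y : LocalityCat.{u} p} (β : X ⟶ Y) : Locality.Iso X.loc Y.loc := β

/-- Rigid isomorphisms: `S = S'` and `β` is the identity on `S`. -/
def rigid (p : ℕ) : MorphismProperty (LocalityCat.{u} p) :=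
  fun X Y β => ∃ h : X.S = Y.S, (toIso β).RestrictsTo (FinPGroup.eqEquiv h)

instance : (rigid.{u} p).IsMultiplicative where
  id_mem X := ⟨rfl, fun _ => rfl⟩
  comp_mem {X Y Z} α β hα hβ := by
    obtain ⟨S, L⟩ := X
    obtain ⟨S', L'⟩ := Y
    obtain ⟨S'', L''⟩ := Z
    obtain ⟨h, hα⟩ := hα
    obtain ⟨h', hβ⟩ := hβ
    dsimp only at h h'
    subst h h'
    exact ⟨rfl, fun s => (congrArg (toIso β).toEquiv (hα s)).trans (hβ s)⟩

open PartialGroup in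
/-- The localities whose conjugation maps on members of `Δ` are the morphisms of a saturated
fusion system: there is a saturated fusion system `F` over `S` such that, for `P ∈ Δ` and `Q ≤ S`,
the `F`-morphisms from `P` to `Q` are the conjugation maps `c_f : P → Q`, `f ∈ L`. -/
def saturated (p : ℕ) : ObjectProperty (LocalityCat.{u} p) :=
  fun X => ∃ F : FusionSystem X.S, F.Saturated p ∧ ∀ P ∈ X.loc.Δ, ∀ (Q : Subgroup X.S) (φ : P →* Q),
    φ ∈ F.Hom P Q ↔ ∃ f : X.loc.carrier, ∀ x : P,
      ∃ hx : X.loc.ι x ∈ conjDom f, conj f (X.loc.ι x) hx = X.loc.ι (φ x)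

end LocalityCat

/-! ### The locality of a transporter system -/

/-- `RepWord q w φ` says that the word `w = [f_n, …, f_1]` of classes has representatives
`φ_i : P_{i-1} → P_i` with composite `φ = φ_n ∘ ⋯ ∘ φ_1`; here `q` sends an isomorphism to its
class. -/
inductive RepWord {p : ℕ} {S L : Type u} [Group S] {T : TransporterSystem p S} (q : T.IsoSet → L) :
    List L → ∀ {P Q : T.Ob}, (P ≅ Q) → Prop
  | nil (P : T.Ob) : RepWord q [] (Iso.refl P)
  | cons (w : List L) {P Q R : T.Ob} (φ : P ≅ Q) (ψ : Q ≅ R) : RepWord q w φ →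
      RepWord q (q ⟨ψ⟩ :: w) (φ ≪≫ ψ)

open PartialGroup in
/-- The locality `L` is the locality `Iso(T)/≡` of the transporter system `T`, on the same `S` and
with the same object set, where the map `q : Iso(T) → L` sends `φ` to its class `[φ]`. -/
structure IsLocalityOf {p : ℕ} (T : TransporterCat.{u} p) (L : LocalityCat.{u} p)
    (q : T.sys.IsoSet → L.loc.carrier) : Prop where
  surjective : Function.Surjective q
  eq_iff (φ ψ : T.sys.IsoSet) : q φ = q ψ ↔ TransporterSystem.IsoEquiv φ ψ
  mem_iff (w : List L.loc.carrier) : w ∈ D ↔ ∃ (P Q : T.sys.Ob) (φ : P ≅ Q), RepWord q w φ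
  prod_eq (w : List L.loc.carrier) (hw : w ∈ D) {P Q : T.sys.Ob} (φ : P ≅ Q) :
    RepWord q w φ → mprod w hw = q ⟨φ⟩
  same_S : ∃ h : T.S = L.S,
    (fun P : Subgroup T.S => P.map (FinPGroup.eqEquiv h).toMonoidHom) '' T.sys.Δ = L.loc.Δ ∧
    ∀ s : T.S, L.loc.ι (FinPGroup.eqEquiv h s) = q ⟨T.sys.δIso s⟩

/-! ### Restricting functors to subcategories -/

/-- The functor `𝖳₀ ⥤ 𝖫₀` of categories with rigid isomorphisms to which a functor `Λ : 𝖳 ⥤ 𝖫`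
restricts if it sends rigid isomorphisms to rigid isomorphisms. -/
def restrictRigid {p : ℕ} (Λ : TransporterCat.{u} p ⥤ LocalityCat.{u} p)
    (h : ∀ ⦃X Y : TransporterCat.{u} p⦄ (α : X ⟶ Y), TransporterCat.rigid p α →
      LocalityCat.rigid p (Λ.map α)) :
    WideSubcategory (TransporterCat.rigid.{u} p) ⥤ WideSubcategory (LocalityCat.rigid.{u} p) where
  obj X := ⟨Λ.obj X.obj⟩
  map {X Y} α := ⟨Λ.map α.hom, h α.hom α.property⟩
  map_id X := by ext1; exact Λ.map_id _
  map_comp α β := by ext1; exact Λ.map_comp _ _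

/-- The functor between full subcategories to which `Λ` restricts. -/
def restrictFull {C D : Type*} [Category* C] [Category* D] (Λ : C ⥤ D) (P : ObjectProperty C)
    (Q : ObjectProperty D) (h : ∀ X, P X → Q (Λ.obj X)) : P.FullSubcategory ⥤ Q.FullSubcategory :=
  Q.lift (P.ι ⋙ Λ) fun X => h X.obj X.property

/-! ### Morphisms of a transporter system -/

/-! The class of an isomorphism of `T` behaves like the germ of a morphism into `S`, and each germ
has a largest representative. By (A2) and the factorization of fusion morphisms, every morphism of
`T` is a monomorphism (`cancel_right`) and is an isomorphism followed by an inclusion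
(`exists_factor`). By (C) and the growth of normalizers in a `p`-group, morphisms into `S` are
determined by their restrictions (`incl_epi_top`). Axiom (II) extends a morphism to every element of
the normalizer that it conjugates into `S` (`exists_extend`). Together these glue two morphisms into
`S` that agree on a common member of `Δ` (`glue`). Hence a class `f` has a largest representative
`rep f`, defined on `dom f`, whose restrictions are exactly the representatives of `f` as morphisms
into `S`.

Two chains of representatives of one word therefore sit inside a common morphism (`repWord_joint`),
so products of classes are well defined and form a partial group. Conjugation by `f` carries `y` to
`z` in `S` exactly if `y` lies in `dom f` and `rep f` sends it to `z` (`carries_iff`). So `f`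
conjugates `P` onto `Q` exactly if it is represented by an isomorphism from `P` to `Q` (`acts_iff`),
which is the domain axiom of a locality. Maximality of `S` follows from axiom (I) and the normalizer
condition.

Morphisms from `P` to `Q` in `T` correspond to the classes that conjugate `P` into `Q`
(`homCls_injective`, `exists_homCls_of_maps`). An isomorphism of localities restricts to an
isomorphism of the `p`-groups, because `S` is the largest member of `Δ`. It can then be read as a
functor of transporter systems, in exactly one way, so the functor to localities is fully faithful,
and rigid morphisms correspond.

For essential surjectivity, the members of a locality's `Δ` become a category whose morphisms are
the elements that conjugate one member into another. The main point is that conjugation by `f` is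
multiplicative on all elements it carries into `S` (`carries_mul`). Any fusion system whose
morphisms on `Δ` are the conjugation maps completes this to a transporter system, whose locality is
the given one, by an isomorphism that is the identity on `S`. One such fusion system always exists
(`fusion`). If a saturated one is given, it is used instead, so saturation is carried along and
never analysed. -/

theorem exists_normalizer_inf_gt {S : Type u} [Group S] [Group.IsNilpotent S] {P Q : Subgroup S}
    (h : P < Q) : P < Subgroup.normalizer (P : Set S) ⊓ Q := by
  have hlt : P.subgroupOf Q < ⊤ := lt_top_iff_ne_top.2 fun e =>
    h.not_ge (Subgroup.subgroupOf_eq_top.1 e)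
  have h1 := Group.normalizerCondition_of_isNilpotent (G := Q) _ hlt
  refine lt_of_le_of_ne (le_inf Subgroup.le_normalizer h.le) fun e => ?_
  obtain ⟨x, hx, hx'⟩ := SetLike.exists_of_lt h1
  refine hx' (Subgroup.mem_subgroupOf.2 ?_)
  rw [e]
  refine ⟨Subgroup.mem_normalizer_iff.2 fun y => ?_, x.2⟩
  rw [Subgroup.mem_normalizer_iff] at hx
  constructor
  · intro hy
    simpa using Subgroup.mem_subgroupOf.1
      ((hx ⟨y, h.le hy⟩).1 (Subgroup.mem_subgroupOf.2 (by simpa using hy)))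
  · intro hy
    have hyQ : y ∈ Q := by
      have := Q.mul_mem (Q.mul_mem (Q.inv_mem x.2) (h.le hy)) x.2
      simpa [mul_assoc] using this
    simpa using Subgroup.mem_subgroupOf.1
      ((hx ⟨y, hyQ⟩).2 (Subgroup.mem_subgroupOf.2 (by simpa using hy)))

namespace TransporterSystem

variable {p : ℕ} {S : Type u} [Group S] (T : TransporterSystem p S)

theorem mem_Δ_of_le {P : T.Ob} {Q : Subgroup S} (h : P.sub ≤ Q) : Q ∈ T.Δ :=
  T.over_closed _ _ P.mem h

theorem δ_comp {P Q R : T.Ob} {g h : S} (hg : g ∈ transporter P.sub Q.sub)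
    (hh : h ∈ transporter Q.sub R.sub) {k : S} (hk : k = h * g) :
    T.δ g hg ≫ T.δ h hh = T.δ k (hk ▸ mul_mem_transporter hg hh) := by
  subst hk; exact (T.δ_mul g h hg hh).symm

theorem incl_comp_incl {P Q R : T.Ob} (h : P.sub ≤ Q.sub) (h' : Q.sub ≤ R.sub) :
    T.incl h ≫ T.incl h' = T.incl (h.trans h') := T.δ_comp _ _ (by simp)

theorem incl_comp_incl_assoc {P Q R X : T.Ob} (h : P.sub ≤ Q.sub) (h' : Q.sub ≤ R.sub)
    (f : R ⟶ X) : T.incl h ≫ T.incl h' ≫ f = T.incl (h.trans h') ≫ f := by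
  rw [← Category.assoc, T.incl_comp_incl]

theorem incl_refl {P : T.Ob} (h : P.sub ≤ P.sub) : T.incl h = 𝟙 P := T.δ_one P

theorem π_incl {P Q : T.Ob} (h : P.sub ≤ Q.sub) (x : P.sub) :
    (T.π (T.incl h) x : S) = x := by
  rw [incl, T.π_δ]; simp [conjHom]

theorem π_δ_apply {P Q : T.Ob} (g : S) (hg : g ∈ transporter P.sub Q.sub) (x : P.sub) :
    (T.π (T.δ g hg) x : S) = g * x * g⁻¹ := by
  rw [T.π_δ]; rfl

theorem π_comp_apply {P Q R : T.Ob} (φ : P ⟶ Q) (ψ : Q ⟶ R) (x : P.sub) :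
    T.π (φ ≫ ψ) x = T.π ψ (T.π φ x) := by rw [T.π_comp]; rfl

theorem π_injective {P Q : T.Ob} (φ : P ⟶ Q) : Function.Injective (T.π φ) :=
  T.fusion.injective _ (T.π_mem φ)

/-- The orbit condition for `e` and `𝟙 P` gives a one-sided inverse that is again in the kernel of
`π`. That inverse has a one-sided inverse too, so, as in any monoid, it is two-sided. -/
theorem isIso_of_π_eq_id {P : T.Ob} {e : P ⟶ P} (he : T.π e = MonoidHom.id P.sub) : IsIso e := by
  have key : ∀ e : P ⟶ P, T.π e = MonoidHom.id P.sub →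
      ∃ e', T.π e' = MonoidHom.id P.sub ∧ e' ≫ e = 𝟙 P := fun e he => by
    obtain ⟨e', h, h'⟩ := (T.π_orbit e (𝟙 P)).1 (he.trans (T.π_id P).symm)
    exact ⟨e', h, h'.symm⟩
  obtain ⟨a, ha, hae⟩ := key e he
  obtain ⟨b, hb, hba⟩ := key a ha
  refine ⟨a, ?_, hae⟩
  have : b = e := by
    rw [← Category.comp_id b, ← hae, ← Category.assoc, hba, Category.id_comp]
  rw [← this, hba]

/-- Injectivity of `π φ` puts `ψ` and `ψ'` in one orbit of the kernel at `R`, and freeness on that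
side forces the element relating them to be trivial. -/
theorem cancel_right {R P Q : T.Ob} {ψ ψ' : R ⟶ P} {φ : P ⟶ Q} (h : ψ ≫ φ = ψ' ≫ φ) :
    ψ = ψ' := by
  have hπ : T.π ψ = T.π ψ' := by
    ext1 x
    apply T.π_injective φ
    rw [← π_comp_apply, h, π_comp_apply]
  obtain ⟨e, he, rfl⟩ := (T.π_orbit ψ ψ').1 hπ
  have : e = 𝟙 R := T.free_right (ψ ≫ φ) e he (by rw [← Category.assoc, ← h])
  rw [this, Category.id_comp]

/-- The factorization of `π φ` in the fusion system is lifted. Lifts of mutually inverse maps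
compose to kernel elements, which are invertible, so the lift onto the image is an isomorphism; a
kernel element at `P` corrects it to give `φ` itself. -/
theorem exists_factor {P Q : T.Ob} (φ : P ⟶ Q) :
    ∃ (R : T.Ob) (hR : R.sub ≤ Q.sub) (ψ : P ≅ R), ψ.hom ≫ T.incl hR = φ := by
  obtain ⟨R, hR, e, he, he', hφ⟩ := T.fusion.factor _ (T.π_mem φ)
  have hRΔ : R ∈ T.Δ := T.conj_closed _ _ P.mem ⟨e, he, he'⟩
  obtain ⟨ψ, hψ⟩ := T.π_surjective (P := P) (Q := ⟨R, hRΔ⟩) _ he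
  obtain ⟨χ, hχ⟩ := T.π_surjective (P := ⟨R, hRΔ⟩) (Q := P) _ he'
  have h1 : IsIso (ψ ≫ χ) := T.isIso_of_π_eq_id (by rw [T.π_comp, hψ, hχ]; ext x; simp)
  have h2 : IsIso (χ ≫ ψ) := T.isIso_of_π_eq_id (by rw [T.π_comp, hψ, hχ]; ext x; simp)
  have h3 : IsIso ψ := by
    refine ⟨χ ≫ inv (ψ ≫ χ), by rw [← Category.assoc, IsIso.hom_inv_id], ?_⟩
    apply T.cancel_right (φ := χ)
    rw [Category.assoc, Category.assoc, IsIso.inv_hom_id, Category.comp_id, Category.id_comp]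
  have h4 : T.π (ψ ≫ T.incl (Q := Q) hR) = T.π φ := by
    rw [T.π_comp, hψ, hφ]
    ext x
    exact T.π_incl _ _
  obtain ⟨a, ha, hae⟩ := (T.π_orbit _ _).1 h4
  have := T.isIso_of_π_eq_id ha
  exact ⟨⟨R, hRΔ⟩, hR, asIso (a ≫ ψ), by rw [hae]; simp⟩

/-- The image of a morphism, as a subgroup of `S`. -/
def image {P Q : T.Ob} (φ : P ⟶ Q) : Subgroup S := (T.π φ).range.map Q.sub.subtype

theorem mem_image {P Q : T.Ob} {φ : P ⟶ Q} {y : S} :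
    y ∈ T.image φ ↔ ∃ x : P.sub, (T.π φ x : S) = y := by
  rw [image, Subgroup.mem_map]
  constructor
  · rintro ⟨_, ⟨x, rfl⟩, rfl⟩; exact ⟨x, rfl⟩
  · rintro ⟨x, rfl⟩; exact ⟨_, ⟨x, rfl⟩, rfl⟩

theorem image_comp_incl {P Q R : T.Ob} (φ : P ⟶ Q) (h : Q.sub ≤ R.sub) :
    T.image (φ ≫ T.incl h) = T.image φ := by
  ext y; simp [mem_image, π_comp_apply, π_incl]

theorem π_inv_hom {P Q : T.Ob} (φ : P ≅ Q) (y : Q.sub) : T.π φ.hom (T.π φ.inv y) = y := by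
  rw [← π_comp_apply, φ.inv_hom_id, T.π_id]; rfl

theorem image_iso {P Q : T.Ob} (φ : P ≅ Q) : T.image φ.hom = Q.sub := by
  ext y
  rw [mem_image]
  constructor
  · rintro ⟨x, rfl⟩; exact (T.π φ.hom x).2
  · exact fun hy => ⟨T.π φ.inv ⟨y, hy⟩, by rw [π_inv_hom]⟩

theorem image_le_comp {P Q R : T.Ob} (φ : P ⟶ Q) (ψ : Q ⟶ R) :
    T.image (φ ≫ ψ) ≤ T.image ψ := by
  intro y hy
  obtain ⟨x, rfl⟩ := T.mem_image.1 hy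
  exact T.mem_image.2 ⟨T.π φ x, by rw [π_comp_apply]⟩

theorem δ_comp_eq_comp_δ {P Q : T.Ob} (φ : P ⟶ Q) (g : P.sub) :
    T.δ (g : S) (mem_transporter_self g.2) ≫ φ =
      φ ≫ T.δ (T.π φ g : S) (mem_transporter_self (T.π φ g).2) := T.comm φ g

theorem sub_le_top (P : T.Ob) : P.sub ≤ T.top.sub := le_top

/-- The endomorphism `δ_S(s)` of the object `S`. -/
abbrev δTop (s : S) : T.top ⟶ T.top := T.δ s (mem_transporter_top T.top_sub s)

/-- The inclusion of an object into `S`. -/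
def inclTop (P : T.Ob) : P ⟶ T.top := T.incl (T.sub_le_top P)

theorem incl_comp_inclTop {P Q : T.Ob} (h : P.sub ≤ Q.sub) :
    T.incl h ≫ T.inclTop Q = T.inclTop P := T.incl_comp_incl _ _

theorem π_inclTop {P : T.Ob} (x : P.sub) : (T.π (T.inclTop P) x : S) = x := T.π_incl _ x

theorem image_comp_inclTop {P Q : T.Ob} (φ : P ⟶ Q) : T.image (φ ≫ T.inclTop Q) = T.image φ :=
  T.image_comp_incl _ _

theorem δTop_mul (s t : S) : T.δTop (s * t) = T.δTop t ≫ T.δTop s := T.δ_mul _ _ _ _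

theorem δTop_one : T.δTop 1 = 𝟙 T.top := T.δ_one _

theorem inclTop_comp_δTop (P : T.Ob) (g : S) :
    T.inclTop P ≫ T.δTop g = T.δ g (fun _ _ => Subgroup.mem_top _) :=
  T.δ_comp _ _ (by simp)

theorem δ_comp_inclTop {P Q : T.Ob} {g : S} (hg : g ∈ transporter P.sub Q.sub) :
    T.δ g hg ≫ T.inclTop Q = T.inclTop P ≫ T.δTop g := by
  rw [inclTop_comp_δTop]; exact T.δ_comp _ _ (by simp)

theorem comp_δTop_injective {P : T.Ob} (a : P ⟶ T.top) {g h : S}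
    (e : a ≫ T.δTop g = a ≫ T.δTop h) : g = h := by
  obtain ⟨R, hR, ψ, rfl⟩ := T.exists_factor a
  rw [Category.assoc, Category.assoc, Iso.cancel_iso_hom_left] at e
  have e' := e
  rw [show T.incl hR = T.inclTop R from rfl, inclTop_comp_δTop, inclTop_comp_δTop] at e'
  exact T.δ_injective _ _ _ _ e'

theorem δ_comp_top {P : T.Ob} (a : P ⟶ T.top) {g : S} (hg : g ∈ P.sub) :
    T.δ g (mem_transporter_self hg) ≫ a = a ≫ T.δTop (T.π a ⟨g, hg⟩) :=
  T.δ_comp_eq_comp_δ a ⟨g, hg⟩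

theorem incl_comp_δ {P P' Q Q' : T.Ob} (hP : P.sub ≤ P'.sub) (hQ : Q.sub ≤ Q'.sub) {g : S}
    (hg : g ∈ transporter P.sub Q.sub) (hg' : g ∈ transporter P'.sub Q'.sub) :
    T.incl hP ≫ T.δ g hg' = T.δ g hg ≫ T.incl hQ := by
  rw [incl, incl, T.δ_comp _ _ (mul_one g).symm, T.δ_comp _ _ (one_mul g).symm]

/-- It suffices to climb from `P` to `N = N_Q(P)`, since `N` is strictly larger. For `x` in `N`,
axiom (C) recovers the image of `x` from the restriction to `P`, so both maps induce the same
homomorphism on `N`. They then differ by a kernel element that fixes the inclusion of `P`, and left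
freeness makes it trivial. -/
theorem incl_epi_top_aux [Finite S] [Group.IsNilpotent S] {Q : T.Ob} (n : ℕ) {P : T.Ob}
    (hn : Nat.card Q.sub - Nat.card P.sub ≤ n) (h : P.sub ≤ Q.sub)
    {a b : Q ⟶ T.top} (e : T.incl h ≫ a = T.incl h ≫ b) : a = b := by
  induction n generalizing P with
  | zero =>
    have : P = Q := Member.ext (Subgroup.eq_of_le_of_card_ge h (by omega))
    subst this
    simpa [incl_refl] using e
  | succ n ih =>
    by_cases hPQ : P.sub = Q.sub
    · have : P = Q := Member.ext hPQ
      subst this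
      simpa [incl_refl] using e
    have hlt := exists_normalizer_inf_gt (lt_of_le_of_ne h hPQ)
    let N : T.Ob := ⟨Subgroup.normalizer (P.sub : Set S) ⊓ Q.sub, T.mem_Δ_of_le hlt.le⟩
    have hNQ : N.sub ≤ Q.sub := inf_le_right
    have hPN : P.sub ≤ N.sub := hlt.le
    have hcard : Nat.card P.sub < Nat.card N.sub :=
      lt_of_not_ge fun hc => hlt.ne (Subgroup.eq_of_le_of_card_ge hPN hc)
    refine ih (P := N) (by omega) hNQ ?_
    set a' := T.incl hNQ ≫ a
    set b' := T.incl hNQ ≫ b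
    have e' : T.incl hPN ≫ a' = T.incl hPN ≫ b' := by
      simpa only [a', b', incl_comp_incl_assoc] using e
    have hπ : T.π a' = T.π b' := by
      ext1 x
      -- As `x` normalizes `P`, conjugation by it restricts to `P`; this lets `δ x` pass through the
      -- inclusion, where the two maps agree.
      have hx : (x : S) ∈ transporter P.sub P.sub :=
        mem_transporter_of_normal (le_refl (Subgroup.normalizer (P.sub : Set S))) x.2.1
      have hx' := mem_transporter_self x.2
      apply Subtype.ext
      apply T.comp_δTop_injective (T.incl hPN ≫ a')
      rw [Category.assoc, ← T.δ_comp_top a' x.2, ← Category.assoc, T.incl_comp_δ hPN hPN hx hx',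
        Category.assoc, e', ← Category.assoc, ← T.incl_comp_δ hPN hPN hx hx', Category.assoc,
        T.δ_comp_top b' x.2, ← Category.assoc, ← e']
    obtain ⟨c, hc, hce⟩ := (T.π_orbit _ _).1 hπ
    have hc' : T.incl hPN ≫ c = T.incl hPN := by
      apply T.cancel_right (φ := a')
      rw [Category.assoc, ← hce, e']
    rw [hce, T.free_left _ _ hc hc', Category.id_comp]

theorem incl_epi_top [Finite S] [Group.IsNilpotent S] {P Q : T.Ob} (h : P.sub ≤ Q.sub)
    {a b : Q ⟶ T.top} (e : T.incl h ≫ a = T.incl h ≫ b) : a = b :=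
  T.incl_epi_top_aux _ le_rfl h e

theorem δ_inv_comp {P : T.Ob} {a : P ⟶ T.top} {g h : S} (hg : g ∈ transporter P.sub P.sub)
    (hg' : g⁻¹ ∈ transporter P.sub P.sub) (e : T.δ g hg ≫ a = a ≫ T.δTop h) :
    T.δ g⁻¹ hg' ≫ a = a ≫ T.δTop h⁻¹ := by
  have h1 : a ≫ T.δTop h ≫ T.δTop h⁻¹ = a := by
    rw [← T.δTop_mul, inv_mul_cancel, T.δTop_one, Category.comp_id]
  have h2 : T.δ g⁻¹ hg' ≫ T.δ g hg = 𝟙 P := by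
    rw [T.δ_comp _ _ (mul_inv_cancel g).symm]; exact T.δ_one P
  rw [← h1]
  conv_lhs => rw [← Category.assoc a, ← e, ← Category.assoc, ← Category.assoc, h2]
  simp [← T.δTop_mul]

/-- For a morphism `a : P ⟶ S`, the group of all `g ∈ N_S(P)` which `a` conjugates into `S`. -/
def extGroup {P : T.Ob} (a : P ⟶ T.top) : Subgroup S where
  carrier := {g | ∃ (hg : g ∈ Subgroup.normalizer (P.sub : Set S)) (h : S),
    T.δ g (mem_transporter_of_normal le_rfl hg) ≫ a = a ≫ T.δTop h}
  one_mem' := ⟨one_mem _, 1, by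
    rw [T.δTop_one, Category.comp_id]
    exact (congrArg (· ≫ a) (T.δ_one P)).trans (Category.id_comp a)⟩
  mul_mem' := by
    rintro g g' ⟨hg, h, e⟩ ⟨hg', h', e'⟩
    refine ⟨mul_mem hg hg', h * h', ?_⟩
    rw [T.δ_mul g' g (mem_transporter_of_normal le_rfl hg') (mem_transporter_of_normal le_rfl hg),
      Category.assoc, e, ← Category.assoc, e', Category.assoc, T.δTop_mul]
  inv_mem' := by
    rintro g ⟨hg, h, e⟩
    exact ⟨inv_mem hg, h⁻¹, T.δ_inv_comp _ _ e⟩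

theorem le_extGroup {P : T.Ob} (a : P ⟶ T.top) : P.sub ≤ T.extGroup a :=
  fun _ hg => ⟨Subgroup.le_normalizer hg, _, T.δ_comp_top a hg⟩

/-- Axiom (II) applies to the isomorphism of `P` onto its image `R`, with the normalizer of `R` as
the larger target. -/
theorem exists_extend {P : T.Ob} (a : P ⟶ T.top) {E : T.Ob} (hE : E.sub = T.extGroup a) :
    ∃ (h : P.sub ≤ E.sub) (c : E ⟶ T.top), T.incl h ≫ c = a := by
  have hPE : P.sub ≤ E.sub := hE ▸ T.le_extGroup a
  obtain ⟨R, hR, φ, hφ⟩ := T.exists_factor a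
  -- Every element of `R` comes from `P`. Evaluating the relation between `g` and `h` on such
  -- elements shows that `h` maps `R` into `R`; with the same for the inverses, `h` normalizes `R`.
  have key : ∀ (g h : S) (hg : g ∈ transporter P.sub P.sub),
      T.δ g hg ≫ a = a ≫ T.δTop h → h ∈ transporter R.sub R.sub := by
    intro g h hg e r hr
    have h1 := congrArg (fun f => (T.π f (T.π φ.inv ⟨r, hr⟩) : S)) e
    simp only [← hφ, π_comp_apply, π_incl, π_inv_hom, π_δ_apply] at h1
    rw [← h1]
    exact (T.π φ.hom _).2
  let N : T.Ob := ⟨Subgroup.normalizer (R.sub : Set S), T.mem_Δ_of_le Subgroup.le_normalizer⟩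
  obtain ⟨c, hc⟩ := T.extend (P' := E) (Q' := N) φ hPE Subgroup.le_normalizer
    (by rw [hE]; exact fun g hg => hg.choose) le_rfl fun g hg => by
      rw [hE] at hg
      obtain ⟨hg, h, e⟩ := hg
      have h1 := key g h _ e
      have h2 := key g⁻¹ h⁻¹ (mem_transporter_of_normal le_rfl (inv_mem hg)) (T.δ_inv_comp _ _ e)
      refine ⟨h, Subgroup.mem_normalizer_iff.2 fun x => ⟨h1 x, fun hx => ?_⟩, ?_⟩
      · simpa [mul_assoc] using h2 _ hx
      · apply T.cancel_right (φ := T.inclTop R)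
        rw [T.δ_comp_inclTop, ← cancel_epi φ.hom]
        simp only [Category.assoc, Iso.hom_inv_id_assoc]
        have e' := e
        rw [← hφ, Category.assoc] at e'
        exact e'
  refine ⟨hPE, c ≫ T.inclTop N, ?_⟩
  rw [← Category.assoc]
  refine (congrArg (· ≫ T.inclTop N) hc).trans ?_
  rw [Category.assoc]
  exact (congrArg (φ.hom ≫ ·) (T.incl_comp_inclTop Subgroup.le_normalizer)).trans hφ

/-- By (C), `a` conjugates each element of `P'` into `S`, and this relation restricts to `P` when
the element normalizes `P`. -/
theorem normalizer_le_extGroup {P P' : T.Ob} (h : P.sub ≤ P'.sub) (a : P' ⟶ T.top) :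
    Subgroup.normalizer (P.sub : Set S) ⊓ P'.sub ≤ T.extGroup (T.incl h ≫ a) := by
  intro g hg
  refine ⟨hg.1, T.π a ⟨g, hg.2⟩, ?_⟩
  rw [Category.assoc, ← T.δ_comp_top a hg.2, ← Category.assoc, ← Category.assoc]
  exact congrArg (· ≫ a) (T.incl_comp_δ h h _ _).symm

/-! ### Gluing morphisms into `S` -/

section Glue

variable [Finite S] [Group.IsNilpotent S]

/-- Downward induction on the order of `P`. The common restriction to `P` extends to `c` on its
extension group `E`, which contains the normalizers `N₁` and `N₂` of `P` in `P₁` and `P₂`. By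
`incl_epi_top`, `c` agrees with `a` on `N₁` and with `b` on `N₂`. As `N₁`, `N₂` and `E` are strictly
larger than `P`, induction glues `a` with `c`, then `b` with `c`, then the two results along `E`. -/
theorem glue_aux (n : ℕ) {P P₁ P₂ : T.Ob} (hn : Nat.card S - Nat.card P.sub ≤ n)
    (h₁ : P.sub ≤ P₁.sub) (h₂ : P.sub ≤ P₂.sub) (a : P₁ ⟶ T.top) (b : P₂ ⟶ T.top)
    (e : T.incl h₁ ≫ a = T.incl h₂ ≫ b) :
    ∃ (J : T.Ob) (k₁ : P₁.sub ≤ J.sub) (k₂ : P₂.sub ≤ J.sub) (c : J ⟶ T.top),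
      T.incl k₁ ≫ c = a ∧ T.incl k₂ ≫ c = b := by
  induction n generalizing P P₁ P₂ with
  | zero =>
    have hP : P.sub = ⊤ :=
      Subgroup.eq_top_of_le_card _ (by omega)
    have e₁ : P = P₁ := Member.ext (le_antisymm h₁ (by rw [hP]; exact le_top))
    have e₂ : P = P₂ := Member.ext (le_antisymm h₂ (by rw [hP]; exact le_top))
    subst e₁ e₂
    exact ⟨P, le_rfl, le_rfl, a, by rw [incl_refl, Category.id_comp], e ▸ by
      rw [incl_refl, Category.id_comp]⟩
  | succ n ih =>
    by_cases hP₁ : P.sub = P₁.sub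
    · have : P = P₁ := Member.ext hP₁
      subst this
      exact ⟨P₂, h₂, le_rfl, b, by rw [← e, incl_refl, Category.id_comp], by
        rw [incl_refl, Category.id_comp]⟩
    by_cases hP₂ : P.sub = P₂.sub
    · have : P = P₂ := Member.ext hP₂
      subst this
      exact ⟨P₁, le_rfl, h₁, a, by rw [incl_refl, Category.id_comp], by
        rw [e, incl_refl, Category.id_comp]⟩
    have hcard : ∀ X : Subgroup S, P.sub < X → Nat.card S - Nat.card X ≤ n := fun X hX => by
      have h1 : Nat.card P.sub < Nat.card X :=
        lt_of_not_ge fun hc => hX.ne (Subgroup.eq_of_le_of_card_ge hX.le hc)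
      have h2 := Subgroup.card_le_card_group X
      omega
    have lt₁ := exists_normalizer_inf_gt (lt_of_le_of_ne h₁ hP₁)
    have lt₂ := exists_normalizer_inf_gt (lt_of_le_of_ne h₂ hP₂)
    have le₁ := T.normalizer_le_extGroup h₁ a
    have le₂ := T.normalizer_le_extGroup h₂ b
    rw [← e] at le₂
    let E : T.Ob := ⟨_, T.mem_Δ_of_le (T.le_extGroup (T.incl h₁ ≫ a))⟩
    let N₁ : T.Ob := ⟨_, T.mem_Δ_of_le lt₁.le⟩
    let N₂ : T.Ob := ⟨_, T.mem_Δ_of_le lt₂.le⟩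
    obtain ⟨hE, c, hc⟩ := T.exists_extend (T.incl h₁ ≫ a) (E := E) rfl
    have i₁ : N₁.sub ≤ P₁.sub := inf_le_right
    have i₂ : N₂.sub ≤ P₂.sub := inf_le_right
    have j₁ : N₁.sub ≤ E.sub := le₁
    have j₂ : N₂.sub ≤ E.sub := le₂
    have m₁ : P.sub ≤ N₁.sub := lt₁.le
    have m₂ : P.sub ≤ N₂.sub := lt₂.le
    have e₁ : T.incl i₁ ≫ a = T.incl j₁ ≫ c := T.incl_epi_top m₁ (by
      rw [incl_comp_incl_assoc, incl_comp_incl_assoc, hc])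
    have e₂ : T.incl i₂ ≫ b = T.incl j₂ ≫ c := T.incl_epi_top m₂ (by
      rw [incl_comp_incl_assoc, incl_comp_incl_assoc, hc, e])
    obtain ⟨J₁, k₁, l₁, c₁, r₁, s₁⟩ := ih (hcard _ lt₁) i₁ j₁ a c e₁
    obtain ⟨J₂, k₂, l₂, c₂, r₂, s₂⟩ := ih (hcard _ lt₂) i₂ j₂ b c e₂
    obtain ⟨J, k, l, d, r, s⟩ := ih (hcard _ (lt₁.trans_le le₁)) l₁ l₂ c₁ c₂ (s₁.trans s₂.symm)
    refine ⟨J, k₁.trans k, k₂.trans l, d, ?_, ?_⟩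
    · rw [← T.incl_comp_incl_assoc k₁ k, r, r₁]
    · rw [← T.incl_comp_incl_assoc k₂ l, s, r₂]

theorem glue {P P₁ P₂ : T.Ob} (h₁ : P.sub ≤ P₁.sub) (h₂ : P.sub ≤ P₂.sub) (a : P₁ ⟶ T.top)
    (b : P₂ ⟶ T.top) (e : T.incl h₁ ≫ a = T.incl h₂ ≫ b) :
    ∃ (J : T.Ob) (k₁ : P₁.sub ≤ J.sub) (k₂ : P₂.sub ≤ J.sub) (c : J ⟶ T.top),
      T.incl k₁ ≫ c = a ∧ T.incl k₂ ≫ c = b := T.glue_aux _ le_rfl h₁ h₂ a b e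

end Glue

end TransporterSystem

/-! ### Classes of isomorphisms of a transporter system -/

namespace TransporterSystem

variable {p : ℕ} {S : Type u} [Group S] (T : TransporterSystem p S)

/-- The set `Iso(T)/≡` of classes of isomorphisms. -/
def Cls : Type u := Quot (IsRestriction (T := T))

/-- The class of an isomorphism. -/
def cls (φ : T.IsoSet) : T.Cls := Quot.mk _ φ

theorem cls_surjective : Function.Surjective T.cls := Quot.mk_surjective

theorem cls_eq_iff_isoEquiv (φ ψ : T.IsoSet) : T.cls φ = T.cls ψ ↔ IsoEquiv φ ψ := Quot.eq

theorem cls_eq_of_isRestriction {φ ψ : T.IsoSet} (h : IsRestriction φ ψ) : T.cls φ = T.cls ψ :=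
  Quot.sound h

/-- Comparing images yields the containment of targets, and the inclusion into `S` cancels.
Restriction of isomorphisms can thus be tested after composing into `S`. -/
theorem factor_isRestriction {P P' R R' : T.Ob} {φ : P ≅ R} {φ' : P' ≅ R'} (hP : P.sub ≤ P'.sub)
    (h : T.incl hP ≫ φ'.hom ≫ T.inclTop R' = φ.hom ≫ T.inclTop R) :
    IsRestriction (T := T) ⟨φ⟩ ⟨φ'⟩ := by
  have hR : R.sub ≤ R'.sub := by
    have h1 := T.image_le_comp (T.incl hP) (φ'.hom ≫ T.inclTop R')
    rwa [h, image_comp_inclTop, image_comp_inclTop, image_iso, image_iso] at h1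
  refine ⟨hP, hR, T.cancel_right (φ := T.inclTop R') ?_⟩
  rw [Category.assoc, Category.assoc, T.incl_comp_inclTop]
  exact h

theorem IsRestriction.comp_inclTop {φ₀ φ : T.IsoSet} (h : IsRestriction φ₀ φ) :
    ∃ hP : φ₀.source.sub ≤ φ.source.sub,
      T.incl hP ≫ φ.iso.hom ≫ T.inclTop φ.target = φ₀.iso.hom ≫ T.inclTop φ₀.target := by
  obtain ⟨h₁, h₂, e⟩ := h
  exact ⟨h₁, by rw [← Category.assoc, e, Category.assoc, T.incl_comp_inclTop]⟩

/-- The class of the isomorphism onto its image given by a morphism. -/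
noncomputable def homCls {P Q : T.Ob} (φ : P ⟶ Q) : T.Cls :=
  T.cls ⟨(T.exists_factor φ).choose_spec.choose_spec.choose⟩

theorem homCls_eq_of_restrict {P P' Q Q' : T.Ob} (h : P.sub ≤ P'.sub) (φ : P ⟶ Q) (φ' : P' ⟶ Q')
    (e : T.incl h ≫ φ' ≫ T.inclTop Q' = φ ≫ T.inclTop Q) : T.homCls φ = T.homCls φ' := by
  refine T.cls_eq_of_isRestriction (T.factor_isRestriction h ?_)
  have h₁ := (T.exists_factor φ).choose_spec.choose_spec.choose_spec
  have h₂ := (T.exists_factor φ').choose_spec.choose_spec.choose_spec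
  have e' := e
  conv_lhs at e' => rw [← h₂]
  conv_rhs at e' => rw [← h₁]
  rw [Category.assoc, Category.assoc, incl_comp_inclTop, incl_comp_inclTop] at e'
  exact e'

theorem homCls_iso {P Q : T.Ob} (φ : P ≅ Q) : T.homCls φ.hom = T.cls ⟨φ⟩ := by
  refine T.cls_eq_of_isRestriction (T.factor_isRestriction le_rfl ?_)
  have h := (T.exists_factor φ.hom).choose_spec.choose_spec.choose_spec
  conv_lhs => rw [← h]
  rw [incl_refl, Category.id_comp, Category.assoc, incl_comp_inclTop]

theorem homCls_comp_incl {P Q R : T.Ob} (φ : P ⟶ Q) (h : Q.sub ≤ R.sub) :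
    T.homCls (φ ≫ T.incl h) = T.homCls φ :=
  T.homCls_eq_of_restrict le_rfl _ _ (by
    rw [incl_refl, Category.id_comp, Category.assoc, incl_comp_inclTop])

theorem homCls_comp_inclTop {P Q : T.Ob} (φ : P ⟶ Q) :
    T.homCls (φ ≫ T.inclTop Q) = T.homCls φ := T.homCls_comp_incl _ _

theorem homCls_incl_comp {P Q R : T.Ob} (h : P.sub ≤ Q.sub) (φ : Q ⟶ R) :
    T.homCls (T.incl h ≫ φ) = T.homCls φ :=
  T.homCls_eq_of_restrict h _ _ (by rw [Category.assoc])

theorem exists_homCls_eq (f : T.Cls) : ∃ (P : T.Ob) (a : P ⟶ T.top), T.homCls a = f := by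
  obtain ⟨φ, rfl⟩ := T.cls_surjective f
  exact ⟨_, φ.iso.hom ≫ T.inclTop _, by rw [homCls_comp_inclTop, homCls_iso]⟩

section

variable [Finite S] [Group.IsNilpotent S]

/-- Having a common extension is already an equivalence relation that contains restriction:
transitivity is exactly `glue` along the middle term. -/
theorem homCls_eq_iff {P P' : T.Ob} (a : P ⟶ T.top) (b : P' ⟶ T.top) :
    T.homCls a = T.homCls b ↔ ∃ (J : T.Ob) (k₁ : P.sub ≤ J.sub) (k₂ : P'.sub ≤ J.sub)
      (c : J ⟶ T.top), T.incl k₁ ≫ c = a ∧ T.incl k₂ ≫ c = b := by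
  constructor
  · have key : ∀ φ ψ : T.IsoSet, IsoEquiv φ ψ → ∃ (J : T.Ob) (k₁ : φ.source.sub ≤ J.sub)
        (k₂ : ψ.source.sub ≤ J.sub) (c : J ⟶ T.top), T.incl k₁ ≫ c = φ.iso.hom ≫ T.inclTop _ ∧
          T.incl k₂ ≫ c = ψ.iso.hom ≫ T.inclTop _ := by
      intro φ ψ h
      induction h with
      | rel φ ψ h =>
        obtain ⟨h₁, e⟩ := IsRestriction.comp_inclTop T h
        exact ⟨_, h₁, le_rfl, _, e, by rw [incl_refl, Category.id_comp]⟩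
      | refl φ =>
        exact ⟨_, le_rfl, le_rfl, φ.iso.hom ≫ T.inclTop _, by rw [incl_refl, Category.id_comp],
          by rw [incl_refl, Category.id_comp]⟩
      | symm φ ψ _ ih =>
        obtain ⟨J, k₁, k₂, c, e₁, e₂⟩ := ih
        exact ⟨J, k₂, k₁, c, e₂, e₁⟩
      | trans φ ψ χ _ _ ih ih' =>
        obtain ⟨J, k₁, k₂, c, e₁, e₂⟩ := ih
        obtain ⟨J', k₁', k₂', c', e₁', e₂'⟩ := ih'
        obtain ⟨K, l, l', d, r, r'⟩ := T.glue k₂ k₁' c c' (e₂.trans e₁'.symm)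
        exact ⟨K, k₁.trans l, k₂'.trans l', d, by rw [← T.incl_comp_incl_assoc k₁ l, r, e₁],
          by rw [← T.incl_comp_incl_assoc k₂' l', r', e₂']⟩
    intro h
    have h' := key _ _ ((T.cls_eq_iff_isoEquiv _ _).1 h)
    have h₁ := (T.exists_factor a).choose_spec.choose_spec.choose_spec
    have h₂ := (T.exists_factor b).choose_spec.choose_spec.choose_spec
    obtain ⟨J, k₁, k₂, c, e₁, e₂⟩ := h'
    exact ⟨J, k₁, k₂, c, e₁.trans h₁, e₂.trans h₂⟩
  · rintro ⟨J, k₁, k₂, c, rfl, rfl⟩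
    rw [homCls_incl_comp, homCls_incl_comp]

/-- Parallel morphisms are restrictions of one common extension to the same `P`, hence equal. -/
theorem homCls_injective {P Q : T.Ob} {φ ψ : P ⟶ Q} (h : T.homCls φ = T.homCls ψ) : φ = ψ := by
  rw [← T.homCls_comp_inclTop φ, ← T.homCls_comp_inclTop ψ,
    homCls_eq_iff] at h
  obtain ⟨J, k₁, k₂, c, e₁, e₂⟩ := h
  exact T.cancel_right (e₁.symm.trans e₂)

/-- Among the finitely many sources of representatives pick a maximal one. A common extension with
any other representative cannot have a larger source, so it is the chosen representative. -/
theorem exists_maximal_rep (f : T.Cls) : ∃ (A : T.Ob) (a : A ⟶ T.top), T.homCls a = f ∧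
    ∀ (P : T.Ob) (b : P ⟶ T.top), T.homCls b = f → ∃ h : P.sub ≤ A.sub, T.incl h ≫ a = b := by
  have : Finite T.Ob :=
    Finite.of_injective (fun P : T.Ob => P.sub) fun _ _ h => Member.ext h
  obtain ⟨A, ⟨a, ha⟩, hA⟩ := (Set.toFinite {P : T.Ob | ∃ a : P ⟶ T.top, T.homCls a = f}).exists_maximalFor
    (fun P : T.Ob => P.sub) _ (T.exists_homCls_eq f)
  refine ⟨A, a, ha, fun P b hb => ?_⟩
  obtain ⟨J, k₁, k₂, c, rfl, rfl⟩ := (T.homCls_eq_iff a b).1 (ha.trans hb.symm)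
  have hJ := hA (j := J) ⟨c, by rw [← ha, homCls_incl_comp]⟩ k₁
  have : J = A := Member.ext (le_antisymm hJ k₁)
  subst this
  exact ⟨k₂, by rw [T.incl_refl k₁, Category.id_comp]⟩

/-- The source of the largest representative of a class. -/
noncomputable def dom (f : T.Cls) : T.Ob := (T.exists_maximal_rep f).choose

/-- The largest representative of a class, as a morphism to `S`. -/
noncomputable def rep (f : T.Cls) : T.dom f ⟶ T.top := (T.exists_maximal_rep f).choose_spec.choose

theorem homCls_eq_iff_rep {P : T.Ob} {b : P ⟶ T.top} {f : T.Cls} :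
    T.homCls b = f ↔ ∃ h : P.sub ≤ (T.dom f).sub, T.incl h ≫ T.rep f = b := by
  have h := (T.exists_maximal_rep f).choose_spec.choose_spec
  refine ⟨h.2 P b, ?_⟩
  rintro ⟨hP, rfl⟩
  rw [homCls_incl_comp]
  exact h.1

theorem homCls_rep (f : T.Cls) : T.homCls (T.rep f) = f :=
  T.homCls_eq_iff_rep.2 ⟨le_rfl, by rw [incl_refl, Category.id_comp]⟩

theorem cls_eq_iff_rep {P Q : T.Ob} {φ : P ≅ Q} {f : T.Cls} :
    T.cls ⟨φ⟩ = f ↔ ∃ h : P.sub ≤ (T.dom f).sub, T.incl h ≫ T.rep f = φ.hom ≫ T.inclTop Q := by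
  rw [← homCls_eq_iff_rep, homCls_comp_inclTop, homCls_iso]

end

end TransporterSystem

/-! ### Words of isomorphisms -/

namespace RepWord

variable {p : ℕ} {S L : Type u} [Group S] {T : TransporterSystem p S} {q : T.IsoSet → L}

theorem nil_inv {P Q : T.Ob} {φ : P ≅ Q} (h : RepWord q [] φ) :
    ∃ e : P = Q, φ = eqToIso e := by
  generalize hl : ([] : List L) = l at h
  cases h with
  | nil P => exact ⟨rfl, rfl⟩
  | cons => cases hl

theorem cons_inv {f : L} {w : List L} {P R : T.Ob} {φ : P ≅ R} (h : RepWord q (f :: w) φ) :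
    ∃ (Q : T.Ob) (φ₁ : P ≅ Q) (ψ : Q ≅ R), RepWord q w φ₁ ∧ q ⟨ψ⟩ = f ∧ φ = φ₁ ≪≫ ψ := by
  generalize hl : f :: w = l at h
  cases h with
  | nil P => cases hl
  | cons w' φ₁ ψ h =>
    cases hl
    exact ⟨_, φ₁, ψ, h, rfl, rfl⟩

theorem single {P Q : T.Ob} (φ : P ≅ Q) : RepWord q [q ⟨φ⟩] φ := by
  have := RepWord.cons (q := q) [] (Iso.refl P) φ (.nil P)
  rwa [Iso.refl_trans] at this

theorem append {u v : List L} {P Q R : T.Ob} {φ : P ≅ Q} {ψ : Q ≅ R} (hv : RepWord q v φ)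
    (hu : RepWord q u ψ) : RepWord q (u ++ v) (φ ≪≫ ψ) := by
  induction hu with
  | nil => rwa [Iso.trans_refl]
  | cons w ψ₁ χ _ ih =>
    rw [← Iso.trans_assoc]
    exact .cons _ _ _ (ih hv)

theorem split {u v : List L} {P R : T.Ob} {φ : P ≅ R} (h : RepWord q (u ++ v) φ) :
    ∃ (Q : T.Ob) (φ₁ : P ≅ Q) (ψ : Q ≅ R), RepWord q v φ₁ ∧ RepWord q u ψ ∧ φ = φ₁ ≪≫ ψ := by
  induction u generalizing R with
  | nil => exact ⟨R, φ, .refl R, h, .nil R, by simp⟩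
  | cons f u ih =>
    obtain ⟨Q, φ₁, ψ, h₁, rfl, rfl⟩ := cons_inv h
    obtain ⟨Q', φ₂, χ, h₂, h₃, rfl⟩ := ih h₁
    exact ⟨Q', φ₂, χ ≪≫ ψ, h₂, .cons _ _ _ h₃, by rw [Iso.trans_assoc]⟩

end RepWord

namespace TransporterSystem

variable {p : ℕ} {S : Type u} [Group S] (T : TransporterSystem p S)

/-- Inversion of classes. -/
def invCls : T.Cls → T.Cls :=
  Quot.map (fun φ => ⟨φ.iso.symm⟩) fun φ₀ φ ⟨h, h', e⟩ => ⟨h', h, by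
    change T.incl h' ≫ φ.iso.inv = φ₀.iso.inv ≫ T.incl h
    rw [Iso.eq_inv_comp, ← Category.assoc, Iso.comp_inv_eq]; exact e.symm⟩

theorem invCls_cls {P Q : T.Ob} (φ : P ≅ Q) : T.invCls (T.cls ⟨φ⟩) = T.cls ⟨φ.symm⟩ := rfl

theorem invCls_invCls (f : T.Cls) : T.invCls (T.invCls f) = f := by
  obtain ⟨⟨φ⟩, rfl⟩ := T.cls_surjective f
  rfl

theorem repWord_inv {w : List T.Cls} {P Q : T.Ob} {φ : P ≅ Q} (h : RepWord T.cls w φ) :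
    RepWord T.cls (w.map T.invCls).reverse φ.symm := by
  induction h with
  | nil P => exact .nil P
  | cons w φ ψ _ ih =>
    rw [List.map_cons, List.reverse_cons, invCls_cls, Iso.trans_symm]
    exact (RepWord.single ψ.symm).append ih

/-! ### Well-definedness of products of classes -/

section

variable [Finite S] [Group.IsNilpotent S]

/-- The bound on the image keeps the induction going. The next class `f` is defined on both targets
reached so far, so `dom f` contains their join and hence the image of the joint map; `rep f` can
then be applied to it. -/
theorem repWord_joint {w : List T.Cls} {P Q P' Q' : T.Ob} {φ : P ≅ Q} {φ' : P' ≅ Q'}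
    (h : RepWord T.cls w φ) (h' : RepWord T.cls w φ') :
    ∃ (J : T.Ob) (k : P.sub ≤ J.sub) (k' : P'.sub ≤ J.sub) (c : J ⟶ T.top),
      T.incl k ≫ c = φ.hom ≫ T.inclTop Q ∧ T.incl k' ≫ c = φ'.hom ≫ T.inclTop Q' ∧
        T.image c ≤ Q.sub ⊔ Q'.sub := by
  induction w generalizing Q Q' with
  | nil =>
    obtain ⟨e, rfl⟩ := h.nil_inv
    obtain ⟨e', rfl⟩ := h'.nil_inv
    subst e e'
    refine ⟨⟨P.sub ⊔ P'.sub, T.mem_Δ_of_le le_sup_left⟩, le_sup_left, le_sup_right, T.inclTop _,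
      ?_, ?_, ?_⟩
    · simp [incl_comp_inclTop]
    · simp [incl_comp_inclTop]
    · intro y hy
      obtain ⟨x, rfl⟩ := T.mem_image.1 hy
      rw [π_inclTop]; exact x.2
  | cons f w ih =>
    obtain ⟨R, φ₁, ψ, h₁, hf, rfl⟩ := h.cons_inv
    obtain ⟨R', φ₁', ψ', h₁', hf', rfl⟩ := h'.cons_inv
    obtain ⟨J, k, k', c, e, e', hc⟩ := ih h₁ h₁'
    obtain ⟨X, hX, γ, rfl⟩ := T.exists_factor c
    obtain ⟨d, hd⟩ := T.cls_eq_iff_rep.1 hf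
    obtain ⟨d', hd'⟩ := T.cls_eq_iff_rep.1 hf'
    rw [image_comp_incl, image_iso] at hc
    have hXf : X.sub ≤ (T.dom f).sub := hc.trans (sup_le d d')
    have key : ∀ {P R Q : T.Ob} (φ₁ : P ≅ R) (ψ : R ≅ Q) (k : P.sub ≤ J.sub)
        (d : R.sub ≤ (T.dom f).sub), T.incl d ≫ T.rep f = ψ.hom ≫ T.inclTop Q →
        T.incl k ≫ γ.hom ≫ T.incl hX = φ₁.hom ≫ T.inclTop R →
        T.incl k ≫ γ.hom ≫ T.incl hXf ≫ T.rep f = (φ₁ ≪≫ ψ).hom ≫ T.inclTop Q := by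
      intro P R Q φ₁ ψ k d hd e
      have h2 : T.incl k ≫ γ.hom ≫ T.incl hXf = φ₁.hom ≫ T.incl d := by
        apply T.cancel_right (φ := T.inclTop _)
        simp only [Category.assoc, incl_comp_inclTop]
        exact e
      rw [Iso.trans_hom, Category.assoc, ← hd, ← Category.assoc φ₁.hom, ← h2]
      simp only [Category.assoc]
    refine ⟨J, k, k', γ.hom ≫ T.incl hXf ≫ T.rep f, key φ₁ ψ k d hd e, key φ₁' ψ' k' d' hd' e', ?_⟩
    intro y hy
    -- `K` consists of the elements of `dom f` that `rep f` sends into the join of the new targets.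
    -- It is a subgroup containing both old targets, so it contains their join and the image of `γ`.
    let K : Subgroup S :=
      ((Q.sub ⊔ Q'.sub).comap ((Subgroup.subtype _).comp (T.π (T.rep f)))).map (Subgroup.subtype _)
    have hK : ∀ {R Q₀ : T.Ob} (ψ : R ≅ Q₀) (d : R.sub ≤ (T.dom f).sub),
        T.incl d ≫ T.rep f = ψ.hom ≫ T.inclTop Q₀ → Q₀.sub ≤ Q.sub ⊔ Q'.sub → R.sub ≤ K := by
      intro R Q₀ ψ d hd hQ x hx
      refine ⟨⟨x, d hx⟩, ?_, rfl⟩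
      have h3 := congrArg (fun g => (T.π g ⟨x, hx⟩ : S)) hd
      simp only [π_comp_apply, π_inclTop] at h3
      have h4 : T.π (T.incl d) ⟨x, hx⟩ = ⟨x, d hx⟩ := Subtype.ext (T.π_incl d ⟨x, hx⟩)
      rw [h4] at h3
      change (T.π (T.rep f) ⟨x, d hx⟩ : S) ∈ Q.sub ⊔ Q'.sub
      rw [h3]
      exact hQ (T.π ψ.hom _).2
    obtain ⟨x, rfl⟩ := T.mem_image.1 hy
    obtain ⟨z, hz, hz'⟩ :=
      (hc.trans (sup_le (hK ψ d hd le_sup_left) (hK ψ' d' hd' le_sup_right))) (T.π γ.hom x).2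
    rw [π_comp_apply, π_comp_apply]
    have : T.π (T.incl hXf) (T.π γ.hom x) = z :=
      Subtype.ext ((T.π_incl hXf _).trans hz'.symm)
    rw [this]
    exact hz

theorem repWord_unique {w : List T.Cls} {P Q P' Q' : T.Ob} {φ : P ≅ Q} {φ' : P' ≅ Q'}
    (h : RepWord T.cls w φ) (h' : RepWord T.cls w φ') : T.cls ⟨φ⟩ = T.cls ⟨φ'⟩ := by
  obtain ⟨J, k, k', c, e, e', -⟩ := T.repWord_joint h h'
  rw [← homCls_iso, ← homCls_iso, ← T.homCls_comp_inclTop φ.hom, ← e,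
    ← T.homCls_comp_inclTop φ'.hom, ← e', homCls_incl_comp, homCls_incl_comp]

/-- The product of a word of classes. -/
noncomputable def wordProd (w : List T.Cls)
    (hw : ∃ (P Q : T.Ob) (φ : P ≅ Q), RepWord T.cls w φ) : T.Cls :=
  T.cls ⟨hw.choose_spec.choose_spec.choose⟩

theorem wordProd_eq {w : List T.Cls} (hw : ∃ (P Q : T.Ob) (φ : P ≅ Q), RepWord T.cls w φ)
    {P Q : T.Ob} {φ : P ≅ Q} (h : RepWord T.cls w φ) : T.wordProd w hw = T.cls ⟨φ⟩ :=
  T.repWord_unique hw.choose_spec.choose_spec.choose_spec h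

/-- Cutting a chain of representatives at the ends of the block `v` leaves an isomorphism that
represents the product of `v` and composes with its neighbours. -/
theorem repWord_assoc {u v w : List T.Cls} {P Q : T.Ob} {φ : P ≅ Q}
    (h : RepWord T.cls (u ++ v ++ w) φ) :
    ∃ (P Q : T.Ob) (ψ : P ≅ Q), RepWord T.cls (u ++ v ++ w) ψ ∧
      ∀ hv, RepWord T.cls (u ++ [T.wordProd v hv] ++ w) ψ := by
  obtain ⟨_, φ₁, ψ, h₁, h₂, rfl⟩ := h.split
  obtain ⟨_, φ₂, φ₃, h₂', h₃, rfl⟩ := h₂.split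
  refine ⟨_, _, _, h, fun hv => h₁.append (.append ?_ h₃)⟩
  rw [T.wordProd_eq hv h₂']
  exact .single φ₂

/-- The partial group of classes of isomorphisms. -/
noncomputable instance : PartialGroup T.Cls where
  D := {w | ∃ (P Q : T.Ob) (φ : P ≅ Q), RepWord T.cls w φ}
  mprod := T.wordProd
  inv := T.invCls
  nil_mem := ⟨T.top, T.top, _, .nil _⟩
  single_mem x := by
    obtain ⟨⟨φ⟩, rfl⟩ := T.cls_surjective x
    exact ⟨_, _, φ, .single φ⟩
  left_mem u v := by
    rintro ⟨P, Q, φ, h⟩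
    obtain ⟨R, φ₁, ψ, -, h₂, -⟩ := h.split
    exact ⟨_, _, ψ, h₂⟩
  right_mem u v := by
    rintro ⟨P, Q, φ, h⟩
    obtain ⟨R, φ₁, ψ, h₁, -, -⟩ := h.split
    exact ⟨_, _, φ₁, h₁⟩
  prod_single x := by
    obtain ⟨⟨φ⟩, rfl⟩ := T.cls_surjective x
    exact T.wordProd_eq _ (.single φ)
  assoc_mem u v w := by
    rintro ⟨_, _, _, h⟩
    obtain ⟨_, _, ψ, -, h₂⟩ := T.repWord_assoc h
    exact ⟨_, _, ψ, h₂ _⟩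
  prod_assoc u v w hw := by
    obtain ⟨_, _, _, h⟩ := id hw
    obtain ⟨_, _, ψ, h₁, h₂⟩ := T.repWord_assoc h
    rw [T.wordProd_eq _ h₁, T.wordProd_eq _ (h₂ _)]
  inv_inv := T.invCls_invCls
  inv_mem w := by
    rintro ⟨P, Q, φ, h⟩
    exact ⟨_, _, _, h.append (T.repWord_inv h)⟩
  prod_inv w hw := by
    obtain ⟨P, Q, φ, h⟩ := id hw
    rw [T.wordProd_eq _ (h.append (T.repWord_inv h)), T.wordProd_eq _ (.nil P),
      Iso.self_symm_id]

theorem mprod_eq {w : List T.Cls} (hw : w ∈ PartialGroup.D) {P Q : T.Ob} {φ : P ≅ Q}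
    (h : RepWord T.cls w φ) : PartialGroup.mprod w hw = T.cls ⟨φ⟩ := T.wordProd_eq hw h

end

end TransporterSystem

/-! ### Products and conjugation in partial groups -/

namespace PartialGroup

section

variable {L : Type u} [PartialGroup L]

/-- The product of the word `w` is defined and equal to `x`. -/
def IsProd (w : List L) (x : L) : Prop := ∃ h : w ∈ D, mprod w h = x

theorem isProd_mprod {w : List L} (h : w ∈ D) : IsProd w (mprod w h) := ⟨h, rfl⟩

theorem IsProd.unique {w : List L} {x y : L} (h : IsProd w x) (h' : IsProd w y) : x = y := by
  obtain ⟨_, rfl⟩ := h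
  obtain ⟨_, rfl⟩ := h'
  rfl

theorem isProd_single (x : L) : IsProd [x] x := ⟨single_mem x, prod_single x⟩

theorem IsProd.assoc {u v w : List L} {x y : L} (h : IsProd (u ++ v ++ w) x) (hv : IsProd v y) :
    IsProd (u ++ [y] ++ w) x := by
  obtain ⟨h, rfl⟩ := h
  obtain ⟨hv, rfl⟩ := hv
  exact ⟨assoc_mem u v w h, (prod_assoc u v w h).symm⟩

/-- The identity element of a partial group. -/
def one (L : Type u) [PartialGroup L] : L := mprod [] nil_mem

theorem isProd_nil : IsProd ([] : List L) (one L) := ⟨nil_mem, rfl⟩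

theorem IsProd.inv_append {w : List L} (h : w ∈ D) :
    IsProd ((w.map inv).reverse ++ w) (one L) := ⟨inv_mem w h, prod_inv w h⟩

theorem IsProd.inv_self (x : L) : IsProd [inv x, x] (one L) := IsProd.inv_append (single_mem x)

theorem IsProd.self_inv (x : L) : IsProd [x, inv x] (one L) := by
  simpa [PartialGroup.inv_inv] using IsProd.inv_self (inv x)

theorem IsProd.one_left (x : L) : IsProd [one L, x] x :=
  IsProd.assoc (u := []) (v := []) (w := [x]) (isProd_single x) isProd_nil

theorem IsProd.one_right (x : L) : IsProd [x, one L] x :=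
  IsProd.assoc (u := [x]) (v := []) (w := []) (isProd_single x) isProd_nil

/-- The group structure on a subgroup of a partial group. -/
abbrev IsSubgroup.group {H : Set L} (hH : IsSubgroup H) : Group H :=
  letI : Mul H := ⟨fun x y => ⟨mprod [x.1, y.1] (hH.word_mem _ (by simp)),
    hH.prod_mem _ (by simp)⟩⟩
  letI : One H := ⟨⟨one L, hH.prod_mem [] (by simp)⟩⟩
  letI : Inv H := ⟨fun x => ⟨inv x.1, hH.inv_mem _ x.2⟩⟩
  Group.ofLeftAxioms
    (fun x y z => Subtype.ext <| by
      have hw : IsProd [x.1, y.1, z.1] _ := isProd_mprod (hH.word_mem _ (by simp))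
      have h₁ : IsProd [x.1, y.1] (x * y).1 := isProd_mprod _
      have h₂ : IsProd [y.1, z.1] (y * z).1 := isProd_mprod _
      exact IsProd.unique (isProd_mprod (w := [(x * y).1, z.1]) _)
        (hw.assoc (u := []) (v := [x.1, y.1]) h₁) |>.trans
        (IsProd.unique (isProd_mprod (w := [x.1, (y * z).1]) _)
          (IsProd.assoc (u := [x.1]) (v := [y.1, z.1]) (w := []) hw h₂)).symm)
    (fun x => Subtype.ext (IsProd.unique (isProd_mprod _) (IsProd.one_left x.1)))
    (fun x => Subtype.ext (IsProd.unique (isProd_mprod _) (IsProd.inv_self x.1)))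

theorem IsSubgroup.isProd_mul {H : Set L} (hH : IsSubgroup H) (x y : H) :
    letI := hH.group
    IsProd [x.1, y.1] (x * y).1 := isProd_mprod _

end

section Carries

variable {S L : Type u} [PartialGroup L]

/-- The conjugate of `ι x` by `f` is defined and equal to `ι y`. -/
def Carries (ι : S → L) (f : L) (x y : S) : Prop := IsProd [f, ι x, inv f] (ι y)

/-- Conjugation by `f` is defined on `ι Y` and maps it onto `ι Z`. -/
def Acts (ι : S → L) (f : L) (Y Z : Set S) : Prop :=
  (∀ y ∈ Y, ∃ z ∈ Z, Carries ι f y z) ∧ ∀ z ∈ Z, ∃ y ∈ Y, Carries ι f y z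

variable {ι : S → L} {f : L} {Y Z : Set S}

theorem conjSet_subset_iff :
    (ι '' Y ⊆ conjDom f ∧ conjSet f (ι '' Y) ⊆ ι '' Z) ↔ ∀ y ∈ Y, ∃ z ∈ Z, Carries ι f y z := by
  constructor
  · rintro ⟨h₁, h₂⟩ y hy
    obtain ⟨z, hz, e⟩ := h₂ ⟨_, ⟨y, hy, rfl⟩, h₁ ⟨y, hy, rfl⟩, rfl⟩
    exact ⟨z, hz, h₁ ⟨y, hy, rfl⟩, e.symm⟩
  · refine fun h => ⟨?_, ?_⟩
    · rintro _ ⟨y, hy, rfl⟩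
      obtain ⟨z, hz, h', -⟩ := h y hy
      exact h'
    · rintro _ ⟨_, ⟨y, hy, rfl⟩, h', rfl⟩
      obtain ⟨z, hz, h'', e⟩ := h y hy
      exact ⟨z, hz, e.symm⟩

theorem conjSet_eq_iff :
    (ι '' Y ⊆ conjDom f ∧ conjSet f (ι '' Y) = ι '' Z) ↔ Acts ι f Y Z := by
  rw [Acts, ← conjSet_subset_iff, and_assoc]
  refine and_congr_right fun hY => ?_
  rw [Set.Subset.antisymm_iff]
  refine and_congr_right fun _ => ⟨fun h z hz => ?_, ?_⟩
  · obtain ⟨_, ⟨y, hy, rfl⟩, h', e⟩ := h ⟨z, hz, rfl⟩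
    exact ⟨y, hy, h', e⟩
  · rintro h _ ⟨z, hz, rfl⟩
    obtain ⟨y, hy, h', e⟩ := h z hz
    exact ⟨_, ⟨y, hy, rfl⟩, h', e⟩

end Carries

end PartialGroup

section

open PartialGroup

variable {S L : Type u} [Group S] [PartialGroup L] {ι : S → L} {Δ : Set (Subgroup S)}

theorem ConjChain.nil_inv {X Y : Subgroup S} (h : ConjChain ι Δ [] X Y) : X = Y ∧ X ∈ Δ := by
  cases h with
  | nil X hX => exact ⟨rfl, hX⟩

theorem ConjChain.cons_inv {f : L} {w : List L} {X Z : Subgroup S}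
    (h : ConjChain ι Δ (f :: w) X Z) :
    ∃ Y : Subgroup S, ConjChain ι Δ w X Y ∧ Z ∈ Δ ∧ Acts ι f (Y : Set S) (Z : Set S) := by
  cases h with
  | cons f w X Y Z h hZ h₁ h₂ => exact ⟨Y, h, hZ, conjSet_eq_iff.1 ⟨h₁, h₂⟩⟩

theorem ConjChain.cons_acts {f : L} {w : List L} {X Y Z : Subgroup S} (h : ConjChain ι Δ w X Y)
    (hZ : Z ∈ Δ) (hf : Acts ι f (Y : Set S) (Z : Set S)) : ConjChain ι Δ (f :: w) X Z :=
  have h' := conjSet_eq_iff.2 hf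
  .cons _ _ _ Y _ h hZ h'.1 h'.2

theorem ConjChain.mem {w : List L} {X Y : Subgroup S} (h : ConjChain ι Δ w X Y) :
    X ∈ Δ ∧ Y ∈ Δ := by
  induction h with
  | nil X hX => exact ⟨hX, hX⟩
  | cons f w X Y Z _ hZ _ _ ih => exact ⟨ih.1, hZ⟩

end

/-! ### The locality of a transporter system -/

namespace TransporterSystem

open PartialGroup

variable {p : ℕ} {S : Type u} [Group S] (T : TransporterSystem p S)

/-- The embedding of `S` into the set of classes of isomorphisms. -/
def emb (s : S) : T.Cls := T.cls ⟨T.δIso s⟩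

theorem homCls_δ {P Q : T.Ob} (g : S) (hg : g ∈ transporter P.sub Q.sub) :
    T.homCls (T.δ g hg) = T.emb g := by
  rw [emb, ← homCls_iso]
  refine T.homCls_eq_of_restrict (T.sub_le_top P) _ _ ?_
  rw [T.δ_comp_inclTop hg]
  change T.incl _ ≫ T.δTop g ≫ T.inclTop T.top = _
  rw [T.δ_comp_inclTop, ← Category.assoc, incl_comp_inclTop]

theorem exists_conj (P : T.Ob) (g : S) :
    ∃ (R : T.Ob) (κ : P ≅ R), κ.hom ≫ T.inclTop R = T.inclTop P ≫ T.δTop g := by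
  obtain ⟨R, hR, κ, e⟩ := T.exists_factor (T.inclTop P ≫ T.δTop g)
  exact ⟨R, κ, e⟩

theorem repWord_map_emb (w : List S) : RepWord T.cls (w.map T.emb) (T.δIso w.prod) := by
  induction w with
  | nil =>
    have : T.δIso ([] : List S).prod = CategoryTheory.Iso.refl T.top := CategoryTheory.Iso.ext (T.δ_one T.top)
    rw [this]
    exact .nil _
  | cons s w ih =>
    have : T.δIso (s :: w).prod = T.δIso w.prod ≪≫ T.δIso s := by
      apply CategoryTheory.Iso.ext
      rw [Iso.trans_hom]
      exact (T.δ_comp _ _ (by simp)).symm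
    rw [this]
    exact .cons _ _ _ ih

/-! ### Conjugation in the partial group of classes -/

section

variable [Finite S] [Group.IsNilpotent S]

theorem cls_eq_emb_iff {P Q : T.Ob} {φ : P ≅ Q} {g : S} :
    T.cls ⟨φ⟩ = T.emb g ↔ φ.hom ≫ T.inclTop Q = T.inclTop P ≫ T.δTop g := by
  rw [← homCls_iso, ← T.homCls_comp_inclTop, inclTop_comp_δTop, ← T.homCls_δ (P := P) (Q := T.top) g
    fun _ _ => Subgroup.mem_top _]
  exact ⟨T.homCls_injective, fun h => by rw [h]⟩

theorem emb_injective : Function.Injective T.emb := fun g h e =>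
  T.comp_δTop_injective (T.inclTop T.top) <| by
    rw [← T.cls_eq_emb_iff (φ := T.δIso g) |>.1 rfl, ← T.cls_eq_emb_iff (φ := T.δIso g) |>.1 e]

theorem exists_iso_comp_eq_rep (f : T.Cls) : ∃ (B : T.Ob) (ψ : T.dom f ≅ B),
    ψ.hom ≫ T.inclTop B = T.rep f ∧ T.cls ⟨ψ⟩ = f := by
  obtain ⟨B, hB, ψ, e⟩ := T.exists_factor (T.rep f)
  exact ⟨B, ψ, e, ((T.homCls_iso ψ).symm.trans (T.homCls_comp_inclTop ψ.hom).symm).trans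
    ((congrArg T.homCls e).trans (T.homCls_rep f))⟩

/-- `exists_extend` extends `rep f` to this group, and `rep f` is already the largest
representative. -/
theorem extGroup_rep_le (f : T.Cls) : T.extGroup (T.rep f) ≤ (T.dom f).sub := by
  obtain ⟨h, c, e⟩ := T.exists_extend (T.rep f) (E := ⟨_, T.mem_Δ_of_le (T.le_extGroup _)⟩) rfl
  exact (T.homCls_eq_iff_rep (b := c).1 (by rw [← T.homCls_incl_comp h, e, homCls_rep])).choose

/-- The word is represented by `ψ⁻¹`, conjugation by `y` on `dom f`, and `ψ`, where `ψ` is `rep f`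
onto its image. Axiom (C) rewrites the composite as a conjugation in `S`. -/
theorem carries_of_mem_dom {f : T.Cls} {y : S} (hy : y ∈ (T.dom f).sub) :
    Carries T.emb f y (T.π (T.rep f) ⟨y, hy⟩) := by
  obtain ⟨B, ψ, e, hf⟩ := T.exists_iso_comp_eq_rep f
  obtain ⟨R, κ, hκ⟩ := T.exists_conj (T.dom f) y
  have hκ' : κ.hom ≫ T.inclTop R = T.δ y (mem_transporter_self hy) ≫ T.inclTop _ := by
    rw [hκ, δ_comp_inclTop]
  have hR : R = T.dom f := by
    apply Member.ext
    rw [← T.image_iso κ, ← T.image_comp_inclTop κ.hom, hκ', image_comp_inclTop]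
    apply le_antisymm
    · intro x hx
      obtain ⟨z, rfl⟩ := T.mem_image.1 hx
      exact (T.π _ z).2
    · intro x hx
      refine T.mem_image.2 ⟨⟨y⁻¹ * x * y, ?_⟩, ?_⟩
      · exact mul_mem (mul_mem (inv_mem hy) hx) hy
      · rw [π_δ_apply]; group
  subst hR
  have h : RepWord T.cls [f, T.emb y, T.invCls f] (ψ.symm ≪≫ κ ≪≫ ψ) := by
    have h := ((RepWord.single (q := T.cls) ψ.symm).cons _ _ κ).cons _ _ ψ
    rwa [← invCls_cls, hf, T.cls_eq_emb_iff.2 hκ, Iso.trans_assoc] at h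
  refine ⟨⟨_, _, _, h⟩, (T.mprod_eq _ h).trans (T.cls_eq_emb_iff.2 ?_)⟩
  have hκ'' := T.cancel_right hκ'
  simp only [Iso.trans_hom, Iso.symm_hom, Category.assoc, e]
  rw [hκ'', T.δ_comp_top (T.rep f) hy, ← e]
  simp only [Category.assoc, Iso.inv_hom_id_assoc]

/-- The forward direction rests on maximality of `dom f`: representatives of the word show first
that `y` normalizes `dom f`, then that `y` lies in the extension group of `rep f`, hence in `dom f`.
-/
theorem carries_iff {f : T.Cls} {y z : S} :
    Carries T.emb f y z ↔ ∃ hy : y ∈ (T.dom f).sub, (T.π (T.rep f) ⟨y, hy⟩ : S) = z := by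
  constructor
  · intro h
    suffices hy : y ∈ (T.dom f).sub from
      ⟨hy, T.emb_injective ((T.carries_of_mem_dom hy).unique h)⟩
    obtain ⟨⟨P₀, P₃, χ, hχ⟩, hz⟩ := h
    rw [T.mprod_eq _ hχ, T.cls_eq_emb_iff] at hz
    obtain ⟨P₂, χ', φ₃, hχ', h₃, rfl⟩ := hχ.cons_inv
    obtain ⟨P₁, φ₁', φ₂, h₁', h₂, rfl⟩ := hχ'.cons_inv
    obtain ⟨_, φ₁'', φ₁, h₁'', h₁, rfl⟩ := h₁'.cons_inv
    obtain ⟨rfl, rfl⟩ := h₁''.nil_inv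
    have h₁ : T.cls ⟨φ₁.symm⟩ = f := by
      rw [← invCls_cls, h₁]; exact T.invCls_invCls f
    obtain ⟨d₁, e₁⟩ := T.cls_eq_iff_rep.1 h₁
    obtain ⟨d₂, e₃⟩ := T.cls_eq_iff_rep.1 h₃
    have e₂ := T.cls_eq_emb_iff.1 h₂
    obtain ⟨R, κ, hκ⟩ := T.exists_conj (T.dom f) y
    obtain ⟨k₁, k₂, hk⟩ := T.factor_isRestriction (φ := φ₂) (φ' := κ) d₁ (by
      rw [hκ, e₂, ← Category.assoc, incl_comp_inclTop])
    dsimp only at k₁ k₂ hk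
    -- This morphism lives on the `y`-conjugate `R` of `dom f` and extends `φ₃`, the representative
    -- of the leftmost `f`. So `R` lies in `dom f`, and equality of orders gives `R = dom f`.
    have hc : T.homCls (κ.inv ≫ T.rep f ≫ T.δTop z) = f := by
      refine (T.homCls_incl_comp k₂ _).symm.trans (Eq.trans (congrArg T.homCls ?_)
        ((T.homCls_comp_inclTop φ₃.hom).trans ((T.homCls_iso φ₃).trans h₃)))
      rw [← cancel_epi φ₂.hom, ← Category.assoc φ₂.hom, ← hk, Category.assoc, Iso.hom_inv_id_assoc,
        ← Category.assoc, e₁, ← cancel_epi φ₁.hom]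
      simpa using hz.symm
    obtain ⟨hR, hR'⟩ := T.homCls_eq_iff_rep.1 hc
    have hRA : R = T.dom f := by
      apply Member.ext
      apply Subgroup.eq_of_le_of_card_ge hR
      have : Function.Bijective (T.π κ.inv) := ⟨T.π_injective _, fun x =>
        ⟨T.π κ.hom x, T.π_inv_hom κ.symm x⟩⟩
      exact (Nat.card_congr (Equiv.ofBijective _ this)).ge
    subst hRA
    rw [incl_refl, Category.id_comp, Iso.eq_inv_comp] at hR'
    have hn : ∀ x : (T.dom f).sub, (T.π κ.hom x : S) = y * x * y⁻¹ := fun x => by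
      have h := congrArg (fun g => (T.π g x : S)) hκ
      simp only [inclTop_comp_δTop, π_comp_apply, π_inclTop] at h
      exact h.trans (T.π_δ_apply _ _ _)
    have hy : y ∈ Subgroup.normalizer ((T.dom f).sub : Set S) := by
      refine Subgroup.mem_normalizer_iff.2 fun x => ⟨fun hx => ?_, fun hx => ?_⟩
      · exact hn ⟨x, hx⟩ ▸ (T.π κ.hom ⟨x, hx⟩).2
      · have h := hn (T.π κ.inv ⟨_, hx⟩)
        rw [π_inv_hom] at h
        have h' : x = (T.π κ.inv ⟨_, hx⟩ : S) := by simpa using h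
        rw [h']
        exact (T.π κ.inv ⟨_, hx⟩).2
    refine T.extGroup_rep_le f ⟨hy, z, ?_⟩
    have : T.δ y (mem_transporter_of_normal le_rfl hy) = κ.hom :=
      T.cancel_right (φ := T.inclTop _) (by rw [hκ, δ_comp_inclTop])
    rw [this]
    exact hR'
  · rintro ⟨hy, rfl⟩
    exact T.carries_of_mem_dom hy

/-- Through `carries_iff`, conjugation by `f` on `P` is the restriction of `rep f`. This matches
chains of members of `Δ` with chains of composable isomorphisms. -/
theorem acts_iff {f : T.Cls} {P Q : T.Ob} :
    Acts T.emb f (P.sub : Set S) (Q.sub : Set S) ↔ ∃ ψ : P ≅ Q, T.cls ⟨ψ⟩ = f := by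
  constructor
  · rintro ⟨h₁, h₂⟩
    have hP : P.sub ≤ (T.dom f).sub := fun y hy => by
      obtain ⟨z, -, h⟩ := h₁ y hy
      exact (T.carries_iff.1 h).choose
    have hπ : ∀ x : P.sub, Carries T.emb f x (T.π (T.incl hP ≫ T.rep f) x) := fun x => by
      refine T.carries_iff.2 ⟨hP x.2, ?_⟩
      rw [π_comp_apply]
      exact congrArg (fun y => (T.π (T.rep f) y : S)) (Subtype.ext (T.π_incl hP x).symm)
    obtain ⟨R, hR, ψ, e⟩ := T.exists_factor (T.incl hP ≫ T.rep f)
    have hRQ : R = Q := by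
      apply Member.ext
      rw [← T.image_iso ψ, ← T.image_comp_incl ψ.hom hR, e]
      ext z
      rw [mem_image]
      constructor
      · rintro ⟨x, rfl⟩
        obtain ⟨z, hz, h⟩ := h₁ x x.2
        rw [T.emb_injective ((hπ x).unique h)]
        exact hz
      · intro hz
        obtain ⟨y, hy, h⟩ := h₂ z hz
        exact ⟨⟨y, hy⟩, T.emb_injective ((hπ ⟨y, hy⟩).unique h)⟩
    subst hRQ
    exact ⟨ψ, T.cls_eq_iff_rep.2 ⟨hP, e.symm⟩⟩
  · rintro ⟨ψ, hψ⟩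
    obtain ⟨hP, e⟩ := T.cls_eq_iff_rep.1 hψ
    have hπ : ∀ x : P.sub, Carries T.emb f x (T.π ψ.hom x) := fun x => by
      refine T.carries_iff.2 ⟨hP x.2, ?_⟩
      have h := congrArg (fun g => (T.π g x : S)) e
      simp only [π_comp_apply, π_inclTop] at h
      rw [← h]
      exact congrArg (fun y => (T.π (T.rep f) y : S)) (Subtype.ext (T.π_incl hP x).symm)
    exact ⟨fun y hy => ⟨_, (T.π ψ.hom ⟨y, hy⟩).2, hπ ⟨y, hy⟩⟩, fun z hz =>
      ⟨_, (T.π ψ.inv ⟨z, hz⟩).2, by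
        have := hπ (T.π ψ.inv ⟨z, hz⟩)
        rwa [π_inv_hom] at this⟩⟩

theorem conjChain_of_repWord {w : List T.Cls} {P Q : T.Ob} {φ : P ≅ Q}
    (h : RepWord T.cls w φ) : ConjChain T.emb T.Δ w P.sub Q.sub := by
  induction h with
  | nil P => exact .nil _ P.mem
  | @cons w P Q R φ ψ _ ih => exact ih.cons_acts R.mem (T.acts_iff.2 ⟨ψ, rfl⟩)

theorem repWord_of_conjChain {w : List T.Cls} {X Y : Subgroup S}
    (h : ConjChain T.emb T.Δ w X Y) : ∃ (hX : X ∈ T.Δ) (hY : Y ∈ T.Δ)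
      (φ : (⟨X, hX⟩ : T.Ob) ≅ ⟨Y, hY⟩), RepWord T.cls w φ := by
  induction w generalizing Y with
  | nil =>
    obtain ⟨rfl, hX⟩ := h.nil_inv
    exact ⟨hX, hX, _, .nil _⟩
  | cons f w ih =>
    obtain ⟨Z, hZ, hY, ha⟩ := h.cons_inv
    obtain ⟨hX, hZ, φ, hφ⟩ := ih hZ
    obtain ⟨ψ, rfl⟩ := (T.acts_iff (P := ⟨Z, hZ⟩) (Q := ⟨Y, hY⟩)).1 ha
    exact ⟨hX, hY, _, .cons _ _ _ hφ⟩

theorem emb_map_mem_D (w : List S) : w.map T.emb ∈ D := ⟨_, _, _, T.repWord_map_emb w⟩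

theorem isProd_map_emb (w : List S) : IsProd (w.map T.emb) (T.emb w.prod) :=
  ⟨T.emb_map_mem_D w, T.mprod_eq _ (T.repWord_map_emb w)⟩

theorem mem_Δ_of_carries {f : T.Cls} {P Q : Subgroup S} (hP : P ∈ T.Δ)
    (h : ∀ y ∈ P, ∃ z ∈ Q, Carries T.emb f y z) : Q ∈ T.Δ := by
  have hPf : P ≤ (T.dom f).sub := fun y hy => by
    obtain ⟨z, -, h⟩ := h y hy
    exact (T.carries_iff.1 h).choose
  obtain ⟨R, hR, ψ, e⟩ := T.exists_factor (T.incl (P := ⟨P, hP⟩) hPf ≫ T.rep f)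
  refine T.over_closed R.sub Q R.mem ?_
  rw [← T.image_iso ψ, ← T.image_comp_incl ψ.hom hR, e]
  intro z hz
  obtain ⟨x, rfl⟩ := T.mem_image.1 hz
  obtain ⟨z, hz, h⟩ := h x x.2
  obtain ⟨hx, rfl⟩ := T.carries_iff.1 h
  rw [π_comp_apply]
  rw [show T.π (T.incl (P := ⟨P, hP⟩) (Q := T.dom f) hPf) x = ⟨x, hPf x.2⟩ from
    Subtype.ext (T.π_incl _ x)]
  exact hz

theorem exists_aut_of_carries {f : T.Cls} (h : ∀ s, ∃ t, Carries T.emb f s t) :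
    ∃ χ : Aut T.top, T.cls ⟨χ⟩ = f := by
  obtain ⟨B, ψ, e, hψ⟩ := T.exists_iso_comp_eq_rep f
  have hA : T.dom f = T.top := Member.ext (top_le_iff.1 fun s _ => by
    obtain ⟨t, ht⟩ := h s
    exact (T.carries_iff.1 ht).choose)
  have hB : B = T.top := by
    apply Member.ext
    apply Subgroup.eq_top_of_card_eq
    have : Function.Bijective (T.π ψ.hom) := ⟨T.π_injective _, fun x =>
      ⟨T.π ψ.inv x, T.π_inv_hom ψ x⟩⟩
    rw [← Nat.card_congr (Equiv.ofBijective _ this), hA]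
    exact Nat.card_congr Subgroup.topEquiv.toEquiv
  subst hB
  clear e
  generalize T.dom f = A at ψ hA
  subst hA
  exact ⟨ψ, hψ⟩

theorem isProd_cls_mul (χ χ' : Aut T.top) :
    IsProd [T.cls ⟨χ⟩, T.cls ⟨χ'⟩] (T.cls ⟨χ * χ'⟩) := by
  have h : RepWord T.cls [T.cls ⟨χ⟩, T.cls ⟨χ'⟩] (χ' ≪≫ χ) := .cons _ _ _ (.single χ')
  exact ⟨⟨_, _, _, h⟩, T.mprod_eq _ h⟩

theorem emb_aut_injective {χ χ' : Aut T.top} (h : T.cls ⟨χ⟩ = T.cls ⟨χ'⟩) : χ = χ' :=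
  CategoryTheory.Iso.ext 
    (T.homCls_injective ((T.homCls_iso _).trans (h.trans (T.homCls_iso _).symm)))

/-- If `S` were proper in the `p`-group `H`, some element of `H` outside `S` would normalize `S`. It
is then the class of an automorphism of the object `S`, and such automorphisms with class in `H`
form a `p`-group containing the Sylow subgroup of axiom (I), so the element lies in `S` after all.
-/
theorem range_emb_maximal [Fact p.Prime] (H : Set T.Cls) (hH : IsPSubgroup p H)
    (hle : Set.range T.emb ⊆ H) : H = Set.range T.emb := by
  obtain ⟨hH, n, hn⟩ := hH
  let _ := hH.group
  have : Finite H := Nat.finite_of_card_ne_zero (by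
    rw [hn]; exact (pow_pos (Fact.out : p.Prime).pos n).ne')
  have hp : IsPGroup p H := IsPGroup.of_card hn
  have hnil : Group.IsNilpotent H := hp.isNilpotent
  obtain ⟨A, hA⟩ := T.sylow T.top T.top_sub
  have hemb : ∀ s t, IsProd [T.emb s, T.emb t] (T.emb (s * t)) := fun s t => by
    simpa using T.isProd_map_emb [s, t]
  let ε : S →* H := MonoidHom.mk' (fun s => ⟨T.emb s, hle ⟨s, rfl⟩⟩) fun s t =>
    Subtype.ext ((hemb s t).unique (hH.isProd_mul ⟨T.emb s, hle ⟨s, rfl⟩⟩ ⟨T.emb t, hle ⟨t, rfl⟩⟩))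
  let K : Subgroup (Aut T.top) :=
    { carrier := {χ | T.cls ⟨χ⟩ ∈ H}
      one_mem' := hle ⟨1, congrArg T.cls (congrArg _ (CategoryTheory.Iso.ext (T.δ_one T.top)))⟩
      mul_mem' := fun {a b} ha hb => by
        have h := (T.isProd_cls_mul a b).unique (hH.isProd_mul ⟨_, ha⟩ ⟨_, hb⟩)
        change T.cls ⟨a * b⟩ ∈ H
        rw [h]
        exact Subtype.prop _
      inv_mem' := fun {a} ha => hH.inv_mem _ ha }
  let κ : K →* H := MonoidHom.mk' (fun χ => ⟨T.cls ⟨χ.1⟩, χ.2⟩) fun a b =>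
    Subtype.ext ((T.isProd_cls_mul a b).unique (hH.isProd_mul ⟨_, a.2⟩ ⟨_, b.2⟩))
  have hK : IsPGroup p K := hp.of_injective κ fun a b h =>
    Subtype.ext (T.emb_aut_injective (congrArg Subtype.val h))
  have hAK : (A : Subgroup (Aut T.top)) ≤ K := fun a ha => by
    obtain ⟨g, hg, e⟩ := (hA a).1 ha
    refine hle ⟨g, ?_⟩
    exact congrArg (fun φ : Aut T.top => T.cls ⟨φ⟩) (CategoryTheory.Iso.ext e.symm)
  have hKA := A.is_maximal' hK hAK
  have hrange : ε.range = ⊤ := by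
    by_contra hne
    obtain ⟨h, hh, hh'⟩ := SetLike.exists_of_lt
      (Group.normalizerCondition_of_isNilpotent _ (lt_top_iff_ne_top.2 hne))
    apply hh'
    have hc : ∀ s, ∃ t, Carries T.emb h.1 s t := fun s => by
      obtain ⟨t, ht⟩ := (Subgroup.mem_normalizer_iff.1 hh (ε s)).1 ⟨s, rfl⟩
      refine ⟨t, ?_⟩
      have hw : ∀ x ∈ [h.1, T.emb s, PartialGroup.inv h.1], x ∈ H := by
        simpa using ⟨hle ⟨s, rfl⟩, hH.inv_mem _ h.2⟩
      have h₁ : IsProd [h.1, T.emb s, PartialGroup.inv h.1] _ := isProd_mprod (hH.word_mem _ hw)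
      have h₂ := IsProd.assoc (u := []) (v := [h.1, T.emb s]) h₁ (hH.isProd_mul h (ε s))
      have h₃ := h₂.unique (hH.isProd_mul (h * ε s) h⁻¹)
      refine ⟨hH.word_mem _ hw, ?_⟩
      rw [h₃, ← ht]
      rfl
    obtain ⟨χ, hχ⟩ := T.exists_aut_of_carries hc
    have hχK : χ ∈ K := by
      change T.cls ⟨χ⟩ ∈ H
      rw [hχ]; exact h.2
    rw [hKA] at hχK
    obtain ⟨g, hg, e⟩ := (hA χ).1 hχK
    exact ⟨g, Subtype.ext (hχ ▸
      congrArg (fun φ : Aut T.top => T.cls ⟨φ⟩) (CategoryTheory.Iso.ext e.symm))⟩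
  refine (Set.Subset.antisymm hle fun x hx => ?_).symm
  obtain ⟨s, hs⟩ : (⟨x, hx⟩ : H) ∈ ε.range := hrange ▸ Subgroup.mem_top _
  exact ⟨s, congrArg Subtype.val hs⟩

instance : Finite T.Cls := by
  have : Finite T.Ob :=
    Finite.of_injective (fun P : T.Ob => P.sub) fun _ _ h => Member.ext h
  have : ∀ P Q : T.Ob, Finite (P ⟶ Q) := T.finite
  let g : (Σ P : T.Ob, P ⟶ T.top) → T.Cls := fun x => T.homCls x.2
  exact Finite.of_surjective g fun f => by
    obtain ⟨P, a, h⟩ := T.exists_homCls_eq f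
    exact ⟨⟨P, a⟩, h⟩

/-- The locality of a transporter system. -/
noncomputable def locality [Fact p.Prime] : Locality p S where
  carrier := T.Cls
  finite := inferInstance
  ι := T.emb
  ι_injective := T.emb_injective
  ι_mem := T.emb_map_mem_D
  ι_prod w := T.mprod_eq _ (T.repWord_map_emb w)
  Δ := T.Δ
  domain w := ⟨fun ⟨_, _, _, h⟩ => ⟨_, _, T.conjChain_of_repWord h⟩, fun ⟨_, _, h⟩ => by
    obtain ⟨_, _, φ, h⟩ := T.repWord_of_conjChain h
    exact ⟨_, _, φ, h⟩⟩
  closed P Q f hP h₁ h₂ := T.mem_Δ_of_carries hP (conjSet_subset_iff.1 ⟨h₁, h₂⟩)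
  maximal := T.range_emb_maximal

end

end TransporterSystem

/-! ### The functor from transporter systems to localities -/

namespace TransporterSystem

open PartialGroup

variable {p : ℕ}

section

variable {S : Type u} [Group S] {T : TransporterSystem p S}

theorem card_eq_of_iso {P Q : T.Ob} (φ : P ≅ Q) : Nat.card P.sub = Nat.card Q.sub :=
  Nat.card_congr (Equiv.ofBijective (T.π φ.hom)
    ⟨T.π_injective _, fun x => ⟨T.π φ.inv x, T.π_inv_hom φ x⟩⟩)

theorem homCls_eq_iff_of_eq_top [Finite S] [Group.IsNilpotent S] {P P' R : T.Ob} (hR : R = T.top)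
    (a : P ⟶ R) (b : P' ⟶ R) :
    T.homCls a = T.homCls b ↔ ∃ (J : T.Ob) (k₁ : P.sub ≤ J.sub) (k₂ : P'.sub ≤ J.sub)
      (c : J ⟶ R), T.incl k₁ ≫ c = a ∧ T.incl k₂ ≫ c = b := by
  subst hR
  exact T.homCls_eq_iff a b

end

namespace Iso

variable {S S' : Type u} [Group S] [Group S'] {T : TransporterSystem p S}
  {T' : TransporterSystem p S'} (α : Iso T T')

theorem map_injective {P Q : T.Ob} {φ ψ : P ⟶ Q} (h : α.functor.map φ = α.functor.map ψ) :
    φ = ψ :=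
  have := α.isEquivalence
  α.functor.map_injective h

theorem map_surjective {P Q : T.Ob} (φ : α.functor.obj P ⟶ α.functor.obj Q) :
    ∃ ψ, α.functor.map ψ = φ :=
  have := α.isEquivalence
  α.functor.map_surjective φ

theorem obj_le {P Q : T.Ob} (h : P.sub ≤ Q.sub) :
    (α.functor.obj P).sub ≤ (α.functor.obj Q).sub := (α.inclusions P Q h).choose

theorem map_incl {P Q : T.Ob} (h : P.sub ≤ Q.sub) :
    α.functor.map (T.incl h) = T'.incl (α.obj_le h) := (α.inclusions P Q h).choose_spec

/-- Essential surjectivity gives an object whose image is isomorphic to `S'`. That image is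
contained in the image of `S`, and comparing orders finishes. -/
theorem obj_top [Finite S'] : α.functor.obj T.top = T'.top := by
  have := α.isEquivalence
  have h₁ := card_eq_of_iso (α.functor.objObjPreimageIso T'.top)
  have h₂ := α.obj_le (T.sub_le_top (α.functor.objPreimage T'.top))
  apply Member.ext
  apply Subgroup.eq_top_of_le_card
  rw [← Nat.card_congr (Subgroup.topEquiv (G := S')).toEquiv]
  exact h₁.ge.trans (Subgroup.card_le_of_le h₂)

theorem exists_map_δTop (s : S) : ∃ (t : S') (ht : t ∈ (α.functor.obj T.top).sub),
    α.functor.map (T.δTop s) = T'.δ t (mem_transporter_self ht) := by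
  have h : α.functor.map (T.δTop s) ∈ T'.inner (α.functor.obj T.top) := by
    rw [← α.isotypical]
    exact ⟨_, ⟨s, Subgroup.mem_top s, rfl⟩, rfl⟩
  exact h

/-- The isomorphism `S ≃ S'` induced by an isomorphism of transporter systems. -/
noncomputable def topEquiv [Finite S'] : S ≃* S' :=
  MulEquiv.ofBijective
    (MonoidHom.mk' (fun s => (α.exists_map_δTop s).choose) fun s t => by
      obtain ⟨hs, es⟩ := (α.exists_map_δTop s).choose_spec
      obtain ⟨ht, et⟩ := (α.exists_map_δTop t).choose_spec
      obtain ⟨hst, est⟩ := (α.exists_map_δTop (s * t)).choose_spec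
      refine T'.δ_injective _ _ (mem_transporter_self hst) (mul_mem_transporter (mem_transporter_self ht)
        (mem_transporter_self hs)) ?_
      rw [← est, T'.δ_mul _ _ (mem_transporter_self ht) (mem_transporter_self hs), ← es, ← et,
        T.δTop_mul, Functor.map_comp])
    ⟨fun s t h => by
      obtain ⟨hs, es⟩ := (α.exists_map_δTop s).choose_spec
      obtain ⟨ht, et⟩ := (α.exists_map_δTop t).choose_spec
      have h' : (α.exists_map_δTop s).choose = (α.exists_map_δTop t).choose := h
      refine T.δ_injective _ _ _ _ (α.map_injective (es.trans (Eq.trans ?_ et.symm)))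
      congr 1, fun t => by
      have ht : T'.δ t (mem_transporter_top (congrArg Member.sub α.obj_top) t) ∈
          T'.inner (α.functor.obj T.top) :=
        ⟨t, by rw [α.obj_top]; exact Subgroup.mem_top t, rfl⟩
      rw [← α.isotypical] at ht
      obtain ⟨_, ⟨s, hs, rfl⟩, e⟩ := ht
      obtain ⟨hs, es⟩ := (α.exists_map_δTop s).choose_spec
      exact ⟨s, T'.δ_injective _ _ _ _ (es.symm.trans e)⟩⟩

section

variable [Finite S']

theorem map_δTop (s : S) : α.functor.map (T.δTop s) =
    T'.δ (α.topEquiv s) (mem_transporter_top (congrArg Member.sub α.obj_top) _) :=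
  (α.exists_map_δTop s).choose_spec.choose_spec

/-- The inclusion of `P` into `S` intertwines `δ_P(g)` with `δ_S(g)`, and `α` preserves inclusions.
-/
theorem topEquiv_eq {P : T.Ob} {g : S} {g' : S'} (hg : g ∈ transporter P.sub P.sub)
    (hg' : g' ∈ transporter (α.functor.obj P).sub (α.functor.obj P).sub)
    (h : α.functor.map (T.δ g hg) = T'.δ g' hg') : g' = α.topEquiv g := by
  have e := congrArg (fun f => α.functor.map f) (T.δ_comp_inclTop hg)
  simp only [inclTop] at e
  rw [Functor.map_comp, Functor.map_comp, h, map_incl, map_δTop, incl, T'.δ_comp _ _ rfl,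
    T'.δ_comp _ _ rfl] at e
  simpa using T'.δ_injective _ _ _ _ e

theorem obj_sub (P : T.Ob) : (α.functor.obj P).sub = P.sub.map α.topEquiv.toMonoidHom := by
  ext g'
  constructor
  · intro hg'
    have h : T'.δ g' (mem_transporter_self hg') ∈ T'.inner (α.functor.obj P) := ⟨g', hg', rfl⟩
    rw [← α.isotypical] at h
    obtain ⟨_, ⟨g, hg, rfl⟩, e⟩ := h
    exact ⟨g, hg, (α.topEquiv_eq _ _ e).symm⟩
  · rintro ⟨g, hg, rfl⟩
    have h : α.functor.map (T.δ g (mem_transporter_self hg)) ∈ T'.inner (α.functor.obj P) := by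
      rw [← α.isotypical]
      exact ⟨_, ⟨g, hg, rfl⟩, rfl⟩
    obtain ⟨g', hg', e⟩ := h
    have := α.topEquiv_eq _ _ e
    subst this
    exact hg'

theorem le_of_obj_le {P Q : T.Ob} (h : (α.functor.obj P).sub ≤ (α.functor.obj Q).sub) :
    P.sub ≤ Q.sub := by
  rw [obj_sub, obj_sub] at h
  exact (Subgroup.map_le_map_iff_of_injective α.topEquiv.injective).1 h

theorem obj_injective {P Q : T.Ob} (h : α.functor.obj P = α.functor.obj Q) : P = Q :=
  Member.ext (le_antisymm (α.le_of_obj_le (congrArg Member.sub h).le)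
    (α.le_of_obj_le (congrArg Member.sub h).ge))

/-- An isomorphism onto `X` from an object in the image of `α`, followed by the inclusion of `X`
into the image of `S`, lifts to a morphism of `T`. The image `R` of the lift is sent exactly to `X`,
since `α` preserves isomorphisms and inclusions. -/
theorem obj_surjective (X : T'.Ob) : ∃ P, α.functor.obj P = X := by
  have := α.isEquivalence
  have hX : X.sub ≤ (α.functor.obj T.top).sub := by
    rw [obj_top]; exact T'.sub_le_top X
  let χ := α.functor.objObjPreimageIso X
  obtain ⟨a, ha⟩ := α.map_surjective (χ.hom ≫ T'.incl hX)
  obtain ⟨R, hR, γ, rfl⟩ := T.exists_factor a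
  refine ⟨R, Member.ext ?_⟩
  rw [Functor.map_comp, map_incl] at ha
  rw [← T'.image_iso χ, ← T'.image_comp_incl χ.hom hX, ← ha, image_comp_incl]
  exact (T'.image_iso (α.functor.mapIso γ)).symm

end

/-- The map on classes induced by an isomorphism of transporter systems. -/
def mapCls : T.Cls → T'.Cls :=
  Quot.map α.mapIso fun _ _ ⟨h, h', e⟩ => ⟨α.obj_le h, α.obj_le h', by
    have e' := congrArg (fun f => α.functor.map f) e
    simp only [Functor.map_comp, map_incl] at e'
    exact e'⟩

theorem mapCls_cls (φ : T.IsoSet) : α.mapCls (T.cls φ) = T'.cls (α.mapIso φ) := rfl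

theorem mapCls_homCls {P Q : T.Ob} (φ : P ⟶ Q) :
    α.mapCls (T.homCls φ) = T'.homCls (α.functor.map φ) := by
  obtain ⟨R, hR, ψ, rfl⟩ := T.exists_factor φ
  rw [homCls_comp_incl, homCls_iso, Functor.map_comp, map_incl, homCls_comp_incl]
  exact (T'.homCls_iso (α.functor.mapIso ψ)).symm

theorem repWord_map {w : List T.Cls} {P Q : T.Ob} {φ : P ≅ Q} (h : RepWord T.cls w φ) :
    RepWord T'.cls (w.map α.mapCls) (α.functor.mapIso φ) := by
  induction h with
  | nil P =>
    rw [Functor.mapIso_refl]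
    exact .nil _
  | cons w φ ψ _ ih =>
    rw [Functor.mapIso_trans]
    exact .cons _ _ _ ih

section

variable [Finite S']

theorem mapCls_emb (s : S) : α.mapCls (T.emb s) = T'.emb (α.topEquiv s) := by
  rw [emb, ← homCls_iso, mapCls_homCls]
  exact (congrArg T'.homCls (α.map_δTop s)).trans (T'.homCls_δ _ _)

theorem mapCls_surjective : Function.Surjective α.mapCls := by
  intro f
  obtain ⟨X, a, rfl⟩ := T'.exists_homCls_eq f
  obtain ⟨P, rfl⟩ := α.obj_surjective X
  have key : ∀ R, R = T'.top → ∃ b : α.functor.obj P ⟶ R, T'.homCls b = T'.homCls a := by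
    rintro _ rfl
    exact ⟨a, rfl⟩
  obtain ⟨b, hb⟩ := key _ α.obj_top
  obtain ⟨c, rfl⟩ := α.map_surjective b
  exact ⟨T.homCls c, by rw [mapCls_homCls, hb]⟩

variable [Finite S] [Group.IsNilpotent S] [Group.IsNilpotent S']

/-- A common extension in `T'` of the images of two representatives lifts to `T`, because `α` is
bijective on objects, reflects containment, and is full and faithful. -/
theorem mapCls_injective : Function.Injective α.mapCls := by
  intro f g h
  rw [← T.homCls_rep f, ← T.homCls_rep g, mapCls_homCls, mapCls_homCls,
    homCls_eq_iff_of_eq_top α.obj_top] at h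
  obtain ⟨J, k₁, k₂, c, e₁, e₂⟩ := h
  obtain ⟨J, rfl⟩ := α.obj_surjective J
  obtain ⟨c, rfl⟩ := α.map_surjective c
  rw [← α.map_incl (α.le_of_obj_le k₁), ← Functor.map_comp] at e₁
  rw [← α.map_incl (α.le_of_obj_le k₂), ← Functor.map_comp] at e₂
  rw [← T.homCls_rep f, ← T.homCls_rep g, ← α.map_injective e₁, ← α.map_injective e₂,
    homCls_incl_comp, homCls_incl_comp]

theorem repWord_of_map {w : List T.Cls} {P Q : T.Ob} {φ : α.functor.obj P ≅ α.functor.obj Q}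
    (h : RepWord T'.cls (w.map α.mapCls) φ) : ∃ ψ : P ≅ Q, RepWord T.cls w ψ := by
  have := α.isEquivalence
  induction w generalizing Q with
  | nil =>
    obtain ⟨e, -⟩ := h.nil_inv
    obtain rfl := α.obj_injective e
    exact ⟨_, .nil _⟩
  | cons f w ih =>
    obtain ⟨X, φ₁, χ, h₁, hf, rfl⟩ := RepWord.cons_inv h
    obtain ⟨R, rfl⟩ := α.obj_surjective X
    obtain ⟨ψ, hψ⟩ := ih h₁
    have hf' : T.cls ⟨α.functor.preimageIso χ⟩ = f := α.mapCls_injective <| by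
      rw [mapCls_cls, ← hf, mapIso]
      exact congrArg (fun φ => T'.cls ⟨φ⟩) (CategoryTheory.Iso.ext (by simp))
    exact ⟨ψ ≪≫ α.functor.preimageIso χ, hf' ▸ .cons _ _ _ hψ⟩

theorem map_mem_D_iff (w : List T.Cls) :
    w.map α.mapCls ∈ PartialGroup.D ↔ w ∈ PartialGroup.D := by
  constructor
  · rintro ⟨X, Y, φ, h⟩
    obtain ⟨P, rfl⟩ := α.obj_surjective X
    obtain ⟨Q, rfl⟩ := α.obj_surjective Y
    obtain ⟨ψ, h⟩ := α.repWord_of_map h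
    exact ⟨_, _, ψ, h⟩
  · rintro ⟨P, Q, φ, h⟩
    exact ⟨_, _, _, α.repWord_map h⟩

variable [Fact p.Prime]

/-- The isomorphism of localities induced by an isomorphism of transporter systems. -/
noncomputable def locality : T.locality.Iso T'.locality where
  toEquiv := Equiv.ofBijective α.mapCls ⟨α.mapCls_injective, α.mapCls_surjective⟩
  mem_iff w := α.map_mem_D_iff w
  map_prod w hw := by
    obtain ⟨P, Q, φ, h⟩ := id hw
    exact (congrArg α.mapCls (T.mprod_eq hw h)).trans (T'.mprod_eq _ (α.repWord_map h)).symm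
  map_Δ := by
    have key : ∀ P : T.Ob, α.mapCls '' (T.emb '' (P.sub : Set S)) =
        T'.emb '' ((α.functor.obj P).sub : Set S') := fun P => by
      rw [obj_sub, Subgroup.coe_map, Set.image_image, Set.image_image]
      exact Set.image_congr fun s _ => α.mapCls_emb s
    apply Set.Subset.antisymm
    · rintro _ ⟨P, hP, rfl⟩
      exact ⟨_, (α.functor.obj ⟨P, hP⟩).mem, (key ⟨P, hP⟩).symm⟩
    · rintro _ ⟨X, hX, rfl⟩
      obtain ⟨P, hP⟩ := α.obj_surjective ⟨X, hX⟩
      exact ⟨P.sub, P.mem, (key P).trans (by rw [hP]; rfl)⟩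

theorem RestrictsTo.locality {α : Iso T T'} {e : S ≃* S'} (h : α.RestrictsTo e) :
    α.locality.RestrictsTo e := by
  obtain ⟨h, h'⟩ := h
  intro s
  change α.mapCls (T.emb s) = T'.emb (e s)
  rw [emb, ← homCls_iso, mapCls_homCls]
  exact (congrArg T'.homCls (h' s)).trans (T'.homCls_δ _ _)

end

end Iso

end TransporterSystem

instance {p : ℕ} [Fact p.Prime] (S : FinPGroup.{u} p) : Group.IsNilpotent S := S.isPGroup.isNilpotent

/-- The functor `Λ` from transporter systems to localities. -/
noncomputable def localityFunctor (p : ℕ) [Fact p.Prime] :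
    TransporterCat.{u} p ⥤ LocalityCat.{u} p where
  obj T := ⟨T.S, T.sys.locality⟩
  map {T T'} α := (TransporterCat.toIso α).locality
  map_id T := by
    apply Locality.Iso.ext
    ext f
    obtain ⟨φ, rfl⟩ := T.sys.cls_surjective f
    rfl
  map_comp {T T' T''} α β := by
    apply Locality.Iso.ext
    ext f
    obtain ⟨φ, rfl⟩ := T.sys.cls_surjective f
    rfl

theorem localityFunctor_rigid {p : ℕ} [Fact p.Prime] {T T' : TransporterCat.{u} p} (α : T ⟶ T')
    (h : TransporterCat.rigid p α) : LocalityCat.rigid p ((localityFunctor p).map α) := by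
  obtain ⟨h, hα⟩ := h
  exact ⟨h, hα.locality⟩

theorem isLocalityOf_localityFunctor {p : ℕ} [Fact p.Prime] (T : TransporterCat.{u} p) :
    IsLocalityOf T ((localityFunctor p).obj T) T.sys.cls where
  surjective := T.sys.cls_surjective
  eq_iff := T.sys.cls_eq_iff_isoEquiv
  mem_iff w := Iff.rfl
  prod_eq w hw P Q φ h := T.sys.mprod_eq hw h
  same_S := ⟨rfl, by
    have : ∀ P : Subgroup T.S, P.map (FinPGroup.eqEquiv (rfl : T.S = T.S)).toMonoidHom = P :=
      fun P => Subgroup.map_id P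
    exact ⟨(Set.image_congr fun P _ => this P).trans (Set.image_id _), fun s => rfl⟩⟩

/-! ### Conjugation in localities -/

namespace PartialGroup

variable {L : Type u} [PartialGroup L]

/-- The inverse of a word. -/
def invWord (w : List L) : List L := (w.map inv).reverse

theorem invWord_append (u v : List L) : invWord (u ++ v) = invWord v ++ invWord u := by
  simp [invWord]

theorem invWord_invWord (w : List L) : invWord (invWord w) = w := by
  simp [invWord, List.map_reverse, Function.comp_def, PartialGroup.inv_inv]

/-- The inversion axiom puts the inverse on the left; applied to the inverse word it puts it on the
right, and the surplus letters are cut off. -/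
theorem append_invWord_mem {u v : List L} (h : u ++ v ∈ D) : u ++ v ++ invWord v ∈ D := by
  have h₁ : invWord (u ++ v) ∈ D := left_mem _ _ (inv_mem _ h)
  have h₂ : invWord (invWord (u ++ v)) ++ invWord (u ++ v) ∈ D := inv_mem _ h₁
  rw [invWord_invWord, invWord_append, ← List.append_assoc] at h₂
  exact left_mem _ _ h₂

theorem invWord_append_mem {u v : List L} (h : u ++ v ∈ D) : invWord u ++ (u ++ v) ∈ D := by
  have h₁ : invWord (u ++ v) ++ (u ++ v) ∈ D := inv_mem _ h
  rw [invWord_append, List.append_assoc] at h₁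
  exact right_mem _ _ h₁

theorem IsProd.mem {w : List L} {x : L} (h : IsProd w x) : w ∈ D := h.choose

theorem exists_isProd {w : List L} (h : w ∈ D) : ∃ x, IsProd w x := ⟨_, isProd_mprod h⟩

theorem IsProd.eq_of_one {x y : L} (h : IsProd [x, y] (one L)) : x = inv y := by
  obtain ⟨z, hz⟩ := exists_isProd (append_invWord_mem (u := [x]) (v := [y]) h.mem)
  have h₁ : IsProd [one L, inv y] z := hz.assoc (u := []) (v := [x, y]) (w := [inv y]) h
  have h₂ : IsProd [x, one L] z :=
    IsProd.assoc (u := [x]) (v := [y, inv y]) (w := []) hz (IsProd.self_inv y)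
  exact ((IsProd.one_right x).unique h₂).trans (h₁.unique (IsProd.one_left _))

theorem IsProd.invWord {w : List L} {x : L} (h : IsProd w x) :
    IsProd (invWord w) (inv x) := by
  have h₁ : IsProd (PartialGroup.invWord w ++ w) (one L) := IsProd.inv_append h.mem
  obtain ⟨k, hk⟩ := exists_isProd (left_mem _ _ h₁.mem)
  have h₂ : IsProd ([k] ++ w) (one L) := IsProd.assoc (u := []) (w := w) h₁ hk
  have h₃ : IsProd [k, x] (one L) :=
    IsProd.assoc (u := [k]) (v := w) (w := []) (by simpa using h₂) h
  rwa [← h₃.eq_of_one]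

end PartialGroup

namespace Locality

open PartialGroup

variable {p : ℕ} {S : Type u} [Group S] (L : Locality p S)

theorem isProd_ι (w : List S) : IsProd (w.map L.ι) (L.ι w.prod) := ⟨L.ι_mem w, L.ι_prod w⟩

theorem isProd_ι_mul (s t : S) : IsProd [L.ι s, L.ι t] (L.ι (s * t)) := by
  simpa using L.isProd_ι [s, t]

theorem ι_one : L.ι 1 = one L.carrier := (L.isProd_ι []).unique isProd_nil

theorem ι_inv (s : S) : L.ι s⁻¹ = inv (L.ι s) :=
  IsProd.eq_of_one (by simpa [ι_one] using L.isProd_ι_mul s⁻¹ s)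

variable {L}

theorem carries_unique {f : L.carrier} {x y y' : S} (h : Carries L.ι f x y)
    (h' : Carries L.ι f x y') : y = y' := L.ι_injective (h.unique h')

/-- The word `f⁻¹ f x f⁻¹ f` lies in the domain, and bracketing it in two ways gives the claim. -/
theorem carries_inv {f : L.carrier} {x y : S} (h : Carries L.ι f x y) :
    Carries L.ι (inv f) y x := by
  have h₁ : [f, L.ι x, inv f, f] ∈ D := by
    simpa [invWord, PartialGroup.inv_inv] using
      append_invWord_mem (u := [f, L.ι x]) (v := [inv f]) h.mem
  have h₂ : [PartialGroup.inv f, f, L.ι x, PartialGroup.inv f, f] ∈ D := by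
    simpa [invWord] using invWord_append_mem (u := [f]) (v := [L.ι x, inv f, f]) h₁
  obtain ⟨t, ht⟩ := exists_isProd h₂
  have e₁ : IsProd [inv f, L.ι y, f] t :=
    ht.assoc (u := [inv f]) (v := [f, L.ι x, inv f]) (w := [f]) h
  have e₂ : IsProd [one _, L.ι x, inv f, f] t :=
    ht.assoc (u := []) (v := [inv f, f]) (w := [L.ι x, inv f, f]) (IsProd.inv_self f)
  have e₃ : IsProd [L.ι x, inv f, f] t :=
    e₂.assoc (u := []) (v := [one _, L.ι x]) (w := [inv f, f]) (IsProd.one_left _)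
  have e₄ : IsProd [L.ι x, one _] t :=
    IsProd.assoc (u := [L.ι x]) (v := [inv f, f]) (w := []) e₃ (IsProd.inv_self f)
  rw [Carries, (IsProd.one_right _).unique e₄]
  simpa [PartialGroup.inv_inv] using e₁

theorem carries_inj {f : L.carrier} {x x' y : S} (h : Carries L.ι f x y)
    (h' : Carries L.ι f x' y) : x = x' := carries_unique (carries_inv h) (carries_inv h')

theorem carries_one (f : L.carrier) : Carries L.ι f 1 1 := by
  rw [Carries, ι_one]
  exact IsProd.assoc (u := [f]) (v := []) (w := [inv f]) (IsProd.self_inv f) isProd_nil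

theorem carries_inv_inv {f : L.carrier} {x y : S} (h : Carries L.ι f x y) :
    Carries L.ι f x⁻¹ y⁻¹ := by
  rw [Carries, ι_inv, ι_inv]
  simpa [invWord, PartialGroup.inv_inv] using h.invWord

theorem carries_ι (g x : S) : Carries L.ι (L.ι g) x (g * x * g⁻¹) := by
  rw [Carries, ← ι_inv]
  simpa [mul_assoc] using L.isProd_ι [g, x, g⁻¹]

theorem acts_inv {f : L.carrier} {Y Z : Set S} (h : Acts L.ι f Y Z) : Acts L.ι (inv f) Z Y :=
  ⟨fun z hz => by
    obtain ⟨y, hy, h⟩ := h.2 z hz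
    exact ⟨y, hy, carries_inv h⟩, fun y hy => by
    obtain ⟨z, hz, h⟩ := h.1 y hy
    exact ⟨z, hz, carries_inv h⟩⟩

theorem acts_ι (g : S) (P : Subgroup S) :
    Acts L.ι (L.ι g) (P : Set S) (P.map (MulAut.conj g).toMonoidHom : Subgroup S) :=
  ⟨fun y hy => ⟨_, ⟨y, hy, rfl⟩, carries_ι g y⟩, by
    rintro _ ⟨y, hy, rfl⟩
    exact ⟨y, hy, carries_ι g y⟩⟩

theorem acts_ι_self {g : S} {P : Subgroup S} (hg : g ∈ P) :
    Acts L.ι (L.ι g) (P : Set S) (P : Set S) :=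
  ⟨fun y hy => ⟨_, mem_transporter_self hg y hy, carries_ι g y⟩, fun y hy =>
    ⟨g⁻¹ * y * g, mul_mem (mul_mem (inv_mem hg) hy) hg, by
      have h := carries_ι (L := L) g (g⁻¹ * y * g)
      have e : g * (g⁻¹ * y * g) * g⁻¹ = y := by group
      rwa [e] at h⟩⟩

theorem mem_Δ_of_carries {f : L.carrier} {P Q : Subgroup S} (hP : P ∈ L.Δ)
    (h : ∀ y ∈ P, ∃ z ∈ Q, Carries L.ι f y z) : Q ∈ L.Δ := by
  obtain ⟨h₁, h₂⟩ := (conjSet_subset_iff (Y := (P : Set S)) (Z := (Q : Set S))).2 h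
  exact L.closed P Q f hP h₁ h₂

theorem mem_Δ_of_acts {f : L.carrier} {P Q : Subgroup S} (hP : P ∈ L.Δ)
    (h : Acts L.ι f (P : Set S) (Q : Set S)) : Q ∈ L.Δ := mem_Δ_of_carries hP h.1

theorem mem_Δ_of_le {P Q : Subgroup S} (hP : P ∈ L.Δ) (h : P ≤ Q) : Q ∈ L.Δ :=
  mem_Δ_of_carries (f := L.ι 1) hP fun y hy => ⟨y, h hy, by simpa using carries_ι (L := L) 1 y⟩

theorem mem_D_of_conjChain {w : List L.carrier} {X Y : Subgroup S}
    (h : ConjChain L.ι L.Δ w X Y) : w ∈ D := (L.domain w).2 ⟨X, Y, h⟩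

theorem _root_.ConjChain.cons_of_acts {f : L.carrier} {w : List L.carrier} {X Y Z : Subgroup S}
    (h : ConjChain L.ι L.Δ w X Y) (hf : Acts L.ι f (Y : Set S) (Z : Set S)) :
    ConjChain L.ι L.Δ (f :: w) X Z := h.cons_acts (mem_Δ_of_acts h.mem.2 hf) hf

variable (L) in
theorem exists_acts (f : L.carrier) : ∃ P Q : Subgroup S, P ∈ L.Δ ∧ Q ∈ L.Δ ∧
    Acts L.ι f (P : Set S) (Q : Set S) := by
  obtain ⟨X, Y, h⟩ := (L.domain [f]).1 (single_mem f)
  obtain ⟨Z, hZ, hY, ha⟩ := h.cons_inv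
  obtain ⟨rfl, hX⟩ := hZ.nil_inv
  exact ⟨X, Y, hX, hY, ha⟩

/-- The word `g f x f⁻¹ g⁻¹` is in the domain through the chain `R, Q, P, P, Q, R`, where `x ∈ P`
serves for the middle step. -/
theorem carries_comp {f g h : L.carrier} {P Q R : Subgroup S} (hP : P ∈ L.Δ)
    (hf : Acts L.ι f (P : Set S) (Q : Set S)) (hg : Acts L.ι g (Q : Set S) (R : Set S))
    (hh : IsProd [g, f] h) {x y z : S} (hx : x ∈ P) (hxy : Carries L.ι f x y)
    (hyz : Carries L.ι g y z) : Carries L.ι h x z := by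
  have hQ := mem_Δ_of_acts hP hf
  have hR := mem_Δ_of_acts hQ hg
  have hw : [g, f, L.ι x, inv f, inv g] ∈ D := mem_D_of_conjChain
    (.cons_of_acts (.cons_of_acts (.cons_of_acts (.cons_of_acts (.cons_of_acts (.nil R hR) (acts_inv hg)) (acts_inv hf))
      (acts_ι_self hx)) hf) hg)
  obtain ⟨t, ht⟩ := exists_isProd hw
  have h₁ : IsProd [g, L.ι y, inv g] t :=
    ht.assoc (u := [g]) (v := [f, L.ι x, inv f]) (w := [inv g]) hxy
  have h₂ : IsProd [h, L.ι x, inv f, inv g] t :=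
    ht.assoc (u := []) (v := [g, f]) (w := [L.ι x, inv f, inv g]) hh
  have h₃ : IsProd [h, L.ι x, inv h] t :=
    IsProd.assoc (u := [h, L.ι x]) (v := [inv f, inv g]) (w := []) h₂ hh.invWord
  rwa [h₁.unique hyz] at h₃

theorem acts_comp {f g h : L.carrier} {P Q R : Subgroup S} (hP : P ∈ L.Δ)
    (hf : Acts L.ι f (P : Set S) (Q : Set S)) (hg : Acts L.ι g (Q : Set S) (R : Set S))
    (hh : IsProd [g, f] h) : Acts L.ι h (P : Set S) (R : Set S) := by
  constructor
  · intro x hx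
    obtain ⟨y, hy, hxy⟩ := hf.1 x hx
    obtain ⟨z, hz, hyz⟩ := hg.1 y hy
    exact ⟨z, hz, carries_comp hP hf hg hh hx hxy hyz⟩
  · intro z hz
    obtain ⟨y, hy, hyz⟩ := hg.2 z hz
    obtain ⟨x, hx, hxy⟩ := hf.2 y hy
    exact ⟨x, hx, carries_comp hP hf hg hh hx hxy hyz⟩

/-- The conjugate of a subgroup. -/
abbrev conjSub (a : S) (P : Subgroup S) : Subgroup S := P.map (MulAut.conj a).toMonoidHom

theorem exists_isProd_comm {f : L.carrier} {a b : S} (hab : Carries L.ι f a b) :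
    ∃ g, IsProd [f, L.ι a] g ∧ IsProd [L.ι b, f] g := by
  have h₁ : [f, L.ι a, inv f, f] ∈ D := by
    simpa [invWord, PartialGroup.inv_inv] using
      append_invWord_mem (u := [f, L.ι a]) (v := [inv f]) hab.mem
  obtain ⟨g, hg⟩ := exists_isProd h₁
  have h₂ : IsProd [f, L.ι a, one _] g :=
    IsProd.assoc (u := [f, L.ι a]) (v := [inv f, f]) (w := []) hg (IsProd.inv_self f)
  exact ⟨g, IsProd.assoc (u := [f]) (v := [L.ι a, one _]) (w := []) h₂ (IsProd.one_right _),
    hg.assoc (u := []) (v := [f, L.ι a, inv f]) (w := [f]) hab⟩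

/-- Since `f a = b f`, the product `b f a⁻¹` is `f`; factor by factor it moves the `a`-conjugate of
`P` to `P`, to `Q`, and to the `b`-conjugate of `Q`. -/
theorem acts_conjSub {f : L.carrier} {P Q : Subgroup S} (hP : P ∈ L.Δ)
    (hf : Acts L.ι f (P : Set S) (Q : Set S)) {a b : S} (hab : Carries L.ι f a b) :
    Acts L.ι f (conjSub a P : Set S) (conjSub b Q : Set S) := by
  have hQ := mem_Δ_of_acts hP hf
  have haP := mem_Δ_of_acts hP (acts_ι (L := L) a P)
  have ha := acts_inv (acts_ι (L := L) a P)
  have hb := acts_ι (L := L) b Q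
  obtain ⟨t, ht⟩ := exists_isProd (mem_D_of_conjChain (w := [L.ι b, f, inv (L.ι a)])
    (.cons_of_acts (.cons_of_acts (.cons_of_acts (.nil _ haP) ha) hf) hb))
  have htf : t = f := by
    obtain ⟨g, h₄, h₂⟩ := exists_isProd_comm hab
    obtain ⟨s, hs⟩ := exists_isProd (append_invWord_mem (u := [f]) (v := [L.ι a]) h₄.mem)
    have h₅ : IsProd [f, one _] s :=
      IsProd.assoc (u := [f]) (v := [L.ι a, inv (L.ι a)]) (w := []) hs (IsProd.self_inv _)
    have h₆ : IsProd [g, inv (L.ι a)] s :=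
      hs.assoc (u := []) (v := [f, L.ι a]) (w := [inv (L.ι a)]) h₄
    have h₇ : IsProd [g, inv (L.ι a)] t :=
      ht.assoc (u := []) (v := [L.ι b, f]) (w := [inv (L.ι a)]) h₂
    exact (h₇.unique h₆).trans (h₅.unique (IsProd.one_right f))
  rw [htf] at ht
  obtain ⟨h, hh⟩ := exists_isProd (right_mem [L.ι b] [f, inv (L.ι a)] ht.mem)
  exact acts_comp haP (acts_comp haP ha hf hh) hb
    (IsProd.assoc (u := [L.ι b]) (v := [f, inv (L.ι a)]) (w := []) ht hh)

/-- All that is at stake is that the word `f a₁ f⁻¹ f a₂ f⁻¹` is in the domain. Neither `aᵢ` need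
lie in a member of `Δ` already known to be conjugated into `S` by `f`, so the chain uses
`acts_conjSub` to follow `f` on successive conjugates of one fixed `P`. -/
theorem carries_mul {f : L.carrier} {a₁ b₁ a₂ b₂ : S} (h₁ : Carries L.ι f a₁ b₁)
    (h₂ : Carries L.ι f a₂ b₂) : Carries L.ι f (a₁ * a₂) (b₁ * b₂) := by
  obtain ⟨P, Q, hP, hQ, hf⟩ := L.exists_acts f
  have hf₂ := acts_conjSub hP hf h₂
  have hP₂ := mem_Δ_of_acts hP (acts_ι (L := L) a₂ P)
  have hf₁ := acts_conjSub hP₂ hf₂ h₁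
  have hw : [f, L.ι a₁, inv f, f, L.ι a₂, inv f] ∈ D := mem_D_of_conjChain
    (.cons_of_acts (.cons_of_acts (.cons_of_acts (.cons_of_acts (.cons_of_acts (.cons_of_acts (.nil Q hQ) (acts_inv hf))
      (acts_ι a₂ P)) hf₂) (acts_inv hf₂)) (acts_ι a₁ _)) hf₁)
  obtain ⟨t, ht⟩ := exists_isProd hw
  have e₁ : IsProd [L.ι b₁, f, L.ι a₂, inv f] t :=
    ht.assoc (u := []) (v := [f, L.ι a₁, inv f]) (w := [f, L.ι a₂, inv f]) h₁
  have e₂ : IsProd [L.ι b₁, L.ι b₂] t :=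
    IsProd.assoc (u := [L.ι b₁]) (v := [f, L.ι a₂, inv f]) (w := []) e₁ h₂
  have e₃ : IsProd [f, L.ι a₁, one _, L.ι a₂, inv f] t :=
    ht.assoc (u := [f, L.ι a₁]) (v := [inv f, f]) (w := [L.ι a₂, inv f]) (IsProd.inv_self f)
  have e₄ : IsProd [f, L.ι a₁, L.ι a₂, inv f] t :=
    e₃.assoc (u := [f]) (v := [L.ι a₁, one _]) (w := [L.ι a₂, inv f]) (IsProd.one_right _)
  have e₅ : IsProd [f, L.ι (a₁ * a₂), inv f] t :=
    e₄.assoc (u := [f]) (v := [L.ι a₁, L.ι a₂]) (w := [inv f]) (L.isProd_ι_mul _ _)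
  rwa [e₂.unique (L.isProd_ι_mul _ _)] at e₅

variable (L) in
/-- The group of all elements of `S` which `f` conjugates into `S`. -/
def domSub (f : L.carrier) : Subgroup S where
  carrier := {x | ∃ y, Carries L.ι f x y}
  one_mem' := ⟨1, carries_one f⟩
  mul_mem' := fun ⟨_, h⟩ ⟨_, h'⟩ => ⟨_, carries_mul h h'⟩
  inv_mem' := fun ⟨_, h⟩ => ⟨_, carries_inv_inv h⟩

theorem domSub_mem (f : L.carrier) : L.domSub f ∈ L.Δ := by
  obtain ⟨P, Q, hP, -, h⟩ := L.exists_acts f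
  exact mem_Δ_of_le hP fun x hx => by
    obtain ⟨y, -, h⟩ := h.1 x hx
    exact ⟨y, h⟩

variable (L) in
/-- Conjugation by `f` is defined on `P` and maps it into `Q`. -/
def Maps (f : L.carrier) (P Q : Subgroup S) : Prop := ∀ x ∈ P, ∃ y ∈ Q, Carries L.ι f x y

theorem Maps.mem {f : L.carrier} {P Q : Subgroup S} (h : L.Maps f P Q) (hP : P ∈ L.Δ) : Q ∈ L.Δ :=
  mem_Δ_of_carries hP h

theorem Maps.exists_acts {f : L.carrier} {P Q : Subgroup S} (h : L.Maps f P Q) :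
    ∃ R ≤ Q, Acts L.ι f (P : Set S) (R : Set S) := by
  refine ⟨{ carrier := {y | ∃ x ∈ P, Carries L.ι f x y}
            one_mem' := ⟨1, P.one_mem, carries_one f⟩
            mul_mem' := fun ⟨_, h, h'⟩ ⟨_, k, k'⟩ => ⟨_, P.mul_mem h k, carries_mul h' k'⟩
            inv_mem' := fun ⟨_, h, h'⟩ => ⟨_, P.inv_mem h, carries_inv_inv h'⟩ }, ?_, ?_, ?_⟩
  · rintro y ⟨x, hx, hxy⟩
    obtain ⟨y', hy', hxy'⟩ := h x hx
    rwa [carries_unique hxy hxy']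
  · intro x hx
    obtain ⟨y, -, hxy⟩ := h x hx
    exact ⟨y, ⟨x, hx, hxy⟩, hxy⟩
  · rintro y ⟨x, hx, hxy⟩
    exact ⟨x, hx, hxy⟩

theorem Maps.mono {f : L.carrier} {P Q P' Q' : Subgroup S} (h : L.Maps f P Q) (hP : P' ≤ P)
    (hQ : Q ≤ Q') : L.Maps f P' Q' := fun x hx => by
  obtain ⟨y, hy, h⟩ := h x (hP hx)
  exact ⟨y, hQ hy, h⟩

theorem maps_ι {g : S} {P Q : Subgroup S} (h : g ∈ transporter P Q) : L.Maps (L.ι g) P Q :=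
  fun x hx => ⟨_, h x hx, carries_ι g x⟩

theorem maps_one {P Q : Subgroup S} (h : P ≤ Q) : L.Maps (one L.carrier) P Q := by
  rw [← ι_one]
  exact maps_ι (one_mem_transporter h)

theorem maps_domSub (f : L.carrier) : L.Maps f (L.domSub f) ⊤ :=
  fun _ ⟨y, h⟩ => ⟨y, Subgroup.mem_top y, h⟩

theorem Maps.le_domSub {f : L.carrier} {P Q : Subgroup S} (h : L.Maps f P Q) : P ≤ L.domSub f :=
  fun x hx => by
    obtain ⟨y, -, h⟩ := h x hx
    exact ⟨y, h⟩

/-- A word of elements mapping members of `Δ` into one another is in the domain. -/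
theorem exists_conjChain_append {f : L.carrier} {P Q : Subgroup S} {w : List L.carrier}
    {X : Subgroup S} (hw : ConjChain L.ι L.Δ w X P) (h : L.Maps f P Q) :
    ∃ R ≤ Q, ConjChain L.ι L.Δ (f :: w) X R := by
  obtain ⟨R, hR, ha⟩ := h.exists_acts
  exact ⟨R, hR, .cons_of_acts hw ha⟩

theorem Maps.pair_mem {f g : L.carrier} {P Q R : Subgroup S} (hP : P ∈ L.Δ) (hf : L.Maps f P Q)
    (hg : L.Maps g Q R) : [g, f] ∈ D := by
  obtain ⟨X, hX, h₁⟩ := exists_conjChain_append (.nil P hP) hf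
  obtain ⟨Y, -, h₂⟩ := exists_conjChain_append h₁ (hg.mono hX le_rfl)
  exact mem_D_of_conjChain h₂

theorem Maps.triple_mem {f g h : L.carrier} {P Q R U : Subgroup S} (hP : P ∈ L.Δ)
    (hf : L.Maps f P Q) (hg : L.Maps g Q R) (hh : L.Maps h R U) : [h, g, f] ∈ D := by
  obtain ⟨X, hX, h₁⟩ := exists_conjChain_append (.nil P hP) hf
  obtain ⟨Y, hY, h₂⟩ := exists_conjChain_append h₁ (hg.mono hX le_rfl)
  obtain ⟨Z, -, h₃⟩ := exists_conjChain_append h₂ (hh.mono hY le_rfl)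
  exact mem_D_of_conjChain h₃

theorem Maps.carries_comp {f g h : L.carrier} {P Q R : Subgroup S} (hP : P ∈ L.Δ)
    (hf : L.Maps f P Q) (hg : L.Maps g Q R) (hh : IsProd [g, f] h) {x y z : S} (hx : x ∈ P)
    (hxy : Carries L.ι f x y) (hyz : Carries L.ι g y z) : Carries L.ι h x z := by
  obtain ⟨X, hX, h₁⟩ := hf.exists_acts
  obtain ⟨Y, -, h₂⟩ := (hg.mono hX le_rfl).exists_acts
  exact Locality.carries_comp hP h₁ h₂ hh hx hxy hyz

theorem Maps.comp {f g h : L.carrier} {P Q R : Subgroup S} (hP : P ∈ L.Δ) (hf : L.Maps f P Q)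
    (hg : L.Maps g Q R) (hh : IsProd [g, f] h) : L.Maps h P R := fun x hx => by
  obtain ⟨y, hy, hxy⟩ := hf x hx
  obtain ⟨z, hz, hyz⟩ := hg y hy
  exact ⟨z, hz, hf.carries_comp hP hg hh hx hxy hyz⟩

/-! ### Isomorphisms of localities -/

section

variable {S' : Type u} [Group S'] {L : Locality p S} {L' : Locality p S'}

/-- The inverse of an isomorphism of localities. -/
def Iso.symm (β : Iso L L') : Iso L' L where
  toEquiv := β.toEquiv.symm
  mem_iff w := by rw [← β.mem_iff]; simp
  map_prod w h := by
    have h' : w.map β.toEquiv.symm ∈ D := by rw [← β.mem_iff]; simpa using h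
    rw [Equiv.symm_apply_eq, β.map_prod _ h']
    simp
  map_Δ := by
    have h := congrArg (fun A => (fun X : Set L'.carrier => β.toEquiv.symm '' X) '' A) β.map_Δ
    simp only [Set.image_image, Equiv.symm_apply_apply] at h
    simpa [Set.image_image] using h.symm

theorem Iso.isProd (β : Iso L L') {w : List L.carrier} {x : L.carrier} (h : IsProd w x) :
    IsProd (w.map β.toEquiv) (β.toEquiv x) := by
  obtain ⟨h, rfl⟩ := h
  exact ⟨(β.mem_iff w).2 h, (β.map_prod w h).symm⟩

theorem Iso.map_one (β : Iso L L') : β.toEquiv (one L.carrier) = one L'.carrier :=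
  (β.isProd isProd_nil).unique isProd_nil

theorem Iso.map_inv (β : Iso L L') (f : L.carrier) : β.toEquiv (inv f) = inv (β.toEquiv f) := by
  have h := β.isProd (IsProd.inv_self f)
  rw [β.map_one] at h
  exact h.eq_of_one

theorem top_mem (L : Locality p S) : (⊤ : Subgroup S) ∈ L.Δ := by
  obtain ⟨P, -, hP, -⟩ := L.exists_acts (one L.carrier)
  exact mem_Δ_of_le hP le_top

/-- `S` and `S'` are the largest members of `Δ` and `Δ'`, and `β` matches the members of the two
collections. -/
theorem Iso.image_range (β : Iso L L') : β.toEquiv '' Set.range L.ι = Set.range L'.ι := by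
  apply Set.Subset.antisymm
  · have h : β.toEquiv '' (L.ι '' ((⊤ : Subgroup S) : Set S)) ∈
        (fun P : Subgroup S' => L'.ι '' (P : Set S')) '' L'.Δ :=
      β.map_Δ ▸ ⟨⊤, L.top_mem, rfl⟩
    obtain ⟨P, -, e⟩ := h
    rw [Subgroup.coe_top, Set.image_univ] at e
    rw [← e]
    exact Set.image_subset_range _ _
  · have h : L'.ι '' ((⊤ : Subgroup S') : Set S') ∈
        (fun P : Subgroup S => β.toEquiv '' (L.ι '' (P : Set S))) '' L.Δ :=
      β.map_Δ ▸ ⟨⊤, L'.top_mem, rfl⟩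
    obtain ⟨P, -, e⟩ := h
    rw [Subgroup.coe_top, Set.image_univ] at e
    rw [← e]
    exact Set.image_mono (Set.image_subset_range _ _)

/-- The isomorphism `S ≃ S'` to which an isomorphism of localities restricts. -/
noncomputable def Iso.restrict (β : Iso L L') : S ≃* S' :=
  have h : ∀ s, ∃ t, L'.ι t = β.toEquiv (L.ι s) := fun s =>
    (β.image_range ▸ ⟨L.ι s, ⟨s, rfl⟩, rfl⟩ : β.toEquiv (L.ι s) ∈ Set.range L'.ι)
  MulEquiv.ofBijective
    (MonoidHom.mk' (fun s => (h s).choose) fun s t => L'.ι_injective <| by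
      rw [(h (s * t)).choose_spec]
      refine IsProd.unique (β.isProd (L.isProd_ι_mul s t)) ?_
      have h' := L'.isProd_ι_mul (h s).choose (h t).choose
      rwa [(h s).choose_spec, (h t).choose_spec] at h')
    ⟨fun s t e => L.ι_injective (β.toEquiv.injective (by
      rw [← (h s).choose_spec, ← (h t).choose_spec]; exact congrArg L'.ι e)), fun t => by
      have ht : L'.ι t ∈ β.toEquiv '' Set.range L.ι := by
        rw [β.image_range]; exact ⟨t, rfl⟩
      obtain ⟨_, ⟨s, rfl⟩, e⟩ := ht
      exact ⟨s, L'.ι_injective ((h s).choose_spec.trans e)⟩⟩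

theorem Iso.restrictsTo_restrict (β : Iso L L') : β.RestrictsTo β.restrict := fun s =>
  (Exists.choose_spec (p := fun t => L'.ι t = β.toEquiv (L.ι s)) _).symm

theorem Iso.RestrictsTo.carries_iff {β : Iso L L'} {e : S ≃* S'} (he : β.RestrictsTo e)
    {f : L.carrier} {x y : S} :
    Carries L'.ι (β.toEquiv f) (e x) (e y) ↔ Carries L.ι f x y := by
  rw [Carries, ← he x, ← he y, ← β.map_inv]
  refine ⟨fun h => ?_, fun h => by simpa using β.isProd h⟩
  have h' := β.symm.isProd h
  simpa [Iso.symm, Carries] using h'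

theorem Iso.RestrictsTo.map_mem_iff {β : Iso L L'} {e : S ≃* S'} (he : β.RestrictsTo e)
    (P : Subgroup S) : P.map e.toMonoidHom ∈ L'.Δ ↔ P ∈ L.Δ := by
  have himg : ∀ P : Subgroup S, β.toEquiv '' (L.ι '' (P : Set S)) =
      L'.ι '' ((P.map e.toMonoidHom : Subgroup S') : Set S') := fun P => by
    rw [Subgroup.coe_map, Set.image_image, Set.image_image]
    exact Set.image_congr fun s _ => he s
  constructor
  · intro h
    have h' : L'.ι '' ((P.map e.toMonoidHom : Subgroup S') : Set S') ∈
      (fun P : Subgroup S => β.toEquiv '' (L.ι '' (P : Set S))) '' L.Δ := β.map_Δ ▸ ⟨_, h, rfl⟩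
    obtain ⟨Q, hQ, hQP⟩ := h'
    have hQP' : β.toEquiv '' (L.ι '' (Q : Set S)) = β.toEquiv '' (L.ι '' (P : Set S)) :=
      hQP.trans (himg P).symm
    rwa [← SetLike.coe_injective
      (L.ι_injective.image_injective (β.toEquiv.injective.image_injective hQP'))]
  · intro h
    have h' : β.toEquiv '' (L.ι '' (P : Set S)) ∈
      (fun P : Subgroup S' => L'.ι '' (P : Set S')) '' L'.Δ := β.map_Δ ▸ ⟨_, h, rfl⟩
    obtain ⟨Q, hQ, hQP⟩ := h'
    have hQP' := hQP.trans (himg P)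
    rwa [← SetLike.coe_injective (L'.ι_injective.image_injective hQP')]

end

end Locality

theorem LocalityCat.isIso {p : ℕ} {X Y : LocalityCat.{u} p} (β : X ⟶ Y) : IsIso β :=
  ⟨(toIso β).symm, Locality.Iso.ext (Equiv.self_trans_symm _),
    Locality.Iso.ext (Equiv.symm_trans_self _)⟩

/-! ### The functor to localities is fully faithful -/

namespace TransporterSystem

open PartialGroup

variable {p : ℕ} {S S' : Type u} [Group S] [Group S'] (T : TransporterSystem p S)
  {T' : TransporterSystem p S'}

theorem homCls_id (P : T.Ob) : T.homCls (𝟙 P) = T.emb 1 := by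
  rw [← T.δ_one]; exact T.homCls_δ _ _

theorem homCls_incl {P Q : T.Ob} (h : P.sub ≤ Q.sub) : T.homCls (T.incl h) = T.emb 1 :=
  T.homCls_δ _ _

variable [Finite S] [Group.IsNilpotent S]

theorem carries_homCls {P Q : T.Ob} (φ : P ⟶ Q) (x : P.sub) :
    Carries T.emb (T.homCls φ) x (T.π φ x) := by
  obtain ⟨h, e⟩ := T.homCls_eq_iff_rep.1 (T.homCls_comp_inclTop φ)
  refine T.carries_iff.2 ⟨h x.2, ?_⟩
  have h' := congrArg (fun g => (T.π g x : S)) e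
  simp only [π_comp_apply, π_inclTop] at h'
  rw [← h']
  exact congrArg (fun y => (T.π (T.rep _) y : S)) (Subtype.ext (T.π_incl h x).symm)

theorem isProd_homCls {P Q R : T.Ob} (φ : P ⟶ Q) (ψ : Q ⟶ R) :
    IsProd [T.homCls ψ, T.homCls φ] (T.homCls (φ ≫ ψ)) := by
  obtain ⟨X, hX, γ, rfl⟩ := T.exists_factor φ
  obtain ⟨Y, hY, χ, e⟩ := T.exists_factor (T.incl hX ≫ ψ)
  have hψ : T.homCls ψ = T.cls ⟨χ⟩ := by
    rw [← T.homCls_incl_comp hX, ← e, homCls_comp_incl, homCls_iso]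
  have h : RepWord T.cls [T.cls ⟨χ⟩, T.cls ⟨γ⟩] (γ ≪≫ χ) := .cons _ _ _ (.single γ)
  rw [hψ, homCls_comp_incl, homCls_iso, Category.assoc, ← e, ← Category.assoc, homCls_comp_incl]
  exact ⟨⟨_, _, _, h⟩, (T.mprod_eq _ h).trans (T.homCls_iso (γ ≪≫ χ)).symm⟩

/-- The morphism is the restriction of `rep f` to `P`, whose image lies in `Q` by the conjugation
formula. With `homCls_injective` this identifies each morphism set with a set of classes, so a
functor can be defined on classes alone. -/
theorem exists_homCls_of_maps {P Q : T.Ob} {f : T.Cls}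
    (h : ∀ x ∈ P.sub, ∃ y ∈ Q.sub, Carries T.emb f x y) : ∃ φ : P ⟶ Q, T.homCls φ = f := by
  have hP : P.sub ≤ (T.dom f).sub := fun x hx => by
    obtain ⟨y, -, h⟩ := h x hx
    exact (T.carries_iff.1 h).choose
  obtain ⟨R, hR, ψ, e⟩ := T.exists_factor (T.incl hP ≫ T.rep f)
  have hψ : T.homCls ψ.hom = f := by
    rw [← T.homCls_comp_incl ψ.hom hR, e, homCls_incl_comp, homCls_rep]
  have hRQ : R.sub ≤ Q.sub := fun z hz => by
    obtain ⟨y, hy, hc⟩ := h _ (T.π ψ.inv ⟨z, hz⟩).2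
    have hc' := T.carries_homCls ψ.hom (T.π ψ.inv ⟨z, hz⟩)
    rw [hψ, π_inv_hom] at hc'
    rw [show z = y from T.emb_injective (hc'.unique hc)]
    exact hy
  exact ⟨ψ.hom ≫ T.incl hRQ, by rw [homCls_comp_incl, hψ]⟩

theorem heq_of_homCls_eq {P P' Q Q' : T.Ob} (hP : P = P') (hQ : Q = Q') {φ : P ⟶ Q} {ψ : P' ⟶ Q'}
    (h : T.homCls φ = T.homCls ψ) : HEq φ ψ := by
  subst hP hQ
  exact heq_of_eq (T.homCls_injective h)

variable {T} [Finite S'] [Group.IsNilpotent S']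

/-! ### Lifting isomorphisms of localities -/

section Full

variable [Fact p.Prime] (β : T.locality.Iso T'.locality)

theorem maps_of_locIso {P Q : T.Ob} (φ : P ⟶ Q) :
    ∀ x ∈ P.sub.map β.restrict.toMonoidHom, ∃ y ∈ Q.sub.map β.restrict.toMonoidHom,
      Carries T'.emb (β.toEquiv (T.homCls φ)) x y := by
  rintro _ ⟨x, hx, rfl⟩
  exact ⟨_, ⟨_, (T.π φ ⟨x, hx⟩).2, rfl⟩,
    (β.restrictsTo_restrict.carries_iff).2 (T.carries_homCls φ ⟨x, hx⟩)⟩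

/-- The image of an object under an isomorphism of localities. -/
noncomputable def objOfLocIso (P : T.Ob) : T'.Ob :=
  ⟨P.sub.map β.restrict.toMonoidHom, (β.restrictsTo_restrict.map_mem_iff P.sub).2 P.mem⟩

/-- The image of a morphism under an isomorphism of localities. -/
noncomputable def homOfLocIso {P Q : T.Ob} (φ : P ⟶ Q) : objOfLocIso β P ⟶ objOfLocIso β Q :=
  (T'.exists_homCls_of_maps (maps_of_locIso β φ)).choose

theorem homCls_homOfLocIso {P Q : T.Ob} (φ : P ⟶ Q) :
    T'.homCls (homOfLocIso β φ) = β.toEquiv (T.homCls φ) :=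
  (T'.exists_homCls_of_maps (maps_of_locIso β φ)).choose_spec

theorem locIso_emb (s : S) : β.toEquiv (T.emb s) = T'.emb (β.restrict s) :=
  β.restrictsTo_restrict s

/-- The functor induced by an isomorphism of localities. -/
noncomputable def functorOfLocIso : T.Ob ⥤ T'.Ob where
  obj := objOfLocIso β
  map := homOfLocIso β
  map_id P := T'.homCls_injective (by
    rw [homCls_homOfLocIso, homCls_id, homCls_id, locIso_emb, map_one])
  map_comp φ ψ := T'.homCls_injective (by
    rw [homCls_homOfLocIso]
    refine (β.isProd (T.isProd_homCls φ ψ)).unique ?_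
    have h := T'.isProd_homCls (homOfLocIso β φ) (homOfLocIso β ψ)
    rwa [homCls_homOfLocIso, homCls_homOfLocIso] at h)

theorem homOfLocIso_δ {P Q : T.Ob} {g : S} (hg : g ∈ transporter P.sub Q.sub)
    (hg' : β.restrict g ∈ transporter (objOfLocIso β P).sub (objOfLocIso β Q).sub) :
    homOfLocIso β (T.δ g hg) = T'.δ (β.restrict g) hg' :=
  T'.homCls_injective (by rw [homCls_homOfLocIso, homCls_δ, homCls_δ, locIso_emb])

/-- The isomorphism of transporter systems induced by an isomorphism of localities. -/
noncomputable def isoOfLocIso : Iso T T' where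
  functor := functorOfLocIso β
  isEquivalence :=
    { faithful := ⟨fun {P Q φ ψ} h => T.homCls_injective <| β.toEquiv.injective <| by
        rw [← homCls_homOfLocIso, ← homCls_homOfLocIso]; exact congrArg T'.homCls h⟩
      full := ⟨fun {P Q} φ => by
        obtain ⟨ψ, hψ⟩ := T.exists_homCls_of_maps (P := P) (Q := Q)
          (f := β.toEquiv.symm (T'.homCls φ)) fun x hx => by
            have h := T'.carries_homCls φ ⟨β.restrict x, ⟨x, hx, rfl⟩⟩
            obtain ⟨y, hy, e⟩ := (T'.π φ ⟨β.restrict x, ⟨x, hx, rfl⟩⟩).2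
            refine ⟨y, hy, (β.restrictsTo_restrict.carries_iff).1 ?_⟩
            rw [← e] at h
            exact (congrArg (fun f => Carries T'.emb f (β.restrict x) (β.restrict y))
              (β.toEquiv.apply_symm_apply (T'.homCls φ))).mpr h
        refine ⟨ψ, T'.homCls_injective ((homCls_homOfLocIso β ψ).trans ?_)⟩
        rw [hψ]
        exact β.toEquiv.apply_symm_apply _⟩
      essSurj := ⟨fun X => by
        have h : (X.sub.map β.restrict.symm.toMonoidHom).map β.restrict.toMonoidHom = X.sub := by
          rw [Subgroup.map_map]
          convert Subgroup.map_id X.sub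
          ext; simp
        refine ⟨⟨X.sub.map β.restrict.symm.toMonoidHom,
          (β.restrictsTo_restrict.map_mem_iff _).1 (by rw [h]; exact X.mem)⟩, ⟨eqToIso (Member.ext h)⟩⟩⟩ }
  isotypical P := by
    ext φ
    constructor
    · rintro ⟨_, ⟨g, hg, rfl⟩, rfl⟩
      exact ⟨β.restrict g, ⟨g, hg, rfl⟩, homOfLocIso_δ β _ _⟩
    · rintro ⟨_, ⟨g, hg, rfl⟩, rfl⟩
      exact ⟨_, ⟨g, hg, rfl⟩, homOfLocIso_δ β _ _⟩
  inclusions P Q h := by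
    refine ⟨Subgroup.map_mono h, T'.homCls_injective ?_⟩
    refine (homCls_homOfLocIso β _).trans ?_
    rw [homCls_incl, locIso_emb, map_one]
    exact (T'.homCls_incl _).symm

theorem isoOfLocIso_locality : (isoOfLocIso β).locality = β := by
  apply Locality.Iso.ext
  ext f
  change (isoOfLocIso β).mapCls f = _
  rw [← T.homCls_rep f, Iso.mapCls_homCls]
  exact homCls_homOfLocIso β _

theorem isoOfLocIso_restrictsTo {e : S ≃* S'} (he : β.RestrictsTo e) :
    (isoOfLocIso β).RestrictsTo e := by
  have : e = β.restrict := by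
    ext s
    exact T'.emb_injective ((he s).symm.trans (β.restrictsTo_restrict s))
  subst this
  refine ⟨?_, fun s => homOfLocIso_δ β _ _⟩
  exact Subgroup.map_top_of_surjective _ β.restrict.surjective

end Full

section

variable {p : ℕ} {S S' : Type u} [Group S] [Group S'] {T : TransporterSystem p S}
  {T' : TransporterSystem p S'} [Finite S'] [Group.IsNilpotent S']

/-- The classes of elements of `S` determine the isomorphism `S ≃* S'`, hence the action on objects;
morphisms are then determined by their classes. -/
theorem Iso.eq_of_mapCls_eq {α α' : Iso T T'} (h : α.mapCls = α'.mapCls) : α = α' := by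
  have he : α.topEquiv = α'.topEquiv := by
    ext s
    exact T'.emb_injective (by rw [← mapCls_emb, ← mapCls_emb, h])
  have hobj : ∀ P, α.functor.obj P = α'.functor.obj P := fun P =>
    Member.ext (by rw [obj_sub, obj_sub, he])
  apply Iso.ext
  refine Functor.hext hobj fun P Q φ => ?_
  exact T'.heq_of_homCls_eq (hobj P) (hobj Q) (by rw [← mapCls_homCls, ← mapCls_homCls, h])

end

end TransporterSystem

open TransporterSystem in
theorem localityFunctor_map_surjective {p : ℕ} [Fact p.Prime] {T T' : TransporterCat.{u} p}
    (β : (localityFunctor p).obj T ⟶ (localityFunctor p).obj T') :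
    ∃ α : T ⟶ T', (localityFunctor p).map α = β ∧
      (LocalityCat.rigid p β → TransporterCat.rigid p α) :=
  ⟨isoOfLocIso (LocalityCat.toIso β), isoOfLocIso_locality (LocalityCat.toIso β),
    fun ⟨h, hβ⟩ => ⟨h, isoOfLocIso_restrictsTo (LocalityCat.toIso β) hβ⟩⟩

instance {p : ℕ} [Fact p.Prime] : (localityFunctor.{u} p).Full where
  map_surjective β := by
    obtain ⟨α, hα, -⟩ := localityFunctor_map_surjective β
    exact ⟨α, hα⟩

instance {p : ℕ} [Fact p.Prime] : (localityFunctor.{u} p).Faithful where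
  map_injective {T T' α α'} h := TransporterSystem.Iso.eq_of_mapCls_eq (by
    ext f
    exact congrArg (fun β => (LocalityCat.toIso β).toEquiv f) h)

/-! ### The transporter system of a locality -/

namespace Locality

open PartialGroup

variable {p : ℕ} {S : Type u} [Group S] {L : Locality p S}

variable (L) in
/-- The `F`-morphisms from members of `Δ` are the conjugation maps of the locality. -/
def InducedBy (F : FusionSystem S) : Prop :=
  ∀ P ∈ L.Δ, ∀ (Q : Subgroup S) (φ : P →* Q),
    φ ∈ F.Hom P Q ↔ ∃ f : L.carrier, ∀ x : P, Carries L.ι f x (φ x)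

/-- The conjugation map `c_f : P → Q`. -/
noncomputable def Maps.conjHom {f : L.carrier} {P Q : Subgroup S} (h : L.Maps f P Q) : P →* Q :=
  MonoidHom.mk' (fun x => ⟨(h x x.2).choose, (h x x.2).choose_spec.1⟩) fun x y =>
    Subtype.ext (carries_unique (h _ (x * y).2).choose_spec.2
      (carries_mul (h x x.2).choose_spec.2 (h y y.2).choose_spec.2))

theorem Maps.carries {f : L.carrier} {P Q : Subgroup S} (h : L.Maps f P Q) (x : P) :
    Carries L.ι f x (h.conjHom x) := (h x x.2).choose_spec.2

theorem Maps.eq_conjHom {f : L.carrier} {P Q : Subgroup S} (h : L.Maps f P Q) {φ : P →* Q}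
    (hφ : ∀ x : P, Carries L.ι f x (φ x)) : h.conjHom = φ :=
  MonoidHom.ext fun x => Subtype.ext (carries_unique (h.carries x) (hφ x))

theorem maps_of_carries {f : L.carrier} {P Q : Subgroup S} {φ : P → Q}
    (hφ : ∀ x : P, Carries L.ι f x (φ x)) : L.Maps f P Q :=
  fun x hx => ⟨_, (φ ⟨x, hx⟩).2, hφ ⟨x, hx⟩⟩

variable (L) in
/-- A fusion system whose morphisms from members of `Δ` are the conjugation maps; a subgroup which
is not in `Δ` may be mapped injectively onto any other such subgroup. -/
def fusion : FusionSystem S where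
  Hom P Q := {φ | Function.Injective φ ∧
    (P ∈ L.Δ → ∃ f : L.carrier, ∀ x : P, Carries L.ι f x (φ x)) ∧
    -- Requiring images to stay outside `Δ` keeps `Δ` closed under conjugacy. Otherwise the inverse
    -- of `φ` on its image would have to be induced by an element of the locality.
    (P ∉ L.Δ → (Q.subtype.comp φ).range ∉ L.Δ)}
  injective φ h := h.1
  conj_mem {P Q} g hg := by
    refine ⟨fun x y h => ?_, fun _ => ⟨L.ι g, fun x => carries_ι g x⟩, fun hP h => hP ?_⟩
    · have h' : g * x * g⁻¹ = g * y * g⁻¹ := congrArg Subtype.val h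
      exact Subtype.ext (mul_left_cancel (mul_right_cancel h'))
    · refine mem_Δ_of_carries (f := L.ι g⁻¹) h ?_
      rintro _ ⟨x, rfl⟩
      refine ⟨x, x.2, ?_⟩
      have h' := carries_ι (L := L) g⁻¹ (g * x * g⁻¹)
      have e : g⁻¹ * (g * x * g⁻¹) * g⁻¹⁻¹ = x := by group
      rw [e] at h'
      exact h'
  comp_mem {P Q R} φ ψ hφ hψ := by
    refine ⟨hψ.1.comp hφ.1, fun hP => ?_, fun hP => ?_⟩
    · obtain ⟨f, hf⟩ := hφ.2.1 hP
      have hfm := maps_of_carries hf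
      obtain ⟨g, hg⟩ := hψ.2.1 (hfm.mem hP)
      have hgm := maps_of_carries hg
      obtain ⟨h, hh⟩ := exists_isProd (hfm.pair_mem hP hgm)
      exact ⟨h, fun x => hfm.carries_comp hP hgm hh x.2 (hf x) (hg _)⟩
    · intro hR
      -- `Q` may belong to `Δ` although the image of `φ` does not. In that case `ψ` is conjugation
      -- by some `g`, and `g⁻¹` would bring an image in `Δ` back to the image of `φ`.
      by_cases hQ : Q ∈ L.Δ
      · obtain ⟨g, hg⟩ := hψ.2.1 hQ
        refine hφ.2.2 hP (mem_Δ_of_carries (f := PartialGroup.inv g) hR ?_)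
        rintro _ ⟨x, rfl⟩
        exact ⟨φ x, ⟨x, rfl⟩, carries_inv (hg _)⟩
      · refine hψ.2.2 hQ (mem_Δ_of_le hR ?_)
        rintro _ ⟨x, rfl⟩
        exact ⟨φ x, rfl⟩
  factor {P Q} φ hφ := by
    have hinj : Function.Injective (Q.subtype.comp φ) := Q.subtype_injective.comp hφ.1
    let e := MonoidHom.ofInjective hinj
    have he : ∀ x : P, (e x : S) = φ x := fun x => rfl
    have hsymm : ∀ y : (Q.subtype.comp φ).range, (φ (e.symm y) : S) = y := fun y => by
      rw [← he, e.apply_symm_apply]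
    refine ⟨(Q.subtype.comp φ).range, ?_, e, ⟨e.injective, hφ.2.1, fun hP h => hφ.2.2 hP ?_⟩,
      ⟨e.symm.injective, fun hR => ?_, fun hR h => ?_⟩, rfl⟩
    · rintro _ ⟨x, rfl⟩
      exact (φ x).2
    · exact h
    · by_cases hP : P ∈ L.Δ
      · obtain ⟨f, hf⟩ := hφ.2.1 hP
        refine ⟨PartialGroup.inv f, fun y => ?_⟩
        have h := carries_inv (hf (e.symm y))
        rwa [hsymm] at h
      · exact absurd hR (hφ.2.2 hP)
    · have hP : (P.subtype.comp e.symm.toMonoidHom).range = P := by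
        ext x
        constructor
        · rintro ⟨y, rfl⟩
          exact (e.symm y).2
        · exact fun hx => ⟨e ⟨x, hx⟩, congrArg Subtype.val (e.symm_apply_apply ⟨x, hx⟩)⟩
      rw [hP] at h
      obtain ⟨f, hf⟩ := hφ.2.1 h
      refine hR (mem_Δ_of_carries (f := f) h fun x hx => ⟨_, ⟨⟨x, hx⟩, rfl⟩, hf ⟨x, hx⟩⟩)

theorem inducedBy_fusion : L.InducedBy L.fusion := fun P hP Q φ => by
  refine ⟨fun h => h.2.1 hP, fun h => ⟨fun x y e => ?_, fun _ => h, fun h' => absurd hP h'⟩⟩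
  obtain ⟨f, hf⟩ := h
  have h₁ := hf y
  rw [← e] at h₁
  exact Subtype.ext (carries_inj (hf x) h₁)

/-- Morphisms of the transporter system of a locality. -/
@[ext]
structure MapsHom (L : Locality p S) (P Q : Member L.Δ) where
  val : L.carrier
  maps : L.Maps val P.sub Q.sub

theorem MapsHom.comp_mem {P Q R : Member L.Δ} (f : L.MapsHom P Q) (g : L.MapsHom Q R) :
    [g.val, f.val] ∈ D := f.maps.pair_mem P.mem g.maps

variable (L) in
/-- The category with object set `Δ` and with the elements of the locality as morphisms. -/
@[reducible]
def memberCategory : Category.{u} (Member L.Δ) where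
  Hom P Q := L.MapsHom P Q
  id P := ⟨one L.carrier, maps_one le_rfl⟩
  comp {P Q R} f g := ⟨mprod [g.val, f.val] (f.comp_mem g),
    f.maps.comp P.mem g.maps (isProd_mprod _)⟩
  id_comp f := MapsHom.ext ((isProd_mprod _).unique (IsProd.one_right f.val))
  comp_id f := MapsHom.ext ((isProd_mprod _).unique (IsProd.one_left f.val))
  assoc {P Q R U} f g h := MapsHom.ext <| by
    have hw := isProd_mprod (f.maps.triple_mem P.mem g.maps h.maps)
    have h₁ : IsProd [h.val, mprod [g.val, f.val] (f.comp_mem g)] _ :=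
      IsProd.assoc (u := [h.val]) (v := [g.val, f.val]) (w := []) hw (isProd_mprod _)
    have h₂ : IsProd [mprod [h.val, g.val] (g.comp_mem h), f.val] _ :=
      hw.assoc (u := []) (v := [h.val, g.val]) (w := [f.val]) (isProd_mprod _)
    exact ((isProd_mprod _).unique h₁).trans (h₂.unique (isProd_mprod _))

/-! ### The category whose morphisms are elements of the locality -/

section

attribute [local instance] memberCategory

theorem isProd_comp {P Q R : Member L.Δ} (f : P ⟶ Q) (g : Q ⟶ R) :
    IsProd [g.val, f.val] (f ≫ g).val := isProd_mprod _

theorem hom_ext {P Q : Member L.Δ} {f g : P ⟶ Q} (h : f.val = g.val) : f = g := MapsHom.ext h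

theorem id_val (P : Member L.Δ) : MapsHom.val (𝟙 P) = one L.carrier := rfl

/-- The isomorphism given by an element which acts from `P` onto `Q`. -/
def isoOfActs {P Q : Member L.Δ} {f : L.carrier} (h : Acts L.ι f (P.sub : Set S) (Q.sub : Set S)) :
    P ≅ Q where
  hom := ⟨f, h.1⟩
  inv := ⟨PartialGroup.inv f, (acts_inv h).1⟩
  hom_inv_id := hom_ext ((isProd_comp _ _).unique (IsProd.inv_self f))
  inv_hom_id := hom_ext ((isProd_comp _ _).unique (IsProd.self_inv f))

theorem inv_val {P Q : Member L.Δ} (φ : P ≅ Q) : φ.inv.val = PartialGroup.inv φ.hom.val := by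
  have h := isProd_comp φ.hom φ.inv
  rw [φ.hom_inv_id] at h
  exact h.eq_of_one

theorem acts_of_iso {P Q : Member L.Δ} (φ : P ≅ Q) :
    Acts L.ι φ.hom.val (P.sub : Set S) (Q.sub : Set S) :=
  ⟨φ.hom.maps, fun y hy => by
    obtain ⟨x, hx, h⟩ := φ.inv.maps y hy
    rw [inv_val] at h
    have h' := carries_inv h
    rw [PartialGroup.inv_inv] at h'
    exact ⟨x, hx, h'⟩⟩

theorem cancel_left_hom {P Q R : Member L.Δ} {f g : P ⟶ Q} {h : Q ⟶ R} (e : f ≫ h = g ≫ h) :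
    f = g := by
  obtain ⟨X, hX, ha⟩ := MapsHom.maps h |>.exists_acts
  have key : ∀ f : P ⟶ Q, IsProd [PartialGroup.inv h.val, (f ≫ h).val] f.val := fun f => by
    have hm : L.Maps (PartialGroup.inv h.val) X Q.sub := (acts_inv ha).1
    have hw := isProd_mprod (MapsHom.maps f |>.triple_mem P.mem ha.1 hm)
    have h₁ : IsProd [one _, f.val] _ :=
      hw.assoc (u := []) (v := [PartialGroup.inv h.val, h.val]) (w := [f.val]) (IsProd.inv_self _)
    have h₂ : IsProd [PartialGroup.inv h.val, (f ≫ h).val] _ :=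
      IsProd.assoc (u := [PartialGroup.inv h.val]) (v := [h.val, f.val]) (w := []) hw
        (isProd_comp f h)
    rwa [h₁.unique (IsProd.one_left _)] at h₂
  refine hom_ext ((key f).unique ?_)
  rw [e]
  exact key g

theorem cancel_right_hom {P Q R : Member L.Δ} {f g : Q ⟶ R} {h : P ⟶ Q} (e : h ≫ f = h ≫ g) :
    f.val = g.val := by
  obtain ⟨X, hX, ha⟩ := MapsHom.maps h |>.exists_acts
  have hXΔ := mem_Δ_of_acts P.mem ha
  have key : ∀ f : Q ⟶ R, IsProd [(h ≫ f).val, PartialGroup.inv h.val] f.val := fun f => by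
    have hm : L.Maps (PartialGroup.inv h.val) X P.sub := (acts_inv ha).1
    have hw := isProd_mprod (hm.triple_mem hXΔ (MapsHom.maps h) (MapsHom.maps f))
    have h₁ : IsProd [f.val, one _] _ :=
      IsProd.assoc (u := [f.val]) (v := [h.val, PartialGroup.inv h.val]) (w := []) hw
        (IsProd.self_inv _)
    have h₂ : IsProd [(h ≫ f).val, PartialGroup.inv h.val] _ :=
      hw.assoc (u := []) (v := [f.val, h.val]) (w := [PartialGroup.inv h.val]) (isProd_comp h f)
    rwa [h₁.unique (IsProd.one_right _)] at h₂
  have h₁ := key f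
  rw [e] at h₁
  exact h₁.unique (key g)

theorem conjHom_comp {P Q R : Member L.Δ} (f : P ⟶ Q) (g : Q ⟶ R) :
    (MapsHom.maps (f ≫ g)).conjHom = (MapsHom.maps g).conjHom.comp (MapsHom.maps f).conjHom :=
  Maps.eq_conjHom _ fun x => (MapsHom.maps f).carries_comp P.mem (MapsHom.maps g)
    (isProd_comp f g) x.2 ((MapsHom.maps f).carries x) ((MapsHom.maps g).carries _)

theorem conjHom_id (P : Member L.Δ) : (MapsHom.maps (𝟙 P)).conjHom = MonoidHom.id P.sub :=
  Maps.eq_conjHom _ fun x => by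
    rw [id_val, ← ι_one]
    simpa using carries_ι (L := L) 1 x

/-- The kernel element is `φ⁻¹ψ` in the locality. It is defined because equal conjugation maps give
`φ` and `ψ` the same image, on which `φ⁻¹` is defined. -/
theorem conjHom_eq_iff {P Q : Member L.Δ} (φ ψ : P ⟶ Q) :
    (MapsHom.maps φ).conjHom = (MapsHom.maps ψ).conjHom ↔
      ∃ e : P ⟶ P, (MapsHom.maps e).conjHom = MonoidHom.id P.sub ∧ ψ = e ≫ φ := by
  constructor
  · intro h
    obtain ⟨X, hX, ha⟩ := (MapsHom.maps φ).exists_acts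
    have hψ : L.Maps ψ.val P.sub X := fun x hx => by
      obtain ⟨y, hy, hxy⟩ := ha.1 x hx
      refine ⟨y, hy, ?_⟩
      have h₁ := (MapsHom.maps ψ).carries ⟨x, hx⟩
      rw [← h] at h₁
      rwa [carries_unique hxy ((MapsHom.maps φ).carries ⟨x, hx⟩)]
    have hm : L.Maps (PartialGroup.inv φ.val) X P.sub := (acts_inv ha).1
    obtain ⟨k, hk⟩ := exists_isProd (hψ.pair_mem P.mem hm)
    let e : P ⟶ P := ⟨k, hψ.comp P.mem hm hk⟩
    refine ⟨e, Maps.eq_conjHom _ fun x => ?_, hom_ext ?_⟩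
    · have h₁ := (MapsHom.maps ψ).carries x
      rw [← h] at h₁
      exact hψ.carries_comp P.mem hm hk x.2 h₁ (carries_inv ((MapsHom.maps φ).carries x))
    · have hw := isProd_mprod (hψ.triple_mem P.mem hm (MapsHom.maps φ))
      have h₁ : IsProd [one _, ψ.val] _ :=
        hw.assoc (u := []) (v := [φ.val, PartialGroup.inv φ.val]) (w := [ψ.val])
          (IsProd.self_inv _)
      have h₂ : IsProd [φ.val, k] _ :=
        IsProd.assoc (u := [φ.val]) (v := [PartialGroup.inv φ.val, ψ.val]) (w := []) hw hk
      rw [← h₁.unique (IsProd.one_left _)]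
      exact h₂.unique (isProd_comp e φ)
  · rintro ⟨e, he, rfl⟩
    rw [conjHom_comp, he]
    rfl

theorem carries_of_conj {P Q : Member L.Δ} {φ : P ≅ Q} {g k : S} (hg : L.Maps (L.ι g) P.sub P.sub)
    (h : MapsHom.val (φ.inv ≫ (⟨L.ι g, hg⟩ : P ⟶ P) ≫ φ.hom) = L.ι k) :
    Carries L.ι (MapsHom.val φ.hom) g k := by
  have hw := isProd_mprod ((MapsHom.maps φ.inv).triple_mem Q.mem hg (MapsHom.maps φ.hom))
  have h₁ := IsProd.assoc (u := []) (v := [MapsHom.val φ.hom, L.ι g]) (w := [φ.inv.val]) hw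
    (isProd_comp (⟨L.ι g, hg⟩ : P ⟶ P) φ.hom)
  rw [h₁.unique (isProd_comp φ.inv _), h, inv_val] at hw
  exact hw

/-- Automorphisms of `T` conjugate `T` onto itself, so the constant chain at `T` puts every word of
them in the domain, and subgroups of `Aut T` become subgroups of the locality. -/
theorem isProd_map_aut {T : Member L.Δ} (A : Subgroup (Aut T)) (w : List L.carrier)
    (hw : ∀ x ∈ w, ∃ a ∈ A, MapsHom.val (CategoryTheory.Iso.hom a) = x) :
    ConjChain L.ι L.Δ w T.sub T.sub ∧ ∃ a ∈ A, IsProd w (MapsHom.val (CategoryTheory.Iso.hom a)) := by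
  induction w with
  | nil => exact ⟨.nil _ T.mem, 1, A.one_mem, isProd_nil⟩
  | cons f w ih =>
    obtain ⟨hc, a, ha, hp⟩ := ih fun x hx => hw x (List.mem_cons_of_mem _ hx)
    obtain ⟨b, hb, rfl⟩ := hw f List.mem_cons_self
    have hc' := hc.cons_of_acts (acts_of_iso b)
    refine ⟨hc', b * a, A.mul_mem hb ha, ?_⟩
    obtain ⟨t, ht⟩ := exists_isProd (mem_D_of_conjChain hc')
    have h₁ : IsProd [b.hom.val, a.hom.val] t :=
      IsProd.assoc (u := [b.hom.val]) (v := w) (w := []) (by simpa using ht) hp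
    rwa [h₁.unique (isProd_comp a.hom b.hom)] at ht

/-- A Sylow subgroup containing the image of `S` gives a `p`-subgroup of the locality containing
`S`; maximality of `S` makes it `S`. -/
theorem exists_sylow [Fact p.Prime] (hS : IsPGroup p S) (T : Member L.Δ) (hT : T.sub = ⊤) :
    ∃ A : Sylow p (Aut T), ∀ a : Aut T, a ∈ A ↔ ∃ g : S, MapsHom.val (CategoryTheory.Iso.hom a) = L.ι g := by
  have hacts : ∀ g : S, Acts L.ι (L.ι g) (T.sub : Set S) (T.sub : Set S) := fun g =>
    acts_ι_self (hT ▸ Subgroup.mem_top g)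
  let δ : S →* Aut T := MonoidHom.mk' (fun g => (isoOfActs (hacts g) : Aut T)) fun g h => by
    apply CategoryTheory.Iso.ext
    exact hom_ext ((L.isProd_ι_mul g h).unique
      (isProd_comp (isoOfActs (hacts h)).hom (isoOfActs (hacts g)).hom))
  have := L.finite
  have hfin : Finite (Aut T) := Finite.of_injective (fun a : Aut T => MapsHom.val (CategoryTheory.Iso.hom a))
    fun a b h => CategoryTheory.Iso.ext (hom_ext h)
  have hδ : IsPGroup p δ.range := hS.of_surjective δ.rangeRestrict δ.rangeRestrict_surjective
  obtain ⟨A, hA⟩ := hδ.exists_le_sylow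
  let H : Set L.carrier := {x | ∃ a ∈ (A : Subgroup (Aut T)), MapsHom.val (CategoryTheory.Iso.hom a) = x}
  have hHw := isProd_map_aut (A : Subgroup (Aut T))
  have hH : IsSubgroup H :=
    { word_mem := fun w hw => mem_D_of_conjChain (hHw w hw).1
      prod_mem := fun w hw => by
        obtain ⟨a, ha, h⟩ := (hHw w hw).2
        exact ⟨a, ha, h.unique (isProd_mprod _)⟩
      inv_mem := by
        rintro _ ⟨a, ha, rfl⟩
        exact ⟨a⁻¹, A.inv_mem ha, inv_val a⟩ }
  have hcard : ∃ n : ℕ, Nat.card H = p ^ n := by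
    obtain ⟨n, hn⟩ := IsPGroup.iff_card.1 A.isPGroup'
    refine ⟨n, hn ▸ (Nat.card_congr (Equiv.ofBijective
      (fun a : A => (⟨MapsHom.val (CategoryTheory.Iso.hom a.1), a.1, a.2, rfl⟩ : H)) ⟨?_, ?_⟩)).symm⟩
    · intro a b h
      exact Subtype.ext (CategoryTheory.Iso.ext (hom_ext (congrArg Subtype.val h)))
    · rintro ⟨_, a, ha, rfl⟩
      exact ⟨⟨a, ha⟩, rfl⟩
  have hle : Set.range L.ι ⊆ H := by
    rintro _ ⟨g, rfl⟩
    exact ⟨δ g, hA ⟨g, rfl⟩, rfl⟩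
  have hHS := L.maximal H ⟨hH, hcard⟩ hle
  refine ⟨A, fun a => ⟨fun ha => ?_, fun ⟨g, hg⟩ => ?_⟩⟩
  · have h : MapsHom.val (CategoryTheory.Iso.hom a) ∈ H := ⟨a, ha, rfl⟩
    rw [hHS] at h
    obtain ⟨g, hg⟩ := h
    exact ⟨g, hg.symm⟩
  · have : a = δ g := CategoryTheory.Iso.ext (hom_ext hg)
    rw [this]
    exact hA ⟨g, rfl⟩

end

/-- The transporter system of a locality and of a fusion system with the same conjugation maps. -/
noncomputable def transporterSystem [Fact p.Prime] (L : Locality p S) (hS : IsPGroup p S)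
    (F : FusionSystem S) (hF : L.InducedBy F) : TransporterSystem p S where
  fusion := F
  Δ := L.Δ
  cat := L.memberCategory
  nonempty := ⟨⊤, L.top_mem⟩
  finite P Q := by
    have := L.finite
    exact Finite.of_injective (fun f : L.MapsHom P Q => f.val) fun _ _ h => MapsHom.ext h
  δ g hg := ⟨L.ι g, maps_ι hg⟩
  δ_one P := MapsHom.ext L.ι_one
  δ_mul g h hg hh := MapsHom.ext ((L.isProd_ι_mul h g).unique (isProd_mprod _))
  π φ := (MapsHom.maps φ).conjHom
  π_mem {P Q} φ := (hF _ P.mem _ _).2 ⟨φ.val, φ.maps.carries⟩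
  π_id P := conjHom_id P
  π_comp φ ψ := conjHom_comp φ ψ
  conj_closed P Q hP hPQ := by
    obtain ⟨e, he, -⟩ := hPQ
    obtain ⟨f, hf⟩ := (hF P hP Q _).1 he
    exact (maps_of_carries hf).mem hP
  over_closed P Q hP h := mem_Δ_of_le hP h
  π_surjective {P Q} φ hφ := by
    obtain ⟨f, hf⟩ := (hF _ P.mem _ _).1 hφ
    exact ⟨⟨f, maps_of_carries hf⟩, Maps.eq_conjHom _ hf⟩
  π_orbit φ ψ := conjHom_eq_iff φ ψ
  free_right {P Q} φ e _ h := by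
    let _ := L.memberCategory
    exact cancel_left_hom (h.trans (Category.id_comp φ).symm)
  free_left {P Q} φ e _ h := by
    let _ := L.memberCategory
    exact hom_ext (cancel_right_hom (h.trans (Category.comp_id φ).symm))
  δ_injective g h hg hh e := L.ι_injective (congrArg MapsHom.val e)
  π_δ g hg := Maps.eq_conjHom _ fun x => carries_ι g x
  comm {P Q} φ g := by
    let _ := L.memberCategory
    obtain ⟨k, h₁, h₂⟩ := exists_isProd_comm ((MapsHom.maps φ).carries g)
    exact hom_ext ((IsProd.unique (isProd_mprod _) h₁).trans (h₂.unique (isProd_mprod _)))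
  sylow T hT := by
    let _ := L.memberCategory
    obtain ⟨A, hA⟩ := exists_sylow hS T hT
    exact ⟨A, fun a => (hA a).trans ⟨fun ⟨g, hg⟩ => ⟨g, mem_transporter_top hT g, hom_ext hg⟩,
      fun ⟨g, _, e⟩ => ⟨g, congrArg MapsHom.val e⟩⟩⟩
  extend {P Q P' Q'} φ hP hQ nP nQ h := by
    let _ := L.memberCategory
    -- The extension is the same element of the locality: the hypothesis of axiom (II) says
    -- precisely that it conjugates `P'` into `Q'`.
    refine ⟨⟨MapsHom.val φ.hom, fun g hg => ?_⟩, hom_ext ?_⟩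
    · obtain ⟨k, hk, e⟩ := h g hg
      exact ⟨k, hk, carries_of_conj _ (congrArg MapsHom.val e)⟩
    · have h₁ := IsProd.one_right (MapsHom.val φ.hom)
      have h₂ := IsProd.one_left (MapsHom.val φ.hom)
      rw [← ι_one] at h₁ h₂
      exact (IsProd.unique (isProd_mprod _) h₁).trans (h₂.unique (isProd_mprod _))

end Locality

/-! ### The locality of the transporter system of a locality -/

namespace Locality

open PartialGroup

variable {p : ℕ} {S : Type u} [Group S] {L : Locality p S}

section

variable [Fact p.Prime] {hS : IsPGroup p S} {F : FusionSystem S} {hF : L.InducedBy F}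

/-- The element of the locality underlying a morphism of its transporter system. -/
def val {P Q : (L.transporterSystem hS F hF).Ob} (φ : P ⟶ Q) : L.carrier := MapsHom.val φ

theorem val_injective {P Q : (L.transporterSystem hS F hF).Ob} {φ ψ : P ⟶ Q}
    (h : val φ = val ψ) : φ = ψ := MapsHom.ext h

theorem isProd_val {P Q R : (L.transporterSystem hS F hF).Ob} (φ : P ⟶ Q) (ψ : Q ⟶ R) :
    IsProd [val ψ, val φ] (val (φ ≫ ψ)) := isProd_mprod _

theorem val_incl {P Q : (L.transporterSystem hS F hF).Ob} (h : P.sub ≤ Q.sub) :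
    val ((L.transporterSystem hS F hF).incl h) = one L.carrier := L.ι_one

theorem val_incl_comp {P Q R : (L.transporterSystem hS F hF).Ob} (h : P.sub ≤ Q.sub)
    (φ : Q ⟶ R) : val ((L.transporterSystem hS F hF).incl h ≫ φ) = val φ := by
  have h₁ := isProd_val ((L.transporterSystem hS F hF).incl h) φ
  rw [val_incl] at h₁
  exact h₁.unique (IsProd.one_right _)

theorem val_comp_incl {P Q R : (L.transporterSystem hS F hF).Ob} (φ : P ⟶ Q)
    (h : Q.sub ≤ R.sub) : val (φ ≫ (L.transporterSystem hS F hF).incl h) = val φ := by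
  have h₁ := isProd_val φ ((L.transporterSystem hS F hF).incl h)
  rw [val_incl] at h₁
  exact h₁.unique (IsProd.one_left _)

/-- The element of the locality underlying a class of isomorphisms. -/
def clsVal : (L.transporterSystem hS F hF).Cls → L.carrier :=
  Quot.lift (fun φ => val φ.iso.hom) fun φ₀ φ ⟨h, h', e⟩ => by
    rw [← val_incl_comp h φ.iso.hom, e, val_comp_incl]

theorem clsVal_homCls {P Q : (L.transporterSystem hS F hF).Ob} (φ : P ⟶ Q) :
    clsVal ((L.transporterSystem hS F hF).homCls φ) = val φ := by
  obtain ⟨R, hR, ψ, rfl⟩ := (L.transporterSystem hS F hF).exists_factor φ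
  rw [TransporterSystem.homCls_comp_incl, TransporterSystem.homCls_iso, val_comp_incl]
  rfl

/-- Morphisms with the same underlying element `f` are all restrictions of the one that `f` defines
on `domSub f`, so they share a class. -/
theorem clsVal_injective :
    Function.Injective (clsVal : (L.transporterSystem hS F hF).Cls → L.carrier) := by
  intro f g h
  obtain ⟨A, a, rfl⟩ := TransporterSystem.exists_homCls_eq _ f
  obtain ⟨B, b, rfl⟩ := TransporterSystem.exists_homCls_eq _ g
  rw [clsVal_homCls, clsVal_homCls] at h
  have hA : A.sub ≤ L.domSub (val a) := (MapsHom.maps a).le_domSub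
  have hB : B.sub ≤ L.domSub (val a) := h ▸ (MapsHom.maps b).le_domSub
  let J : (L.transporterSystem hS F hF).Ob := ⟨L.domSub (val a), domSub_mem _⟩
  let c : J ⟶ (L.transporterSystem hS F hF).top := ⟨val a, maps_domSub _⟩
  have ha : (L.transporterSystem hS F hF).incl (P := A) (Q := J) hA ≫ c = a :=
    val_injective (val_incl_comp _ c)
  have hb : (L.transporterSystem hS F hF).incl (P := B) (Q := J) hB ≫ c = b :=
    val_injective ((val_incl_comp _ c).trans h)
  rw [← ha, ← hb, TransporterSystem.homCls_incl_comp, TransporterSystem.homCls_incl_comp]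

theorem clsVal_surjective :
    Function.Surjective (clsVal : (L.transporterSystem hS F hF).Cls → L.carrier) := fun f => by
  let J : (L.transporterSystem hS F hF).Ob := ⟨L.domSub f, domSub_mem _⟩
  let c : J ⟶ (L.transporterSystem hS F hF).top := ⟨f, maps_domSub _⟩
  exact ⟨_, clsVal_homCls c⟩

theorem conjChain_isProd_of_repWord {w : List (L.transporterSystem hS F hF).Cls}
    {P Q : (L.transporterSystem hS F hF).Ob} {φ : P ≅ Q}
    (h : RepWord (L.transporterSystem hS F hF).cls w φ) :
    ConjChain L.ι L.Δ (w.map clsVal) P.sub Q.sub ∧ IsProd (w.map clsVal) (val φ.hom) := by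
  induction h with
  | nil P => exact ⟨.nil _ P.mem, isProd_nil⟩
  | cons w φ ψ _ ih =>
    have hc := ih.1.cons_of_acts (acts_of_iso ψ)
    refine ⟨hc, ?_⟩
    obtain ⟨t, ht⟩ := exists_isProd (mem_D_of_conjChain hc)
    have h₁ : IsProd [val ψ.hom, val φ.hom] t :=
      IsProd.assoc (u := [val ψ.hom]) (v := w.map clsVal) (w := [])
        ((List.append_nil (val ψ.hom :: w.map clsVal)).symm ▸ ht) ih.2
    rw [h₁.unique (isProd_val φ.hom ψ.hom)] at ht
    exact ht

theorem repWord_of_conjChain {w : List (L.transporterSystem hS F hF).Cls} {X Y : Subgroup S}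
    (h : ConjChain L.ι L.Δ (w.map clsVal) X Y) : ∃ (hX : X ∈ L.Δ) (hY : Y ∈ L.Δ)
      (φ : (⟨X, hX⟩ : (L.transporterSystem hS F hF).Ob) ≅ ⟨Y, hY⟩),
        RepWord (L.transporterSystem hS F hF).cls w φ := by
  induction w generalizing Y with
  | nil =>
    obtain ⟨rfl, hX⟩ := h.nil_inv
    exact ⟨hX, hX, _, .nil _⟩
  | cons f w ih =>
    obtain ⟨Z, hZ, hY, ha⟩ := ConjChain.cons_inv h
    obtain ⟨hX, hZ, φ, hφ⟩ := ih hZ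
    let ψ : (⟨Z, hZ⟩ : (L.transporterSystem hS F hF).Ob) ≅ ⟨Y, hY⟩ := isoOfActs ha
    have hψ : (L.transporterSystem hS F hF).cls ⟨ψ⟩ = f := clsVal_injective rfl
    exact ⟨hX, hY, φ ≪≫ ψ, hψ ▸ .cons _ _ _ hφ⟩

variable [Finite S] [Group.IsNilpotent S]

/-- The locality of the transporter system of a locality `L` is isomorphic to `L`. -/
noncomputable def transporterSystemLocality :
    (L.transporterSystem hS F hF).locality.Iso L where
  toEquiv := Equiv.ofBijective clsVal ⟨clsVal_injective, clsVal_surjective⟩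
  mem_iff w := by
    constructor
    · intro h
      obtain ⟨X, Y, h⟩ := (L.domain _).1 h
      obtain ⟨_, _, φ, h⟩ := repWord_of_conjChain h
      exact ⟨_, _, φ, h⟩
    · rintro ⟨_, _, φ, h⟩
      exact mem_D_of_conjChain (conjChain_isProd_of_repWord h).1
  map_prod w hw := by
    obtain ⟨_, _, φ, h⟩ := id hw
    exact (congrArg clsVal (TransporterSystem.mprod_eq _ hw h)).trans
      ((conjChain_isProd_of_repWord h).2.unique (isProd_mprod _))
  map_Δ := Set.image_congr fun P _ => by
    rw [Set.image_image]
    rfl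

end

end Locality

/-! ### Equivalence of the categories -/

section

variable {p : ℕ} [Fact p.Prime]

/-- The fusion system of `T` itself serves: (A2) lifts its morphisms to `T`, and their classes
induce the conjugation maps. In either direction `Q` contains a conjugate of `P`, so it is an
object. -/
theorem saturated_localityFunctor (T : TransporterCat.{u} p) (h : TransporterCat.saturated p T) :
    LocalityCat.saturated p ((localityFunctor p).obj T) := by
  refine ⟨T.sys.fusion, h, fun P hP Q φ => ⟨fun hφ => ?_, fun ⟨f, hf⟩ => ?_⟩⟩
  · have hQ : Q ∈ T.sys.Δ := by
      obtain ⟨R, hR, e, he, he', -⟩ := T.sys.fusion.factor φ hφ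
      exact T.sys.over_closed _ _ (T.sys.conj_closed _ _ hP ⟨e, he, he'⟩) hR
    obtain ⟨ψ, rfl⟩ := T.sys.π_surjective (P := ⟨P, hP⟩) (Q := ⟨Q, hQ⟩) φ hφ
    exact ⟨T.sys.homCls ψ, fun x => T.sys.carries_homCls ψ x⟩
  · have hm : ∀ x ∈ P, ∃ y ∈ Q, PartialGroup.Carries T.sys.emb f x y :=
      fun x hx => ⟨_, (φ ⟨x, hx⟩).2, hf ⟨x, hx⟩⟩
    obtain ⟨ψ, hψ⟩ := T.sys.exists_homCls_of_maps (P := ⟨P, hP⟩)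
      (Q := ⟨Q, T.sys.mem_Δ_of_carries hP hm⟩) hm
    have : T.sys.π ψ = φ := MonoidHom.ext fun x =>
      Subtype.ext (T.sys.emb_injective ((hψ ▸ T.sys.carries_homCls ψ x).unique (hf x)))
    exact this ▸ T.sys.π_mem ψ

/-- Leaving `F` free lets one construction give essential surjectivity in all four settings, with
`F` saturated when required; the isomorphism is the identity on `S`, which covers the rigid
versions. -/
theorem exists_localityFunctor_iso (X : LocalityCat.{u} p) (F : FusionSystem X.S)
    (hF : X.loc.InducedBy F) : ∃ (T : TransporterCat.{u} p) (i : (localityFunctor p).obj T ≅ X),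
      LocalityCat.rigid p i.hom ∧ LocalityCat.rigid p i.inv ∧
        (F.Saturated p → TransporterCat.saturated p T) := by
  let T : TransporterCat.{u} p := ⟨X.S, X.loc.transporterSystem X.S.isPGroup F hF⟩
  let β : T.sys.locality.Iso X.loc :=
    Locality.transporterSystemLocality (hS := X.S.isPGroup) (hF := hF)
  exact ⟨T, ⟨β, β.symm, Locality.Iso.ext (Equiv.self_trans_symm _),
    Locality.Iso.ext (Equiv.symm_trans_self _)⟩, ⟨rfl, fun s => rfl⟩,
    ⟨rfl, fun s => (Equiv.symm_apply_eq β.toEquiv).2 rfl⟩, id⟩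

instance isEquivalence_localityFunctor : (localityFunctor.{u} p).IsEquivalence where
  essSurj := ⟨fun X => by
    obtain ⟨T, i, -⟩ := exists_localityFunctor_iso X _ Locality.inducedBy_fusion
    exact ⟨T, ⟨i⟩⟩⟩

theorem isEquivalence_restrictRigid :
    (restrictRigid (localityFunctor.{u} p) fun _ _ α h => localityFunctor_rigid α h).IsEquivalence where
  faithful := ⟨fun h => by
    ext1
    exact (localityFunctor p).map_injective (congrArg InducedWideCategory.Hom.hom h)⟩
  full := ⟨fun {X Y} β => by
    obtain ⟨α, hα, hr⟩ := localityFunctor_map_surjective β.hom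
    exact ⟨⟨α, hr β.property⟩, by ext1; exact hα⟩⟩
  essSurj := ⟨fun X => by
    obtain ⟨T, i, h, h', -⟩ := exists_localityFunctor_iso X.obj _ Locality.inducedBy_fusion
    exact ⟨⟨T⟩, ⟨⟨i.hom, h⟩, ⟨i.inv, h'⟩, by ext1; exact i.hom_inv_id,
      by ext1; exact i.inv_hom_id⟩⟩⟩

theorem isEquivalence_restrictFull_saturated :
    (restrictFull (localityFunctor.{u} p) (TransporterCat.saturated p) (LocalityCat.saturated p)
      saturated_localityFunctor).IsEquivalence where
  faithful := ⟨fun h => by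
    have h' := congrArg InducedCategory.Hom.hom h
    ext1
    exact (localityFunctor p).map_injective h'⟩
  full := ⟨fun {X Y} β => by
    obtain ⟨α, hα, -⟩ := localityFunctor_map_surjective β.hom
    exact ⟨⟨α⟩, by ext1; exact hα⟩⟩
  essSurj := ⟨fun X => by
    obtain ⟨F, hF, h⟩ := X.property
    obtain ⟨T, i, -, -, hT⟩ := exists_localityFunctor_iso X.obj F h
    exact ⟨⟨T, hT hF⟩, ⟨ObjectProperty.isoMk _ i⟩⟩⟩

theorem isEquivalence_restrictFull_restrictRigid :
    (restrictFull
      (restrictRigid (localityFunctor.{u} p) fun _ _ α h => localityFunctor_rigid α h)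
      ((TransporterCat.saturated p).inverseImage (wideSubcategoryInclusion _))
      ((LocalityCat.saturated p).inverseImage (wideSubcategoryInclusion _))
      (fun T hT => saturated_localityFunctor T.obj hT)).IsEquivalence where
  faithful := ⟨fun h => by
    have h' := congrArg InducedCategory.Hom.hom h
    ext1
    exact isEquivalence_restrictRigid.faithful.map_injective h'⟩
  full := ⟨fun {X Y} β => by
    obtain ⟨α, hα⟩ := isEquivalence_restrictRigid.full.map_surjective β.hom
    exact ⟨⟨α⟩, by ext1; exact hα⟩⟩
  essSurj := ⟨fun X => by
    obtain ⟨F, hF, h⟩ := X.property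
    obtain ⟨T, i, hi, hi', hT⟩ := exists_localityFunctor_iso X.obj.obj F h
    exact ⟨⟨⟨T⟩, hT hF⟩, ⟨ObjectProperty.isoMk _ ⟨⟨i.hom, hi⟩, ⟨i.inv, hi'⟩,
      by ext1; exact i.hom_inv_id, by ext1; exact i.inv_hom_id⟩⟩⟩⟩

/-- Isomorphisms of localities are bijections with evident inverses, and a fully faithful functor
reflects invertibility. -/
theorem isGroupoid_transporterCat : IsGroupoid (TransporterCat.{u} p) where
  all_isIso α :=
    have := LocalityCat.isIso ((localityFunctor p).map α)
    isIso_of_reflects_iso α (localityFunctor p)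

end

theorem theoremT (p : ℕ) [Fact p.Prime] :
    IsGroupoid (TransporterCat.{u} p) ∧ IsGroupoid (LocalityCat.{u} p) ∧
    ∃ (Λ : TransporterCat.{u} p ⥤ LocalityCat.{u} p)
      (cls : ∀ T : TransporterCat.{u} p, T.sys.IsoSet → (Λ.obj T).loc.carrier)
      (hrigid : ∀ ⦃T T' : TransporterCat.{u} p⦄ (α : T ⟶ T'), TransporterCat.rigid p α →
        LocalityCat.rigid p (Λ.map α))
      (hsat : ∀ T : TransporterCat.{u} p, TransporterCat.saturated p T →
        LocalityCat.saturated p (Λ.obj T)),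
      (∀ T, IsLocalityOf T (Λ.obj T) (cls T)) ∧
      (∀ (T T' : TransporterCat.{u} p) (α : T ⟶ T') (φ : T.sys.IsoSet),
        (LocalityCat.toIso (Λ.map α)).toEquiv (cls T φ) =
          cls T' ((TransporterCat.toIso α).mapIso φ)) ∧
      Λ.IsEquivalence ∧
      (restrictRigid Λ hrigid).IsEquivalence ∧
      (restrictFull Λ (TransporterCat.saturated p) (LocalityCat.saturated p) hsat).IsEquivalence ∧
      (restrictFull (restrictRigid Λ hrigid)
        ((TransporterCat.saturated p).inverseImage (wideSubcategoryInclusion _))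
        ((LocalityCat.saturated p).inverseImage (wideSubcategoryInclusion _))
        (fun T hT => hsat T.obj hT)).IsEquivalence ∧
      ∀ T : TransporterCat.{u} p, ∃ Φ : Aut T ≃* Aut (Λ.obj T),
        (∀ (α : Aut T) (φ : T.sys.IsoSet),
          (LocalityCat.toIso (Φ α).hom).toEquiv (cls T φ) =
            cls T ((TransporterCat.toIso α.hom).mapIso φ)) ∧
        Φ '' {α | TransporterCat.rigid p α.hom} = {β | LocalityCat.rigid p β.hom} := by
  refine ⟨isGroupoid_transporterCat, ⟨LocalityCat.isIso⟩, localityFunctor p, fun T => T.sys.cls,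
    fun _ _ α h => localityFunctor_rigid α h, saturated_localityFunctor,
    isLocalityOf_localityFunctor, fun _ _ _ _ => rfl, isEquivalence_localityFunctor,
    isEquivalence_restrictRigid, isEquivalence_restrictFull_saturated,
    isEquivalence_restrictFull_restrictRigid, fun T => ?_⟩
  let Φ := (Functor.FullyFaithful.ofFullyFaithful (localityFunctor p)).autMulEquivOfFullyFaithful T
  have hΦ : ∀ α : Aut T, (Φ α).hom = (localityFunctor p).map α.hom := fun _ => rfl
  refine ⟨Φ, fun _ _ => rfl, Set.Subset.antisymm ?_ fun β hβ => ?_⟩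
  · rintro _ ⟨α, hα, rfl⟩
    exact localityFunctor_rigid α.hom hα
  · obtain ⟨α, rfl⟩ := Φ.surjective β
    refine ⟨α, ?_, rfl⟩
    -- The lift constructed from a rigid isomorphism is rigid, and by faithfulness it coincides with
    -- `α`.
    obtain ⟨α', hα', hr⟩ := localityFunctor_map_surjective (Φ α).hom
    have : α' = α.hom := (localityFunctor p).map_injective (hα'.trans (hΦ α))
    change TransporterCat.rigid p α.hom
    rw [← this]
    exact hr hβ
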